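/- **Conventions.** Qubit registers, states and trace distance $\mathrm{TD}(\rho,\sigma)=\frac12\|\rho-\sigma\|_1$ are as usual. *General quantum circuits.* A general quantum circuit has input qubits, prepares ancilla qubits in state $|0\rangle$, applies a list of instructions (a gate from $\{H,T,\mathrm{CNOT}\}$, a measurement of a qubit in the computational basis, or a reset, i.e. tracing out a qubit and preparing a new $|0\rangle$ in its place) and outputs a list of its wires, all other wires being traced out. Its size is the number of instructions plus the number of ancillas prepared. It is written down as a string over a fixed finite alphabet: one symbol per ancilla, then the instructions, then the output wires, where wires are named by indices in binary (input qubits by the pair: number of the copy, number of the qubit in the copy). For $t:\mathbb N\to\mathbb R^+$ a family $(C_n)$ is *$t$-time-uniform* if $C_n$ has size at most $\mathrm{poly}(n,t(n))$ and a (multi-stack, equivalently multi-tape) Turing machine writes down $C_n$ on input $1^n$ in time $O(t(n))$. *Descriptions of unitary circuits.* Given $q$, a bit string describes a unitary circuit on $q$ wires as a circuit diagram: it is cut into layers of $q$ cells of three bits, one cell per wire (an incomplete last layer is ignored); a cell marks its wire as idle, $H$, $T$, control or target ($001=H$, $010=T$, $011=$ control, $100=$ target, all other triples idle); the layer applies the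 marked one-qubit gates, and then a $\mathrm{CNOT}$ from each control wire to each target wire. The $n$-qubit state prepared by such a circuit on $n+a$ wires is obtained by starting from $|0^{n+a}\rangle$, applying the layers in order and tracing out the last $a$ wires. *Learning.* Let $\mathcal C=\bigcup_{n\ge1}\mathcal C_n$, where $\mathcal C_n$ is a set of $n$-qubit pure states. $\mathcal C$ is *$(m,t,\varepsilon,\delta)$-learnable* if there are a $t$-time-uniform family of general quantum circuits $(C_n)$, where $C_n$ takes $m(n)$ copies of an $n$-qubit state, and numbers $a(n)$, computable in unary from $1^n$ in time $O(t(n))$, such that for every $n\ge1$ and every $|\psi\rangle\in\mathcal C_n$ the following holds with probability at least $1-\delta(n)$: the bit string obtained by running $C_n$ on $|\psi\rangle^{\otimes m(n)}$ and measuring the output wires describes a unitary circuit on $n+a(n)$ wires that prepares an $n$-qubit state $\hat\rho$ with $\mathrm{TD}(|\psi\rangle\langle\psi|,\hat\rho)\le\varepsilon(n)$. *Distinguishing.* $\mathcal C$ is *$(m,t,\varepsilon)$-distinguishable* (from Haar random states) if there is a $t$-time-uniform family of general quantum circuits $(C_n)$ with one output qubit, where $C_n$ takes $m(n)$ copies of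 an $n$-qubit state, such that for all sufficiently large $n$ and every $\rho\in\mathcal C_n$ $$\Bigl|\mathrm{tr}\bigl[|1\rangle\langle1|\,C_n(\rho^{\otimes m(n)})\bigr]-\mathop{\mathbf E}_{|\psi\rangle\sim\mu_{\mathrm{Haar}}}\mathrm{tr}\bigl[|1\rangle\langle1|\,C_n(|\psi\rangle\langle\psi|^{\otimes m(n)})\bigr]\Bigr|\ \ge\ \varepsilon(n).$$ **Lemma.** Let $\mathcal C=\bigcup_{n\ge1}\mathcal C_n$ be a class of pure states, let $m:\mathbb N\to\mathbb N$ and $\eta,\lambda:\mathbb N\to\mathbb R$, and let $t:\mathbb N\to\mathbb R^+$ be a time bound that is at least linear, $n=O(t(n))$. Suppose that $\eta(n)\ge2^{-o(n)}$, $\lambda(n)\ge2^{-o(n)}$, $m(n)\le2^{o(n)}$, and that $\mathcal C$ is $(m,t,1-\eta,1-\lambda)$-learnable. Then $\mathcal C$ is $\bigl(m+1,\ t\log t,\ \tfrac{1-o(1)}2\,\eta\lambda\bigr)$-distinguishable; that is, there is a function $g$ with $g(n)\to0$ such that $\mathcal C$ is $\bigl(m+1,\ t\log_2 t,\ \tfrac{1-g}2\,\eta\lambda\bigr)$-distinguishable.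 -/

import Mathlib

open Filter Topology Asymptotics MeasureTheory

namespace QLearn

noncomputable section

/-! ### Registers, states, trace distance -/

/-- Operators on a register whose qubits are labelled by `W`, in the computational basis. -/
abbrev Op (W : Type) : Type := Matrix (W → Bool) (W → Bool) ℂ

/-- Vectors of the Hilbert space of a register whose qubits are labelled by `W`. -/
abbrev Ket (W : Type) : Type := EuclideanSpace ℂ (W → Bool)

/-- The rank-one operator `|ψ⟩⟨ψ|`. -/
def ketBra {W : Type} (ψ : Ket W) : Op W := Matrix.of fun x y => ψ x * star (ψ y)

/-- `ρ` is the density matrix of a pure state. -/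
def IsPureState {W : Type} [Fintype W] [DecidableEq W] (ρ : Op W) : Prop :=
  ∃ ψ : Ket W, ‖ψ‖ = 1 ∧ ρ = ketBra ψ

/-- The trace norm `‖A‖₁`: the sum of the singular values of `A`. -/
def traceNorm {W : Type} [Fintype W] [DecidableEq W] (A : Op W) : ℝ :=
  ∑ i, Real.sqrt ((Matrix.isHermitian_conjTranspose_mul_self A).eigenvalues i)

/-- The trace distance `½ ‖ρ - σ‖₁`. -/
def traceDist {W : Type} [Fintype W] [DecidableEq W] (ρ σ : Op W) : ℝ :=
  traceNorm (ρ - σ) / 2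

/-- `ρ^{⊗ m}`; qubit `(c, j)` is the `j`-th qubit of the `c`-th copy. -/
def copies {n : ℕ} (m : ℕ) (ρ : Op (Fin n)) : Op (Fin m × Fin n) :=
  Matrix.of fun x y => ∏ c : Fin m, ρ (fun j => x (c, j)) (fun j => y (c, j))

/-- The Haar (uniform) probability measure on the unit vectors of an `n`-qubit register:
normalized surface measure of the unit sphere. -/
def haarState (n : ℕ) : Measure (Metric.sphere (0 : Ket (Fin n)) 1) :=
  ((volume : Measure (Ket (Fin n))).toSphere Set.univ)⁻¹ •
    (volume : Measure (Ket (Fin n))).toSphere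

/-! ### Quantum circuits over `{H, CNOT, T}` -/

/-- The unitary gates on a set `W` of wires. -/
inductive UGate (W : Type) : Type
  | had (w : W)
  | tee (w : W)
  | cnot (c t : W) (h : c ≠ t)

/-- The matrix of the Hadamard gate. -/
def hadMatrix : Matrix Bool Bool ℂ :=
  Matrix.of fun a b => (if a && b then -1 else 1) / (Real.sqrt 2 : ℂ)

/-- The matrix of the gate `T = diag(1, e^{iπ/4})`. -/
def teeMatrix : Matrix Bool Bool ℂ :=
  Matrix.diagonal fun a => if a then Complex.exp (Complex.I * (Real.pi / 4)) else 1

/-- A one-qubit operator applied to wire `w`. -/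
def onWire {W : Type} [DecidableEq W] [Fintype W] (u : Matrix Bool Bool ℂ) (w : W) : Op W :=
  Matrix.of fun x y => if ∀ v, v ≠ w → x v = y v then u (x w) (y w) else 0

/-- The unitary matrix of a gate. -/
def UGate.mat {W : Type} [DecidableEq W] [Fintype W] : UGate W → Op W
  | .had w => onWire hadMatrix w
  | .tee w => onWire teeMatrix w
  | .cnot c t _ => Matrix.of fun x y => if x = Function.update y t (xor (y t) (y c)) then 1 else 0

/-- The instructions of a general quantum circuit on a set `W` of wires: unitary gates, the
measurement of a qubit in the computational basis, and tracing out a qubit and preparing a new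
one, in state `|0⟩`, in its place. (Wires can also be prepared at the beginning, and are traced
out at the end, see `QCircuit`.) -/
inductive Gate (W : Type) : Type
  | unitary (g : UGate W)
  | measure (w : W)
  | reset (w : W)

/-- The quantum channel of an instruction. -/
def Gate.apply {W : Type} [DecidableEq W] [Fintype W] : Gate W → Op W → Op W
  | .unitary g, ρ => g.mat * ρ * g.mat.conjTranspose
  | .measure w, ρ => Matrix.of fun x y => if x w = y w then ρ x y else 0
  | .reset w, ρ => Matrix.of fun x y =>
      if x w = false ∧ y w = false then
        ∑ b : Bool, ρ (Function.update x w b) (Function.update y w b)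
      else 0

/-- A general quantum circuit with input qubits labelled by `ι`. It prepares `anc` further qubits
in state `|0⟩`, applies a list of instructions, and outputs the wires listed in `outputs`; all
other wires are traced out. -/
structure QCircuit (ι : Type) : Type where
  anc : ℕ
  gates : List (Gate (ι ⊕ Fin anc))
  outputs : List (ι ⊕ Fin anc)

/-- The number of gates, with the preparations of ancilla qubits counted as gates. -/
def QCircuit.size {ι : Type} (C : QCircuit ι) : ℕ := C.anc + C.gates.length

/-- The input state together with the ancilla qubits in state `|0…0⟩`. -/
def QCircuit.start {ι : Type} (C : QCircuit ι) (ρ : Op ι) : Op (ι ⊕ Fin C.anc) :=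
  Matrix.of fun x y =>
    if ∀ k, x (Sum.inr k) = false ∧ y (Sum.inr k) = false then
      ρ (fun i => x (Sum.inl i)) (fun i => y (Sum.inl i))
    else 0

/-- The state of all wires after the last instruction. -/
def QCircuit.run {ι : Type} [DecidableEq ι] [Fintype ι] (C : QCircuit ι) (ρ : Op ι) :
    Op (ι ⊕ Fin C.anc) :=
  C.gates.foldl (fun σ g => g.apply σ) (C.start ρ)

open Classical in
/-- The probability that the string read on the output wires, measured in the computational
basis after the circuit was run on `ρ`, has the property `P`. -/
def QCircuit.probOf {ι : Type} [DecidableEq ι] [Fintype ι] (C : QCircuit ι) (ρ : Op ι)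
    (P : List Bool → Prop) : ℝ :=
  ∑ x : ι ⊕ Fin C.anc → Bool, if P (C.outputs.map x) then (C.run ρ x x).re else 0

/-! ### Descriptions of circuits written by Turing machines -/

/-- The alphabet in which Turing machines write down general quantum circuits. -/
inductive Sym : Type
  | bit (b : Bool)
  | sep
  | inp
  | anc
  | prep
  | had
  | tee
  | cnot
  | measure
  | reset
  | out

/-- A number in binary, with an end mark. -/
def symNat (k : ℕ) : List Sym := (Nat.bits k).map Sym.bit ++ [Sym.sep]

/-- The name of a wire: the pair of indices of an input qubit, or the index of an ancilla. -/
def symWire {m n a : ℕ} : (Fin m × Fin n) ⊕ Fin a → List Sym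
  | Sum.inl (c, j) => Sym.inp :: (symNat c ++ symNat j)
  | Sum.inr k => Sym.anc :: symNat k

/-- The description of an instruction: its kind and the names of the wires it acts on. -/
def symGate {m n a : ℕ} : Gate ((Fin m × Fin n) ⊕ Fin a) → List Sym
  | .unitary (.had w) => Sym.had :: symWire w
  | .unitary (.tee w) => Sym.tee :: symWire w
  | .unitary (.cnot c t _) => Sym.cnot :: (symWire c ++ symWire t)
  | .measure w => Sym.measure :: symWire w
  | .reset w => Sym.reset :: symWire w

/-- The description of a circuit acting on `m` copies of an `n`-qubit state: one symbol for each
ancilla that is prepared, the list of instructions, the list of output wires. -/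
def QCircuit.desc {m n : ℕ} (C : QCircuit (Fin m × Fin n)) : List Sym :=
  List.replicate C.anc Sym.prep ++ C.gates.flatMap symGate ++
    C.outputs.flatMap fun w => Sym.out :: symWire w

/-- Some Turing machine (with any fixed number of stacks, equivalently tapes) writes the string
`f n` on input `1ⁿ` in time `O(t n)`. -/
def WritableInTime {Γ : Type} (t : ℕ → ℝ) (f : ℕ → List Γ) : Prop :=
  ∃ M : Turing.TM2ComputableInTime Computability.unaryEncodeNat (id : List Γ → List Γ) f,
    (fun n => (M.time n : ℝ)) =O[atTop] t

/-- `t`-time-uniformity of a family of circuits, the `n`-th of which acts on `m n` copies of an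
`n`-qubit state. -/
def TimeUniform {m : ℕ → ℕ} (t : ℕ → ℝ) (C : ∀ n, QCircuit (Fin (m n) × Fin n)) : Prop :=
  (∃ k : ℕ, (fun n => ((C n).size : ℝ)) =O[atTop] fun n : ℕ => ((n : ℝ) + t n) ^ k) ∧
    WritableInTime t fun n => (C n).desc

/-! ### Descriptions of unitary circuits by bit strings

A bit string describes a unitary circuit on `q` wires as a circuit diagram: it is cut into cells
of three bits, and `q` consecutive cells form a layer, with one cell for each wire. -/

/-- The marks of a circuit diagram. -/
inductive Mark : Type
  | idle
  | had
  | tee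
  | control
  | target
  deriving DecidableEq

/-- The mark encoded by three bits. -/
def Mark.ofBits : Bool → Bool → Bool → Mark
  | false, false, true => .had
  | false, true, false => .tee
  | false, true, true => .control
  | true, false, false => .target
  | _, _, _ => .idle

/-- The mark in the `p`-th cell of the string `s`. -/
def markAt (s : List Bool) (p : ℕ) : Mark :=
  Mark.ofBits (s.getD (3 * p) false) (s.getD (3 * p + 1) false) (s.getD (3 * p + 2) false)

/-- The gates of a layer with marks `μ`: the marked one-qubit gates, and then a `CNOT` from each
wire marked as a control to each wire marked as a target. -/
def layerGates {q : ℕ} (μ : Fin q → Mark) : List (UGate (Fin q)) :=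
  ((List.finRange q).flatMap fun i =>
    match μ i with
    | .had => [UGate.had i]
    | .tee => [UGate.tee i]
    | _ => []) ++
  (List.finRange q).flatMap fun i => (List.finRange q).flatMap fun j =>
    if h : i ≠ j then
      (if μ i = .control ∧ μ j = .target then [UGate.cnot i j h] else [])
    else []

/-- The gates, in order of application, of the circuit on `q` wires that `s` describes. -/
def describedGates (q : ℕ) (s : List Bool) : List (UGate (Fin q)) :=
  (List.range (s.length / (3 * q))).flatMap fun l =>
    layerGates fun i : Fin q => markAt s (l * q + i)

/-- The vector to which a list of gates, applied in order, sends `|0…0⟩`. -/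
def gatesOnZero {q : ℕ} (gs : List (UGate (Fin q))) : (Fin q → Bool) → ℂ :=
  gs.foldl (fun v g => g.mat.mulVec v) (Pi.single (fun _ => false) 1)

/-- The `n`-qubit state prepared by the unitary circuit on `n + a` wires that `s` describes: all
wires are initialized to `|0⟩`, the gates are applied, the last `a` wires are traced out. -/
def preparedState (n a : ℕ) (s : List Bool) : Op (Fin n) :=
  Matrix.of fun x y => ∑ z : Fin a → Bool,
    gatesOnZero (describedGates (n + a) s) (Fin.append x z) *
      star (gatesOnZero (describedGates (n + a) s) (Fin.append y z))

/-! ### Learning and distinguishing -/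

/-- `(m, t, ε, δ)`-learnability of a class of states: `𝒞 n` is the set of its `n`-qubit members.
The learner is a `t`-time-uniform family of general quantum circuits, with a number `a n` of
ancilla wires for the circuits that it describes, which is also computed (in unary) in time
`O(t n)`. -/
def Learnable (𝒞 : ∀ n : ℕ, Set (Op (Fin n))) (m : ℕ → ℕ) (t ε δ : ℕ → ℝ) : Prop :=
  ∃ (C : ∀ n, QCircuit (Fin (m n) × Fin n)) (a : ℕ → ℕ),
    TimeUniform t C ∧
    WritableInTime t (fun n => Computability.unaryEncodeNat (a n)) ∧
    ∀ n, 1 ≤ n → ∀ ρ ∈ 𝒞 n,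
      1 - δ n ≤ (C n).probOf (copies (m n) ρ)
        fun s => traceDist ρ (preparedState n (a n) s) ≤ ε n

/-- `(m, t, ε)`-distinguishability of a class of states from Haar random states: `𝒞 n` is the set
of its `n`-qubit members. -/
def Distinguishable (𝒞 : ∀ n : ℕ, Set (Op (Fin n))) (m : ℕ → ℕ) (t ε : ℕ → ℝ) : Prop :=
  ∃ C : ∀ n, QCircuit (Fin (m n) × Fin n),
    TimeUniform t C ∧
    (∀ n, (C n).outputs.length = 1) ∧
    ∀ᶠ n in atTop, ∀ ρ ∈ 𝒞 n,
      ε n ≤ |(C n).probOf (copies (m n) ρ) (fun s => s = [true]) -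
        ∫ ψ, (C n).probOf (copies (m n) (ketBra (ψ : Ket (Fin n)))) (fun s => s = [true])
          ∂(haarState n)|

end

end QLearn

open QLearn

open Filter Topology Asymptotics MeasureTheory

namespace QLearn

noncomputable section

/-! ### Composing stack machines -/

section Machines

open Turing TM2 Function

/-! The distinguisher runs the learner on copies 1, ..., m, lets a universal circuit execute
whatever circuit the learner's output wires describe, and compares the prepared state with copy 0 by
a swap test. For an output string a whose circuit prepares ρ_a, the test fails with probability (1 -
F_a)/2, where F_a = ⟨ψ|ρ_a|ψ⟩. Hence the output is 1 with probability (1 - M(ψ))/2, where M(ψ) is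
the mean of F_a over the outputs of the learner (`meanOverlap`, `probOf_distinguisher_eq`). The
output wires need not be measured: later gates use them only as controls, so on the diagonal of the
final state they behave like classical bits (`diag_matOf`).

On the class, M ≥ ηλ: with probability at least λ the trace distance is at most 1 - η, and F ≥ 1 -
TD for a pure ψ (`one_sub_traceDist_le_overlap`, `mul_probOf_le_meanOverlap`). For Haar random ψ the
mean of M is at most (m + 1)√(2/2^n) (`integral_meanOverlap_le`), which is o(ηλ) under the growth
hypotheses (`tendsto_haar_error`). The difference of the two acceptance probabilities is therefore
at least (1 - o(1))ηλ/2.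

The Haar bound uses only invariance under isometries. Multiplying the amplitudes of ψ by independent
N-th roots of unity preserves the measure. The probability of an output of the learner is a sum of
terms |L(ψ^{⊗m})|² with L linear (`exists_diag_run`), so as a function of the phases L is a
combination of characters indexed by the types of m-tuples of basis strings. The overlap contributes
one more character, and a given type of an (m+1)-tuple arises by adding one of at most m + 1
strings. Parseval and Cauchy-Schwarz then bound the phase average by the factor m + 1
(`sum_norm_sq_mul_phaseChar_le`, `ncard_tupleType_le`). What remains is controlled by the fourth
moments of the amplitudes, which beam splitters determine (`sum_integral_norm_pow_four`).

The universal circuit copies the three bits of each cell to work wires, applies gates controlled by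
them, and erases the copy (`act_cell`, `act_cellGates`). The CNOTs of a layer, quadratically many,
are replaced by linearly many gates through one parity wire (`flow_parity`), so the circuit has a
bounded number of gates per cell.

Uniformity is a string rewriting: the description of the distinguisher arises from that of the
learner by renaming wires and filling templates (`desc_distinguisher`). There are at most as many
cells as output wires, and naming the index of a cell in binary costs a logarithm; this is the
factor log t (`runs_distPre`, `WritableInTime.distOut`). New names avoid arithmetic: ancilla k
becomes 2k + 1, wire i of the described circuit 4i + 2, work wire k 8k + 4, which only prepends
fixed low digits. -/

/-- `c` leads to `c'` in exactly `n` steps. -/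
def Steps {K : Type} [DecidableEq K] {Γ : K → Type} {Λ σ : Type} (m : Λ → Stmt Γ Λ σ) :
    ℕ → Cfg Γ Λ σ → Cfg Γ Λ σ → Prop
  | 0, c, c' => c = c'
  | n + 1, c, c' => ∃ c₁, step m c = some c₁ ∧ Steps m n c₁ c'

variable {K : Type} [DecidableEq K] {Γ : K → Type} {Λ σ : Type}

theorem Steps.trans {m : Λ → Stmt Γ Λ σ} {a b : ℕ} {c c' c'' : Cfg Γ Λ σ}
    (h : Steps m a c c') (h' : Steps m b c' c'') : Steps m (a + b) c c'' := by
  induction a generalizing c with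
  | zero => cases h; simpa using h'
  | succ a ih =>
    obtain ⟨c₁, h₁, h₂⟩ := h
    rw [Nat.add_right_comm]
    exact ⟨c₁, h₁, ih h₂⟩

theorem flip_bind_iterate_none {α : Type} (f : α → Option α) (n : ℕ) :
    (flip Bind.bind f)^[n] none = none := by
  induction n with
  | zero => rfl
  | succ n ih => rw [iterate_succ_apply]; exact ih

/-- Running times of `FinTM2` are stated by iterating `step` in the option monad; the recursive form
is better suited to concatenating runs. -/
theorem steps_iff {m : Λ → Stmt Γ Λ σ} {n : ℕ} {c c' : Cfg Γ Λ σ} :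
    Steps m n c c' ↔ (flip Bind.bind (step m))^[n] (some c) = some c' := by
  induction n generalizing c with
  | zero => simp [Steps]
  | succ n ih =>
    rw [iterate_succ_apply]
    change (∃ c₁, step m c = some c₁ ∧ Steps m n c₁ c') ↔ (flip Bind.bind (step m))^[n] (step m c) = _
    cases h : step m c with
    | none => rw [flip_bind_iterate_none]; simp
    | some c₁ => simp [ih]

/-- The statement `q` of a machine on the stacks `K`, run on the stacks `ι k` of a bigger machine,
with `exit` in place of `halt`. -/
def liftStmt {K' : Type} {Γ' : K' → Type} {Λ' σ' : Type} (ι : K → K') (get : σ' → σ)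
    (set : σ → σ' → σ') (lab : Λ → Λ') (exit : Stmt Γ' Λ' σ') :
    Stmt (fun k => Γ' (ι k)) Λ σ → Stmt Γ' Λ' σ'
  | .push k f q => .push (ι k) (fun v => f (get v)) (liftStmt ι get set lab exit q)
  | .peek k f q => .peek (ι k) (fun v o => set (f (get v) o) v) (liftStmt ι get set lab exit q)
  | .pop k f q => .pop (ι k) (fun v o => set (f (get v) o) v) (liftStmt ι get set lab exit q)
  | .load f q => .load (fun v => set (f (get v)) v) (liftStmt ι get set lab exit q)
  | .branch f q₁ q₂ => .branch (fun v => f (get v)) (liftStmt ι get set lab exit q₁)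
      (liftStmt ι get set lab exit q₂)
  | .goto l => .goto fun v => lab (l (get v))
  | .halt => exit

/-- `S'` consists of `S` on the stacks `ι k` and of `F` on the other ones. -/
def Overlay {K' : Type} {Γ' : K' → Type} (ι : K → K') (F : ∀ k, List (Γ' k))
    (S : ∀ k, List (Γ' (ι k))) (S' : ∀ k, List (Γ' k)) : Prop :=
  (∀ k, S' (ι k) = S k) ∧ ∀ k', (∀ k, ι k ≠ k') → S' k' = F k'

theorem Overlay.update {K' : Type} [DecidableEq K'] {Γ' : K' → Type} {ι : K → K'}
    (hι : Injective ι) {F : ∀ k, List (Γ' k)} {S : ∀ k, List (Γ' (ι k))} {S' : ∀ k, List (Γ' k)}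
    (h : Overlay ι F S S') (k : K) (l : List (Γ' (ι k))) :
    Overlay ι F (update S k l) (update S' (ι k) l) := by
  refine ⟨fun j => ?_, fun k' hk' => ?_⟩
  · by_cases hj : j = k
    · subst hj; simp
    · rw [update_of_ne hj, update_of_ne (fun e => hj (hι e)), h.1]
  · rw [update_of_ne (fun e => hk' k e.symm), h.2 k' hk']

/-- A way to store a value of type `σ` in a value of type `σ'`. -/
structure Lens (σ σ' : Type) where
  get : σ' → σ
  set : σ → σ' → σ'
  get_set : ∀ a v, get (set a v) = a
  set_set : ∀ a b v, set a (set b v) = set a v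
  set_get : ∀ v, set (get v) v = v

section Lift

variable {K' : Type} [DecidableEq K'] {Γ' : K' → Type} {Λ' σ' : Type} {ι : K → K'}

/-- Each instruction touches one stack `ι k` and the component of the state seen by the lens, so the
other stacks stay equal to `F`. In place of `halt`, the statement `exit` is executed within the same
step, so that leaving a subprogram costs no time. -/
theorem stepAux_liftStmt (hι : Injective ι) (ls : Lens σ σ') (lab : Λ → Λ')
    (exit : Stmt Γ' Λ' σ') {F : ∀ k, List (Γ' k)}
    (q : Stmt (fun k => Γ' (ι k)) Λ σ) (v' : σ') (S : ∀ k, List (Γ' (ι k)))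
    (S' : ∀ k, List (Γ' k)) (h : Overlay ι F S S') :
    ∃ S₁', Overlay ι F (stepAux q (ls.get v') S).stk S₁' ∧
      stepAux (liftStmt ι ls.get ls.set lab exit q) v' S' =
        match (stepAux q (ls.get v') S).l with
        | some l => ⟨some (lab l), ls.set (stepAux q (ls.get v') S).var v', S₁'⟩
        | none => stepAux exit (ls.set (stepAux q (ls.get v') S).var v') S₁' := by
  induction q generalizing v' S S' with
  | push k f q ih =>
    have := ih v' _ _ (h.update hι k (f (ls.get v') :: S k))
    simpa [liftStmt, h.1] using this
  | peek k f q ih =>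
    have := ih (ls.set (f (ls.get v') (S k).head?) v') _ _ h
    simpa [liftStmt, h.1, ls.get_set, ls.set_set] using this
  | pop k f q ih =>
    have := ih (ls.set (f (ls.get v') (S k).head?) v') _ _ (h.update hι k (S k).tail)
    simpa [liftStmt, h.1, ls.get_set, ls.set_set] using this
  | load f q ih =>
    have := ih (ls.set (f (ls.get v')) v') _ _ h
    simpa [liftStmt, h.1, ls.get_set, ls.set_set] using this
  | branch f q₁ q₂ ih₁ ih₂ =>
    cases hf : f (ls.get v')
    · simpa [liftStmt, hf] using ih₂ v' _ _ h
    · simpa [liftStmt, hf] using ih₁ v' _ _ h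
  | goto l => exact ⟨S', h, by simp [liftStmt, ls.set_get]⟩
  | halt => exact ⟨S', h, by simp [liftStmt, ls.set_get]⟩

theorem Steps.lift (hι : Injective ι) (ls : Lens σ σ') {lab : Λ → Λ'}
    {exit : Stmt Γ' Λ' σ'} {F : ∀ k, List (Γ' k)} {m : Λ → Stmt (fun k => Γ' (ι k)) Λ σ}
    {m' : Λ' → Stmt Γ' Λ' σ'} (hm : ∀ l, m' (lab l) = liftStmt ι ls.get ls.set lab exit (m l))
    {n : ℕ} {l : Λ} {v₁ : σ} {v' : σ'} {S S₁ : ∀ k, List (Γ' (ι k))} {S' : ∀ k, List (Γ' k)}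
    (h : Overlay ι F S S') (hs : Steps m n ⟨some l, ls.get v', S⟩ ⟨none, v₁, S₁⟩) :
    ∃ S₁', Overlay ι F S₁ S₁' ∧
      Steps m' n ⟨some (lab l), v', S'⟩ (stepAux exit (ls.set v₁ v') S₁') := by
  induction n generalizing l v' S S' with
  | zero => cases hs
  | succ n ih =>
    obtain ⟨c₁, h₁, h₂⟩ := hs
    simp only [step, Option.some.injEq] at h₁
    obtain ⟨S₂, hS₂, h₃⟩ := stepAux_liftStmt hι ls lab exit (m l) v' S S' h
    rw [h₁] at h₃ hS₂
    rcases c₁ with ⟨l₁, w, T⟩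
    cases l₁ with
    | some l₁ =>
      have hw : ls.get (ls.set w v') = w := ls.get_set _ _
      obtain ⟨S₁', hS₁', h₄⟩ := ih (v' := ls.set w v') hS₂ (by rw [hw]; exact h₂)
      refine ⟨S₁', hS₁', _, ?_, by rw [ls.set_set] at h₄; exact h₄⟩
      simp only [step, hm, h₃]
    | none =>
      cases n with
      | zero =>
        cases h₂
        exact ⟨S₂, hS₂, _, by simp only [step, hm, h₃], rfl⟩
      | succ n =>
        obtain ⟨c₁, h₄, -⟩ := h₂
        simp at h₄

end Lift

/-- A program for stack machines with the stacks `Γ` and the internal states `σ`. -/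
structure Mach (Γ : K → Type) (σ : Type) where
  Λ : Type
  [fin : Fintype Λ]
  main : Λ
  m : Λ → Stmt Γ Λ σ

attribute [instance] Mach.fin

/-- Internal states with room for a symbol that was popped. -/
class Scratch (A : outParam Type) (σ : Type) extends Inhabited σ where
  put : Option A → σ
  get : σ → Option A
  get_put : ∀ o, get (put o) = o

/-- The program `P` transforms the stacks `S` to `S'` in at most `c` steps. -/
def Runs [Inhabited σ] (P : Mach Γ σ) (S S' : ∀ k, List (Γ k)) (c : ℕ) : Prop :=
  ∃ n ≤ c, Steps P.m n ⟨some P.main, default, S⟩ ⟨none, default, S'⟩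

theorem Runs.mono [Inhabited σ] {P : Mach Γ σ} {S S' : ∀ k, List (Γ k)} {c c' : ℕ}
    (h : Runs P S S' c) (hc : c ≤ c') : Runs P S S' c' := by
  obtain ⟨n, hn, h⟩ := h
  exact ⟨n, hn.trans hc, h⟩

theorem Runs.congr [Inhabited σ] {P : Mach Γ σ} {S S' S'' : ∀ k, List (Γ k)} {c c' : ℕ}
    (h : Runs P S S' c) (hS : S' = S'') (hc : c ≤ c') : Runs P S S'' c' :=
  hS ▸ h.mono hc

theorem Runs.congr' [Inhabited σ] {P : Mach Γ σ} {S T S' T' : ∀ k, List (Γ k)} {c c' : ℕ}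
    (h : Runs P S S' c) (hS : S = T) (hS' : S' = T') (hc : c ≤ c' := by exact le_rfl) :
    Runs P T T' c' :=
  hS ▸ hS' ▸ h.mono hc

def Lens.id (σ : Type) : Lens σ σ :=
  ⟨fun v => v, fun a _ => a, fun _ _ => rfl, fun _ _ _ => rfl, fun _ => rfl⟩

omit [DecidableEq K] in
theorem Overlay.eq_of_id {F S S' : ∀ k, List (Γ k)}
    (h : Overlay (Γ' := Γ) (fun k => k) F S S') : S' = S := funext h.1

/-- The program that pushes the symbols of `l`, the last one ending on top. -/
def Mach.pushList (k : K) (l : List (Γ k)) : Mach Γ σ where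
  Λ := Unit
  main := ()
  m _ := l.foldr (fun a q => .push k (fun _ => a) q) .halt

theorem stepAux_pushList (k : K) (l : List (Γ k)) (v : σ) (S : ∀ k, List (Γ k)) :
    stepAux (l.foldr (fun a q => Stmt.push k (fun _ => a) q) (.halt : Stmt Γ Λ σ)) v S =
      ⟨none, v, update S k (l.reverse ++ S k)⟩ := by
  induction l generalizing S with
  | nil => simp
  | cons a l ih =>
    simp only [List.foldr_cons, stepAux]
    rw [ih]
    simp

theorem runs_pushList [Inhabited σ] (k : K) (l : List (Γ k)) (S : ∀ k, List (Γ k)) :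
    Runs (Mach.pushList k l : Mach Γ σ) S (update S k (l.reverse ++ S k)) 1 := by
  exact ⟨1, le_rfl, _, rfl, stepAux_pushList k l default S⟩

/-- The program `P` followed by `Q`. -/
def Mach.seq (P Q : Mach Γ σ) : Mach Γ σ where
  Λ := P.Λ ⊕ Q.Λ
  main := .inl P.main
  m
    | .inl l => liftStmt (fun k => k) (Lens.id σ).get (Lens.id σ).set Sum.inl
        (.goto fun _ => .inr Q.main) (P.m l)
    | .inr l => liftStmt (fun k => k) (Lens.id σ).get (Lens.id σ).set Sum.inr .halt (Q.m l)

theorem Runs.seq [Inhabited σ] {P Q : Mach Γ σ} {S S' S'' : ∀ k, List (Γ k)} {c c' : ℕ}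
    (h : Runs P S S' c) (h' : Runs Q S' S'' c') : Runs (P.seq Q) S S'' (c + c') := by
  obtain ⟨n, hn, h⟩ := h
  obtain ⟨n', hn', h'⟩ := h'
  refine ⟨n + n', Nat.add_le_add hn hn', ?_⟩
  obtain ⟨S₁, hS₁, h₁⟩ := Steps.lift (m' := (P.seq Q).m) (lab := Sum.inl)
    (exit := .goto fun _ => .inr Q.main) (ι := fun k => k) (v' := default)
    (fun _ _ e => e) (Lens.id σ) (fun _ => rfl) (F := S) ⟨fun _ => rfl, fun k hk => rfl⟩ h
  obtain ⟨S₂, hS₂, h₂⟩ := Steps.lift (m' := (P.seq Q).m) (lab := Sum.inr)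
    (exit := .halt) (ι := fun k => k) (v' := default)
    (fun _ _ e => e) (Lens.id σ) (fun _ => rfl) (F := S') ⟨fun _ => rfl, fun k hk => rfl⟩ h'
  obtain rfl := hS₁.eq_of_id
  obtain rfl := hS₂.eq_of_id
  exact h₁.trans h₂

/-- The program that pops a symbol `a` from `k`, runs `f (some a)`, and starts again if
`cont a` holds; if the stack is empty, it runs `f none` and halts. -/
def Mach.popLoop {A : Type} [Fintype A] [Scratch A σ] (k : K) (e : Γ k → A) (cont : A → Bool)
    (f : Option A → Mach Γ σ) : Mach Γ σ where
  Λ := Option (Σ o : Option A, Option (f o).Λ)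
  main := none
  m
    | none => .pop k (fun _ o => Scratch.put (o.map e))
        (.goto fun v => some ⟨Scratch.get v, none⟩)
    | some ⟨o, none⟩ => .load (fun _ => default) (.goto fun _ => some ⟨o, some (f o).main⟩)
    | some ⟨o, some l⟩ => liftStmt (fun k => k) (Lens.id σ).get (Lens.id σ).set
        (fun l => some ⟨o, some l⟩) (if o.any cont then .goto fun _ => none else .halt) ((f o).m l)

section PopLoop

variable {A : Type} [Fintype A] [Scratch A σ] {k : K} {e : Γ k → A} {cont : A → Bool}
  {f : Option A → Mach Γ σ} {S S' S'' : ∀ k, List (Γ k)} {c c' : ℕ}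

/-- The two additional steps are the pop, after which the symbol travels from the internal state
into the label, and the reset of the internal state to `default`, from which the body must start.
The jump back to the loop is part of the last step of the body. -/
theorem popLoop_steps (h : Runs (f ((S k).head?.map e)) (update S k (S k).tail) S' c) :
    ∃ n ≤ c + 2, Steps (Mach.popLoop k e cont f).m n ⟨some none, default, S⟩
      (stepAux (if ((S k).head?.map e).any cont then .goto fun _ => none else .halt)
        default S') := by
  obtain ⟨n, hn, h⟩ := h
  obtain ⟨S₁, hS₁, h₁⟩ := Steps.lift (m' := (Mach.popLoop k e cont f).m)
    (lab := fun l => some ⟨_, some l⟩)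
    (exit := if ((S k).head?.map e).any cont then .goto fun _ => none else .halt)
    (ι := fun k => k) (v' := default)
    (fun _ _ e => e) (Lens.id σ) (fun _ => rfl) (F := S) (S := update S k (S k).tail)
    (S' := update S k (S k).tail) ⟨fun _ => rfl, fun k' hk => (hk k' rfl).elim⟩ h
  obtain rfl := hS₁.eq_of_id
  refine ⟨n + 2, by omega, ⟨some (some
    (Sigma.mk (β := fun o => Option (f o).Λ) ((S k).head?.map e) none)),
    Scratch.put ((S k).head?.map e), update S k (S k).tail⟩, ?_, _, rfl, h₁⟩
  change some (Cfg.mk (some (some (Sigma.mk (β := fun o => Option (f o).Λ)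
    (Scratch.get (Scratch.put ((S k).head?.map e))) none))) _ _) = _
  rw [Scratch.get_put]
  rfl

theorem runs_popLoop_nil (hk : S k = []) (h : Runs (f none) S S' c) :
    Runs (Mach.popLoop k e cont f) S S' (c + 2) := by
  obtain ⟨n, hn, hs⟩ := popLoop_steps (k := k) (e := e) (cont := cont) (f := f) (S := S) (S' := S')
    (c := c) (by
      have hS : update S k [] = S := by rw [← hk, update_eq_self]
      simpa only [hk, List.head?_nil, List.tail_nil, hS, Option.map_none] using h)
  simp only [hk, List.head?_nil, Option.map_none, Option.any_none] at hs
  exact ⟨n, hn, hs⟩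

theorem runs_popLoop_stop {a : Γ k} {l : List (Γ k)} (hk : S k = a :: l) (ha : cont (e a) = false)
    (h : Runs (f (some (e a))) (update S k l) S' c) :
    Runs (Mach.popLoop k e cont f) S S' (c + 2) := by
  obtain ⟨n, hn, hs⟩ := popLoop_steps (k := k) (e := e) (cont := cont) (f := f) (S := S) (S' := S')
    (c := c) (by simpa [hk] using h)
  simp only [hk, List.head?_cons, Option.map_some, Option.any_some, ha] at hs
  exact ⟨n, hn, hs⟩

theorem runs_popLoop_cont {a : Γ k} {l : List (Γ k)} (hk : S k = a :: l) (ha : cont (e a) = true)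
    (h : Runs (f (some (e a))) (update S k l) S' c)
    (h' : Runs (Mach.popLoop k e cont f) S' S'' c') :
    Runs (Mach.popLoop k e cont f) S S'' (c + 2 + c') := by
  obtain ⟨n, hn, hs⟩ := popLoop_steps (k := k) (e := e) (cont := cont) (f := f) (S := S) (S' := S')
    (c := c) (by simpa [hk] using h)
  simp only [hk, List.head?_cons, Option.map_some, Option.any_some, ha] at hs
  obtain ⟨n', hn', h'⟩ := h'
  exact ⟨n + n', by omega, hs.trans h'⟩

end PopLoop

/-- The program `P`, run on the stacks `ι k` of a bigger machine. -/
def Mach.lift {K' : Type} {Γ' : K' → Type} {σ' : Type} (ι : K → K') (ls : Lens σ σ')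
    (P : Mach (fun k => Γ' (ι k)) σ) : Mach Γ' σ' where
  Λ := P.Λ
  main := P.main
  m l := liftStmt ι ls.get ls.set (fun l => l) .halt (P.m l)

theorem Runs.lift {K' : Type} [DecidableEq K'] {Γ' : K' → Type} {σ' : Type} [Inhabited σ]
    [Inhabited σ'] {ι : K → K'} (hι : Injective ι) (ls : Lens σ σ')
    (hd : ls.get default = default)
    {P : Mach (fun k => Γ' (ι k)) σ} {F S' : ∀ k, List (Γ' k)} {S₁ : ∀ k, List (Γ' (ι k))} {c : ℕ}
    (h : Runs P (fun k => F (ι k)) S₁ c) (hS' : Overlay ι F S₁ S') : Runs (P.lift ι ls) F S' c := by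
  obtain ⟨n, hn, h⟩ := h
  refine ⟨n, hn, ?_⟩
  obtain ⟨S₂, hS₂, h₂⟩ := Steps.lift (m' := (P.lift ι ls).m) (lab := fun l => l)
    (exit := .halt) (ι := ι) (v' := default) hι ls (fun _ => rfl) (F := F)
    ⟨fun _ => rfl, fun k hk => rfl⟩ (by rw [hd]; exact h)
  have : S₂ = S' := by
    funext k'
    by_cases hk : ∃ k, ι k = k'
    · obtain ⟨k, rfl⟩ := hk
      rw [hS₂.1, hS'.1]
    · push Not at hk
      rw [hS₂.2 _ hk, hS'.2 _ hk]
  subst this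
  have hv : ls.set default default = default := by
    have := ls.set_get default
    rwa [hd] at this
  simp only [stepAux, hv] at h₂
  exact h₂

end Machines

end

end QLearn

namespace QLearn

noncomputable section

/-! ### The program that writes down the distinguisher -/

section Programs

open Turing TM2 Function

/-- Finiteness of the alphabet is required because `popLoop` stores the popped symbol in a label. -/
theorem range_sym : Surjective fun i : Fin 12 => ([Sym.bit false, .bit true, .sep, .inp, .anc, .prep, .had,
    .tee, .cnot, .measure, .reset, .out] : List Sym).get i := by
  rintro ((_ | _) | _ | _ | _ | _ | _ | _ | _ | _ | _ | _)
  exacts [⟨0, rfl⟩, ⟨1, rfl⟩, ⟨2, rfl⟩, ⟨3, rfl⟩, ⟨4, rfl⟩, ⟨5, rfl⟩, ⟨6, rfl⟩, ⟨7, rfl⟩, ⟨8, rfl⟩,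
    ⟨9, rfl⟩, ⟨10, rfl⟩, ⟨11, rfl⟩]

instance : Fintype Sym :=
  have := Finite.of_surjective _ range_sym
  Fintype.ofFinite Sym

instance : Scratch Sym (Option Sym) where
  put o := o
  get o := o
  get_put _ := rfl

/-- The stacks of the program. -/
inductive Stk : Type
  | N | A | D | E | I | J | X | Y | Z | L | G | R | Q | T | U | O
  deriving DecidableEq

instance : Fintype Stk :=
  ⟨{.N, .A, .D, .E, .I, .J, .X, .Y, .Z, .L, .G, .R, .Q, .T, .U, .O}, fun x => by
    cases x <;> decide⟩

abbrev Prog : Type 1 := Mach (fun _ : Stk => Sym) (Option Sym)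

/-- Roles of the stacks: `N`, `A` hold n and a(n) in unary; `D` the description of the learner; `E`
the text written so far, reversed; `I` the binary counter with work stack `J`; `X` the names of the
output wires still to be read, `Y` those already read, `Z` a cell during its first reading; `Q` one
mark per wire of the described circuit; `R` a backup of `Q` or `N`; `L`, `T`, `U`, `G` serve to
divide the number of output wires by 3(n + a); `O` receives the result. -/
abbrev Stacks : Type := Stk → List Sym

def push (k : Stk) (l : List Sym) : Prog := Mach.pushList k l

theorem runs_push (k : Stk) (l : List Sym) (S : Stacks) :
    Runs (push k l) S (update S k (l.reverse ++ S k)) 1 :=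
  runs_pushList (Γ := fun _ => Sym) k l S

def skip : Prog := push .N []

theorem runs_skip (S : Stacks) : Runs skip S S 1 := by
  simpa [skip] using runs_push .N [] S

def loop (k : Stk) (cont : Sym → Bool) (f : Option Sym → Prog) : Prog :=
  Mach.popLoop k (fun a => a) cont f

section Loop

variable {k : Stk} {cont : Sym → Bool} {f : Option Sym → Prog} {S S' S'' : Stacks} {c c' : ℕ}

theorem runs_loop_nil (hk : S k = []) (h : Runs (f none) S S' c) :
    Runs (loop k cont f) S S' (c + 2) :=
  runs_popLoop_nil hk h

theorem runs_loop_stop {a : Sym} {l : List Sym} (hk : S k = a :: l) (ha : cont a = false)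
    (h : Runs (f (some a)) (update S k l) S' c) : Runs (loop k cont f) S S' (c + 2) :=
  runs_popLoop_stop hk ha h

theorem runs_loop_cont {a : Sym} {l : List Sym} (hk : S k = a :: l) (ha : cont a = true)
    (h : Runs (f (some a)) (update S k l) S' c) (h' : Runs (loop k cont f) S' S'' c') :
    Runs (loop k cont f) S S'' (c + 2 + c') :=
  runs_popLoop_cont hk ha h h'

end Loop

/-- Empties the stack `k`, running `g a` for each symbol `a` that is popped. -/
def forEach (k : Stk) (g : Sym → Prog) : Prog :=
  loop k (fun _ => true) fun o => o.elim skip g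

/-- `post` predicts the final stacks from the current ones and must be preserved by the body; `cost`
is a potential that pays for each round and for the final empty pop. -/
theorem runs_forEach {k : Stk} {g : Sym → Prog} (Inv : Stacks → Prop) (post : Stacks → Stacks)
    (cost : Stacks → ℕ) (h₀ : ∀ S, Inv S → S k = [] → post S = S ∧ 3 ≤ cost S)
    (h₁ : ∀ S a l, Inv S → S k = a :: l → ∃ c S₁, Runs (g a) (update S k l) S₁ c ∧ S₁ k = l ∧
      Inv S₁ ∧ post S₁ = post S ∧ c + 2 + cost S₁ ≤ cost S)
    (S : Stacks) (hS : Inv S) : Runs (forEach k g) S (post S) (cost S) := by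
  generalize hl : S k = l
  induction l generalizing S with
  | nil =>
    obtain ⟨h, hc⟩ := h₀ S hS hl
    exact (runs_loop_nil hl (runs_skip S)).congr h.symm hc
  | cons a l ih =>
    obtain ⟨c, S₁, hr, hk, hi, hp, hc⟩ := h₁ S a l hS hl
    exact (runs_loop_cont hl rfl hr (ih S₁ hi hk)).congr hp hc

/-- Moves the contents of `k` to `k'`, reversing their order. -/
def move (k k' : Stk) : Prog := forEach k fun a => push k' [a]

theorem runs_move {k k' : Stk} (hk : k ≠ k') (S : Stacks) :
    Runs (move k k') S (update (update S k []) k' ((S k).reverse ++ S k'))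
      (3 * (S k).length + 3) := by
  refine runs_forEach (fun _ => True)
    (fun S => update (update S k []) k' ((S k).reverse ++ S k'))
    (fun S => 3 * (S k).length + 3) (fun S _ hS => ⟨?_, by omega⟩) (fun S a l _ hS => ?_) S trivial
  · funext j
    by_cases h₁ : j = k' <;> by_cases h₂ : j = k <;> simp_all
  · refine ⟨1, _, runs_push _ _ _, by simp [update_of_ne hk], trivial, ?_, ?_⟩
    · funext j
      by_cases h₁ : j = k' <;> by_cases h₂ : j = k <;>
        simp_all
    · simp [update_of_ne hk, hS]; omega

/-- Empties `k`. -/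
def clear (k : Stk) : Prog := forEach k fun _ => skip

theorem runs_clear (k : Stk) (S : Stacks) :
    Runs (clear k) S (update S k []) (3 * (S k).length + 3) := by
  refine runs_forEach (fun _ => True) (fun S => update S k [])
    (fun S => 3 * (S k).length + 3) (fun S _ hS => ⟨?_, by omega⟩) (fun S a l _ hS => ?_) S trivial
  · rw [← hS, update_eq_self]
  · exact ⟨1, _, runs_skip _, by simp, trivial, by simp, by simp [hS]; omega⟩

/-! #### Counters and templates -/

/-- The binary successor, lowest digit first. -/
def succBits : List Bool → List Bool
  | [] => [true]
  | false :: l => true :: l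
  | true :: l => false :: succBits l

theorem bits_succ (n : ℕ) : Nat.bits (n + 1) = succBits (Nat.bits n) := by
  induction n using Nat.binaryRec' with
  | zero => simp [succBits]
  | bit b n h ih =>
    rw [Nat.bits_append_bit _ _ h]
    cases b
    · have hn : n ≠ 0 := fun e => by simpa using h e
      have : Nat.bit false n + 1 = Nat.bit true n := by simp [Nat.bit]
      rw [this, Nat.bits_append_bit _ _ (by simp)]
      rfl
    · have : Nat.bit true n + 1 = Nat.bit false (n + 1) := by simp [Nat.bit]; omega
      rw [this, Nat.bits_append_bit _ _ (by simp), ih]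
      rfl

def symBits (i : ℕ) : List Sym := (Nat.bits i).map Sym.bit

/-- Adds `1` to the counter `I`, with `J` as a work stack. -/
def incr : Prog :=
  (loop .I (fun a => match a with | .bit true => true | _ => false) fun o =>
    match o with
    | some (.bit true) => push .J [.bit false]
    | _ => push .I [.bit true]).seq (move .J .I)

/-- Carry propagation: the leading ones become zeros collected on `J` (that is `l₁`), and the first
zero, or the end of the number, becomes a one on `I`. Moving `J` back completes the successor. -/
theorem runs_incr_loop (l : List Bool) (S : Stacks) (hI : S .I = l.map Sym.bit) :
    ∃ l₁ l₂ : List Bool, succBits l = l₁.reverse ++ l₂ ∧ l₁.length ≤ l.length ∧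
    Runs (loop .I (fun a => match a with | .bit true => true | _ => false) fun o =>
      match o with
      | some (.bit true) => push .J [.bit false]
      | _ => push .I [.bit true]) S
      (update (update S .I (l₂.map Sym.bit)) .J (l₁.map Sym.bit ++ S .J)) (3 * l.length + 3) := by
  induction l generalizing S with
  | nil =>
    refine ⟨[], [true], rfl, by simp, ?_⟩
    refine (runs_loop_nil hI (runs_push _ _ _)).congr ?_ (by simp)
    funext j; cases j <;> simp [hI]
  | cons b l ih =>
    cases b
    · refine ⟨[], true :: l, rfl, by simp, ?_⟩
      refine (runs_loop_stop (a := .bit false) hI rfl (runs_push _ _ _)).congr ?_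
        (by simp)
      funext j; cases j <;> simp
    · obtain ⟨l₁, l₂, h, hl, hr⟩ := ih (update (update S .I (l.map Sym.bit)) .J (.bit false :: S .J))
        (by simp)
      refine ⟨l₁ ++ [false], l₂, by simp [succBits, h], by simpa, ?_⟩
      refine (runs_loop_cont (a := .bit true) hI rfl (runs_push _ _ _) ?_).congr rfl
        (c := 1 + 2 + (3 * l.length + 3)) (by simp; omega)
      refine hr.congr ?_ le_rfl
      funext j; cases j <;> simp

theorem runs_incr (i : ℕ) (S : Stacks) (hI : S .I = symBits i) (hJ : S .J = []) :
    Runs incr S (update S .I (symBits (i + 1))) (6 * (S .I).length + 6) := by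
  obtain ⟨l₁, l₂, h, hl, hr⟩ := runs_incr_loop _ S hI
  refine (hr.seq (runs_move (by decide) _)).congr ?_ ?_
  · funext j
    cases j <;> simp [hJ, symBits, bits_succ, h]
  · simp [hJ, hI, symBits]; omega

/-- Symbols of a template: a fixed symbol, or a hole for the digits of the counter. -/
inductive Tok : Type
  | lit (a : Sym)
  | idx

def Tok.render (l : List Sym) : Tok → List Sym
  | .lit a => [a]
  | .idx => l

/-- Writes the digits of the counter. -/
def emitIdx : Prog :=
  (forEach .I fun a => (push .E [a]).seq (push .J [a])).seq (move .J .I)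

theorem runs_emitIdx (S : Stacks) (hJ : S .J = []) :
    Runs emitIdx S (update S .E ((S .I).reverse ++ S .E)) (7 * (S .I).length + 6) := by
  have h := runs_forEach (k := .I) (g := fun a => (push .E [a]).seq (push .J [a])) (fun _ => True)
    (fun S => update (update (update S .I []) .E ((S .I).reverse ++ S .E)) .J
      ((S .I).reverse ++ S .J)) (fun S => 4 * (S .I).length + 3) (fun S _ hS => ⟨?_, by omega⟩)
    (fun S a l _ hS => ⟨2, _, (runs_push _ _ _).seq (runs_push _ _ _), by simp, trivial, ?_, ?_⟩)
    S trivial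
  · refine (h.seq (runs_move (by decide) _)).congr ?_ ?_
    · funext j; cases j <;> simp [hJ]
    · simp [hJ]; omega
  · funext j; cases j <;> simp [hS]
  · funext j; cases j <;> simp [hS]
  · simp [hS]; omega

def emitTok : Tok → Prog
  | .lit a => push .E [a]
  | .idx => emitIdx

/-- Writes a template. -/
def emitTemplate (T : List Tok) : Prog := T.foldr (fun a P => (emitTok a).seq P) skip

theorem runs_emitTemplate (T : List Tok) (S : Stacks) (hJ : S .J = []) :
    Runs (emitTemplate T) S (update S .E ((T.flatMap (Tok.render (S .I))).reverse ++ S .E))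
      (T.length * (7 * (S .I).length + 6) + 1) := by
  induction T generalizing S with
  | nil => simpa [emitTemplate] using runs_skip S
  | cons a T ih =>
    have h : Runs (emitTok a) S (update S .E ((a.render (S .I)).reverse ++ S .E))
        (7 * (S .I).length + 6) := by
      cases a with
      | lit a => exact (runs_push _ _ _).mono (by omega)
      | idx => exact runs_emitIdx S hJ
    refine (h.seq (ih _ (by simpa using hJ))).congr ?_ ?_
    · funext j; cases j <;> simp
    · simp; ring_nf; omega

end Programs

end

end QLearn

namespace QLearn

noncomputable section

section Programs

open Turing TM2 Function

/-! #### The universal circuit -/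

def Sym.isOut : Sym → Bool
  | .out => true
  | _ => false

/-- Moves a name, terminated by `out`, from `X` to `k`, and writes it. -/
def readName (k : Stk) : Prog :=
  loop .X (fun a => !a.isOut) fun o => o.elim skip fun a =>
    bif a.isOut then push k [a] else (push .E [a]).seq (push k [a])

theorem runs_readName {k : Stk} (hk : k ≠ .E) (hk' : k ≠ .X) (w rest : List Sym)
    (hw : ∀ a ∈ w, a.isOut = false) (S : Stacks) (hX : S .X = w ++ .out :: rest) :
    Runs (readName k) S
      (update (update (update S .X rest) .E (w.reverse ++ S .E)) k (.out :: (w.reverse ++ S k)))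
      (4 * w.length + 3) := by
  induction w generalizing S with
  | nil =>
    refine (runs_loop_stop hX rfl (runs_push k _ _)).congr ?_ (by simp)
    funext j
    by_cases h₁ : j = k <;> by_cases h₂ : j = .X <;> by_cases h₃ : j = .E <;> simp_all
  | cons a w ih =>
    simp only [List.mem_cons, forall_eq_or_imp] at hw
    have ha : (some a : Option Sym).elim skip (fun a => bif a.isOut then push k [a] else
        (push .E [a]).seq (push k [a])) = (push .E [a]).seq (push k [a]) := by simp [hw.1]
    refine (runs_loop_cont (c := 2) (c' := 4 * w.length + 3) hX (by simp [hw.1])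
      (by rw [ha]; exact (runs_push _ _ _).seq (runs_push _ _ _)) (ih hw.2 _ ?_)).congr ?_ ?_
    · simp [hk'.symm]
    · funext j
      by_cases h₁ : j = k <;> by_cases h₂ : j = .X <;> by_cases h₃ : j = .E <;> simp_all
    · simp; omega

/-- The name of the work wire `k`. -/
def workName (k : ℕ) : List Sym := .anc :: symNat (8 * k + 4)

/-- The names of the three wires on which a cell of a circuit diagram is read. -/
abbrev CellName : Type := List Sym × List Sym × List Sym

/-- Names free of `out` can be delimited by `out` without ambiguity, which is how `encCell` stores
them. -/
def CellName.WF (c : CellName) : Prop :=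
  (∀ a ∈ c.1, a.isOut = false) ∧ (∀ a ∈ c.2.1, a.isOut = false) ∧ ∀ a ∈ c.2.2, a.isOut = false

def encCell (c : CellName) : List Sym :=
  c.1 ++ .out :: (c.2.1 ++ .out :: (c.2.2 ++ [.out]))

/-- The description of the gates that copy a cell to the work wires. -/
def loadOut (c : CellName) : List Sym :=
  .cnot :: (c.1 ++ workName 0) ++ .cnot :: (c.2.1 ++ workName 1) ++ .cnot :: (c.2.2 ++ workName 2)

def loadBit (k : Stk) (b : ℕ) : Prog :=
  (push .E [.cnot]).seq ((readName k).seq (push .E (workName b)))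

theorem runs_loadBit {k : Stk} (hk : k ≠ .E) (hk' : k ≠ .X) (b : ℕ) (w rest : List Sym)
    (hw : ∀ a ∈ w, a.isOut = false) (S : Stacks) (hX : S .X = w ++ .out :: rest) :
    Runs (loadBit k b) S
      (update (update (update S .X rest) .E ((.cnot :: (w ++ workName b)).reverse ++ S .E)) k
        (.out :: (w.reverse ++ S k))) (4 * w.length + 5) := by
  refine ((runs_push _ _ _).seq ((runs_readName hk hk' w rest hw _ ?_).seq
    (runs_push _ _ _))).congr ?_ (by omega)
  · simpa using hX
  · funext j
    by_cases h₁ : j = k <;> by_cases h₂ : j = .X <;> by_cases h₃ : j = .E <;> simp_all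

def loadCell (k : Stk) : Prog := (loadBit k 0).seq ((loadBit k 1).seq (loadBit k 2))

theorem runs_loadCell {k : Stk} (hk : k ≠ .E) (hk' : k ≠ .X) (c : CellName) (hc : c.WF)
    (rest : List Sym) (S : Stacks) (hX : S .X = encCell c ++ rest) :
    Runs (loadCell k) S
      (update (update (update S .X rest) .E ((loadOut c).reverse ++ S .E)) k
        ((encCell c).reverse ++ S k)) (4 * (encCell c).length + 15) := by
  obtain ⟨w₀, w₁, w₂⟩ := c
  refine ((runs_loadBit hk hk' 0 w₀ (w₁ ++ .out :: (w₂ ++ .out :: rest)) hc.1 _ ?_).seq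
    ((runs_loadBit hk hk' 1 w₁ (w₂ ++ .out :: rest) hc.2.1 _ ?_).seq
    (runs_loadBit hk hk' 2 w₂ rest hc.2.2 _ ?_))).congr ?_ ?_
  · simpa [encCell] using hX
  · simp [hk'.symm]
  · simp [hk'.symm]
  · funext j
    by_cases h₁ : j = k <;> by_cases h₂ : j = .X <;> by_cases h₃ : j = .E <;>
      simp_all [encCell, loadOut]
  · simp [encCell]; omega

/-- The gates `T` for one cell, together with reading and forgetting its marks. -/
def cellProg (T : List Tok) : Prog :=
  (loadCell .Z).seq ((move .Z .X).seq ((emitTemplate T).seq (loadCell .Y)))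

def cellOut (T : List Tok) (i : ℕ) (c : CellName) : List Sym :=
  loadOut c ++ T.flatMap (Tok.render (symBits i)) ++ loadOut c

/-- The names of a cell are needed twice, since the same CNOTs load and unload its bits. The first
reading goes to `Z` and is moved back; the second leaves the cell reversed on `Y`, ready for the
next pass. -/
theorem runs_cellProg (T : List Tok) (i : ℕ) (c : CellName) (hc : c.WF) (rest : List Sym)
    (S : Stacks) (hX : S .X = encCell c ++ rest) (hI : S .I = symBits i) (hJ : S .J = [])
    (hZ : S .Z = []) :
    Runs (cellProg T) S
      (update (update (update S .X rest) .E ((cellOut T i c).reverse ++ S .E)) .Y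
        ((encCell c).reverse ++ S .Y))
      (11 * (encCell c).length + T.length * (7 * (symBits i).length + 6) + 34) := by
  refine ((runs_loadCell (by decide) (by decide) c hc rest S hX).seq
    ((runs_move (by decide) _).seq ((runs_emitTemplate T _ ?_).seq
    (runs_loadCell (by decide) (by decide) c hc rest _ ?_)))).congr ?_ ?_
  · simpa using hJ
  · simp [hZ]
  · funext j
    cases j <;> simp [cellOut, hZ, hI]
  · simp [hZ, hI]; omega

theorem length_symBits (i : ℕ) : (symBits i).length = i.size := by
  simp [symBits, Nat.size_eq_bits_len]

/-- One pass over the cells of a layer. -/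
def passProg (T : List Tok) : Prog :=
  (forEach .Q fun a => (push .R [a]).seq ((cellProg T).seq incr)).seq
    ((clear .I).seq (move .R .Q))

def passOut (T : List Tok) : ℕ → List CellName → List Sym
  | _, [] => []
  | i, c :: cs => cellOut T i c ++ passOut T (i + 1) cs

/-- The marks on `Q` count the cells while `I` holds the index of the current one; `B` bounds the
number of digits of every index that occurs. -/
theorem runs_passProg_loop (T : List Tok) (B : ℕ) (cs : List CellName) (hcs : ∀ c ∈ cs, c.WF)
    (rest : List Sym) (i : ℕ) (hB : (i + cs.length).size ≤ B) (S : Stacks)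
    (hX : S .X = cs.flatMap encCell ++ rest) (hI : S .I = symBits i) (hJ : S .J = [])
    (hZ : S .Z = []) (hQ : (S .Q).length = cs.length) :
    Runs (forEach .Q fun a => (push .R [a]).seq ((cellProg T).seq incr)) S
      (update (update (update (update (update (update S .X rest) .E
        ((passOut T i cs).reverse ++ S .E)) .Y ((cs.flatMap encCell).reverse ++ S .Y))
        .Q []) .R ((S .Q).reverse ++ S .R)) .I (symBits (i + cs.length)))
      (11 * (cs.flatMap encCell).length + cs.length * (T.length * (7 * B + 6) + 6 * B + 43) + 3) := by
  induction cs generalizing S i with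
  | nil =>
    have hQ : S .Q = [] := by simpa using hQ
    refine (runs_loop_nil hQ (runs_skip S)).congr ?_ (by simp)
    funext j
    cases j <;> simp_all [passOut]
  | cons c cs ih =>
    obtain ⟨a, l, hl⟩ : ∃ a l, S .Q = a :: l := List.exists_cons_of_length_eq_add_one hQ
    simp only [List.mem_cons, forall_eq_or_imp] at hcs
    simp only [List.length_cons] at hB
    have hi : (symBits i).length ≤ B := by
      rw [length_symBits]; exact (Nat.size_le_size (by omega)).trans hB
    refine (runs_loop_cont hl rfl ((runs_push _ _ _).seq
      ((runs_cellProg T i c hcs.1 (cs.flatMap encCell ++ rest) _ ?_ ?_ ?_ ?_).seq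
      (runs_incr i _ ?_ ?_))) (ih hcs.2 (i + 1) ?_ _ ?_ ?_ ?_ ?_ ?_)).congr ?_ ?_
    any_goals simp [hX, hI, hJ, hZ]
    · rwa [Nat.add_right_comm]
    · simpa [hl] using hQ
    · funext j
      cases j <;> simp [passOut, hl, Nat.add_right_comm, Nat.add_assoc]
    · have : T.length * (7 * (symBits i).length + 6) ≤ T.length * (7 * B + 6) := by gcongr
      rw [Nat.add_mul]
      omega

theorem runs_passProg (T : List Tok) (cs : List CellName) (hcs : ∀ c ∈ cs, c.WF)
    (rest : List Sym) (S : Stacks)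
    (hX : S .X = cs.flatMap encCell ++ rest) (hI : S .I = []) (hJ : S .J = [])
    (hZ : S .Z = []) (hR : S .R = []) (hQ : (S .Q).length = cs.length) :
    Runs (passProg T) S
      (update (update (update S .X rest) .E
        ((passOut T 0 cs).reverse ++ S .E)) .Y ((cs.flatMap encCell).reverse ++ S .Y))
      (11 * (cs.flatMap encCell).length +
        cs.length * (T.length * (7 * cs.length.size + 6) + 6 * cs.length.size + 46) +
        3 * cs.length.size + 9) := by
  refine ((runs_passProg_loop T _ cs hcs rest 0 le_rfl S hX (by simpa [symBits] using hI) hJ hZ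
    hQ).seq ((runs_clear _ _).seq (runs_move (by decide) _))).congr ?_ ?_
  · funext j
    cases j <;> simp [hR, hI]
  · simp only [Nat.zero_add]
    simp [length_symBits, hR, hQ, Nat.mul_add]
    omega

/-- The templates of a layer: one-qubit gates, controls (before and after the targets), targets. -/
structure Templates : Type where
  one : List Tok
  ctl : List Tok
  tgt : List Tok

/-- Moving `Y` to `X` rewinds to the start of the layer between passes. The control pass comes twice
because the second one erases the parity computed by the first. -/
def layerProg (T : Templates) : Prog :=
  (passProg T.one).seq ((move .Y .X).seq ((passProg T.ctl).seq ((move .Y .X).seq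
    ((passProg T.tgt).seq ((move .Y .X).seq ((passProg T.ctl).seq (clear .Y)))))))

def layerOut (T : Templates) (cs : List CellName) : List Sym :=
  passOut T.one 0 cs ++ passOut T.ctl 0 cs ++ passOut T.tgt 0 cs ++ passOut T.ctl 0 cs

def Templates.size (T : Templates) : ℕ := T.one.length + T.ctl.length + T.tgt.length

theorem runs_layerProg (T : Templates) (cs : List CellName) (hcs : ∀ c ∈ cs, c.WF)
    (rest : List Sym) (S : Stacks)
    (hX : S .X = cs.flatMap encCell ++ rest) (hI : S .I = []) (hJ : S .J = [])
    (hY : S .Y = []) (hZ : S .Z = []) (hR : S .R = []) (hQ : (S .Q).length = cs.length) :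
    Runs (layerProg T) S
      (update (update S .X rest) .E ((layerOut T cs).reverse ++ S .E))
      (56 * (cs.flatMap encCell).length +
        4 * (cs.length * (T.size * (7 * cs.length.size + 6) + 6 * cs.length.size + 46)) +
        12 * cs.length.size + 48) := by
  have hP : ∀ τ ≤ T.size, cs.length * (τ * (7 * cs.length.size + 6) + 6 * cs.length.size + 46) ≤
      cs.length * (T.size * (7 * cs.length.size + 6) + 6 * cs.length.size + 46) := by
    intro τ hτ; gcongr
  have h₁ := hP T.one.length (by unfold Templates.size; omega)
  have h₂ := hP T.ctl.length (by unfold Templates.size; omega)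
  have h₃ := hP T.tgt.length (by unfold Templates.size; omega)
  refine ((runs_passProg T.one cs hcs rest S hX hI hJ hZ hR hQ).seq
    ((runs_move (by decide) _).seq
    ((runs_passProg T.ctl cs hcs rest _ ?_ ?_ ?_ ?_ ?_ ?_).seq ((runs_move (by decide) _).seq
    ((runs_passProg T.tgt cs hcs rest _ ?_ ?_ ?_ ?_ ?_ ?_).seq ((runs_move (by decide) _).seq
    ((runs_passProg T.ctl cs hcs rest _ ?_ ?_ ?_ ?_ ?_ ?_).seq (runs_clear _ _)))))))).congr ?_ ?_
  any_goals simp [hY, hI, hJ, hZ, hR, hQ]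
  · funext j
    cases j <;> simp [layerOut, hY]
  · omega

def layersProg (T : Templates) : Prog := forEach .G fun _ => layerProg T

theorem runs_layersProg (T : Templates) (q : ℕ) (Ls : List (List CellName))
    (hcs : ∀ cs ∈ Ls, cs.length = q ∧ ∀ c ∈ cs, c.WF)
    (rest : List Sym) (S : Stacks)
    (hX : S .X = Ls.flatMap (fun cs => cs.flatMap encCell) ++ rest) (hI : S .I = [])
    (hJ : S .J = []) (hY : S .Y = []) (hZ : S .Z = []) (hR : S .R = [])
    (hQ : (S .Q).length = q) (hG : (S .G).length = Ls.length) :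
    Runs (layersProg T) S
      (update (update (update S .X rest) .E ((Ls.flatMap (layerOut T)).reverse ++ S .E)) .G [])
      (56 * (Ls.flatMap fun cs => cs.flatMap encCell).length +
        Ls.length * (4 * (q * (T.size * (7 * q.size + 6) + 6 * q.size + 46)) +
        12 * q.size + 50) + 3) := by
  induction Ls generalizing S with
  | nil =>
    have hG : S .G = [] := by simpa using hG
    refine (runs_loop_nil hG (runs_skip S)).congr ?_ (by simp)
    funext j
    cases j <;> simp_all
  | cons cs Ls ih =>
    obtain ⟨a, l, hl⟩ : ∃ a l, S .G = a :: l := List.exists_cons_of_length_eq_add_one hG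
    simp only [List.mem_cons, forall_eq_or_imp] at hcs
    obtain ⟨⟨hq, hwf⟩, hcs⟩ := hcs
    refine (runs_loop_cont hl rfl (runs_layerProg T cs hwf
      (Ls.flatMap (fun cs => cs.flatMap encCell) ++ rest) _ ?_ ?_ ?_ ?_ ?_ ?_ ?_)
      (ih hcs _ ?_ ?_ ?_ ?_ ?_ ?_ ?_ ?_)).congr ?_ ?_
    any_goals simp [hX, hI, hJ, hY, hZ, hR, hQ, hq]
    · simpa [hl] using hG
    · funext j
      cases j <;> simp
    · rw [Nat.add_mul]
      omega

end Programs

end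

end QLearn

namespace QLearn

noncomputable section

section Programs

open Turing TM2 Function

/-! #### Renaming the wires of the learner -/

/-- The description of an instruction on wires named by `name`. -/
def gateDesc {W : Type} (name : W → List Sym) : Gate W → List Sym
  | .unitary (.had w) => Sym.had :: name w
  | .unitary (.tee w) => Sym.tee :: name w
  | .unitary (.cnot c t _) => Sym.cnot :: (name c ++ name t)
  | .measure w => Sym.measure :: name w
  | .reset w => Sym.reset :: name w

theorem symGate_eq {m n a : ℕ} (g : Gate ((Fin m × Fin n) ⊕ Fin a)) :
    symGate g = gateDesc symWire g := by
  rcases g with (_ | _ | _) | _ | _ <;> rfl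

/-- The new name of a wire of the learner. -/
def newName {m n a : ℕ} : (Fin m × Fin n) ⊕ Fin a → List Sym
  | Sum.inl (c, j) => Sym.inp :: (symNat (c + 1) ++ symNat j)
  | Sum.inr k => Sym.anc :: symNat (2 * k + 1)

/-- Copies the binary successor of a number from `D` to `k`, up to the last carry. -/
def succCopy (k : Stk) : Prog :=
  loop .D (fun a => match a with | .bit true => true | _ => false) fun o =>
    match o with
    | some (.bit true) => push k [.bit false]
    | some (.bit false) => push k [.bit true]
    | some a => (push k [.bit true]).seq (push .D [a])
    | none => skip

/-- Only the digits up to the last carry are treated here; the rest `l₂` is unchanged by the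
successor and is left on `D` for the surrounding loop to copy. If the carry runs through all digits,
the separator is put back after an additional digit has been written. -/
theorem runs_succCopy {k : Stk} (hk : k ≠ .D) (l : List Bool) (rest : List Sym) (S : Stacks)
    (hD : S .D = l.map Sym.bit ++ .sep :: rest) :
    ∃ l₁ l₂ : List Bool, succBits l = l₁ ++ l₂ ∧ l₂.length ≤ l.length ∧
      Runs (succCopy k) S (update (update S .D (l₂.map Sym.bit ++ .sep :: rest)) k
        ((l₁.map Sym.bit).reverse ++ S k)) (3 * (l.length - l₂.length) + 4) := by
  induction l generalizing S with
  | nil =>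
    refine ⟨[true], [], rfl, by simp, ?_⟩
    refine (runs_loop_stop (a := .sep) hD rfl ((runs_push _ _ _).seq (runs_push _ _ _))).congr ?_
      (by simp)
    funext j
    by_cases h₁ : j = k <;> by_cases h₂ : j = .D <;> simp_all
  | cons b l ih =>
    cases b
    · refine ⟨[true], l, rfl, by simp, ?_⟩
      refine (runs_loop_stop (a := .bit false) hD rfl (runs_push _ _ _)).congr ?_
        (by simp)
      funext j
      by_cases h₁ : j = k <;> by_cases h₂ : j = .D <;> simp_all
    · obtain ⟨l₁, l₂, h, hl, hr⟩ := ih (update (update S .D (l.map Sym.bit ++ .sep :: rest)) k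
        (.bit false :: S k)) (by simp [hk.symm])
      refine ⟨false :: l₁, l₂, by simp [succBits, h], by simp; omega, ?_⟩
      refine (runs_loop_cont (a := .bit true) hD rfl (runs_push _ _ _) ?_).congr rfl
        (c := 1 + 2 + (3 * (l.length - l₂.length) + 4)) (by simp; omega)
      refine hr.congr' ?_ ?_
      · funext j
        by_cases h₁ : j = k <;> by_cases h₂ : j = .D <;> simp_all
      · funext j
        by_cases h₁ : j = k <;> by_cases h₂ : j = .D <;> simp_all

/-- Copies a symbol to `k`, renaming the wire if a name begins. -/
def transSym (k : Stk) : Sym → Prog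
  | .prep => push k [.prep, .prep]
  | .anc => push k [.anc, .bit true]
  | .inp => (push k [.inp]).seq (succCopy k)
  | a => push k [a]

/-- Started with `u` on top of `D`, the program `P` pushes `v` to `k` and then runs as without
`u`. -/
def Consumes (P : Prog) (k : Stk) (u v : List Sym) : Prop :=
  ∀ (S S' : Stacks) (rest : List Sym) (c : ℕ), S .D = u ++ rest →
    Runs P (update (update S .D rest) k (v.reverse ++ S k)) S' c → Runs P S S' (10 * u.length + c)

theorem Consumes.append {P : Prog} {k : Stk} (hk : k ≠ .D) {u v u' v' : List Sym}
    (h : Consumes P k u v) (h' : Consumes P k u' v') : Consumes P k (u ++ u') (v ++ v') := by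
  intro S S' rest c hD hr
  refine (h S S' (u' ++ rest) (10 * u'.length + c) (by simpa using hD) (h' _ S' rest c
    (by simp [hk.symm]) ?_)).mono (by simp; omega)
  convert hr using 1
  funext j
  by_cases h₁ : j = k <;> by_cases h₂ : j = .D <;> simp_all

theorem Consumes.nil {P : Prog} {k : Stk} : Consumes P k [] [] := by
  intro S S' rest c hD hr
  convert hr using 1
  · funext j
    by_cases h₁ : j = k <;> by_cases h₂ : j = .D <;> simp_all
  · simp

theorem Consumes.flatMap {P : Prog} {k : Stk} (hk : k ≠ .D) {α : Type} {f g : α → List Sym}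
    (h : ∀ a, Consumes P k (f a) (g a)) (l : List α) :
    Consumes P k (l.flatMap f) (l.flatMap g) := by
  induction l with
  | nil => exact .nil
  | cons a l ih => simpa using (h a).append hk ih

section Consumes

variable {k : Stk} {cont : Sym → Bool} {f : Option Sym → Prog}

theorem consumes_single {a : Sym} {v : List Sym} (hc : cont a = true)
    (hf : f (some a) = push k v) (hk : k ≠ .D) : Consumes (loop .D cont f) k [a] v := by
  intro S S' rest c hD hr
  refine (runs_loop_cont hD hc (c := 1) (c' := c) (by rw [hf]; exact runs_push _ _ _) ?_).mono
    (by simp)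
  simpa [hk] using hr

variable (hf : ∀ a, a.isOut = false → cont a = true ∧ f (some a) = transSym k a)
include hf

theorem consumes_map_bit (hk : k ≠ .D) (l : List Bool) :
    Consumes (loop .D cont f) k (l.map Sym.bit) (l.map Sym.bit) := by
  have := Consumes.flatMap hk (P := loop .D cont f) (f := fun b => [Sym.bit b])
    (g := fun b => [Sym.bit b])
    (fun b => consumes_single (hf (.bit b) rfl).1 (hf (.bit b) rfl).2 hk) l
  simpa [← List.map_eq_flatMap] using this

theorem consumes_symNat (hk : k ≠ .D) (i : ℕ) :
    Consumes (loop .D cont f) k (symNat i) (symNat i) :=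
  (consumes_map_bit hf hk _).append hk (consumes_single (hf .sep rfl).1 (hf .sep rfl).2 hk)

/-- Input copies are shifted by one to free copy 0 for the swap test. For an ancilla, 2k + 1 is
obtained by prepending the lowest digit 1, so only the number of a copy requires a carry. -/
theorem consumes_symWire (hk : k ≠ .D) {m n a : ℕ} (w : (Fin m × Fin n) ⊕ Fin a) :
    Consumes (loop .D cont f) k (symWire w) (newName w) := by
  rcases w with ⟨x, j⟩ | i
  · intro S S' rest c hD hr
    have hD' : S .D = .inp :: ((Nat.bits x).map Sym.bit ++ .sep :: (symNat j ++ rest)) := by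
      simpa [symWire, symNat] using hD
    obtain ⟨l₁, l₂, h, hl, hs⟩ := runs_succCopy hk (Nat.bits x) (symNat j ++ rest) (update (update S .D
      ((Nat.bits x).map Sym.bit ++ .sep :: (symNat j ++ rest))) k (.inp :: S k))
      (by simp [hk.symm])
    have h₂ := ((consumes_map_bit hf hk l₂).append hk
      (consumes_single (hf .sep rfl).1 (hf .sep rfl).2 hk)).append hk (consumes_symNat hf hk j)
    have hb := ((runs_push k [.inp] (update S .D
      ((Nat.bits x).map Sym.bit ++ .sep :: (symNat j ++ rest)))).seq (hs.congr' (by simp [hk]) rfl))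
    refine (runs_loop_cont hD' (hf .inp rfl).1 (by rw [(hf .inp rfl).2]; exact hb)
      (h₂ _ S' rest c ?_ ?_)).mono ?_
    · simp [hk.symm]
    · convert hr using 1
      funext j
      by_cases h₁ : j = k <;> by_cases h₂ : j = .D <;>
        simp_all [newName, symNat, bits_succ]
    · simp [symWire, symNat]
      omega
  · have := (consumes_single (hf .anc rfl).1 (hf .anc rfl).2 hk).append hk (consumes_symNat hf hk i)
    simpa [symWire, newName, symNat] using this

theorem consumes_symGate (hk : k ≠ .D) {m n a : ℕ} (g : Gate ((Fin m × Fin n) ⊕ Fin a)) :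
    Consumes (loop .D cont f) k (symGate g) (gateDesc newName g) := by
  have hw := consumes_symWire hf hk (m := m) (n := n) (a := a)
  rcases g with (w | w | ⟨w, w', h⟩) | w | w
  · exact (consumes_single (hf .had rfl).1 (hf .had rfl).2 hk).append hk (hw w)
  · exact (consumes_single (hf .tee rfl).1 (hf .tee rfl).2 hk).append hk (hw w)
  · exact (consumes_single (hf .cnot rfl).1 (hf .cnot rfl).2 hk).append hk
      ((hw w).append hk (hw w'))
  · exact (consumes_single (hf .measure rfl).1 (hf .measure rfl).2 hk).append hk (hw w)
  · exact (consumes_single (hf .reset rfl).1 (hf .reset rfl).2 hk).append hk (hw w)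

end Consumes

/-- Copies the list of output wires from `D` to `Y`. -/
def transOuts : Prog :=
  loop .D (fun _ => true) fun o => o.elim (push .Y [.out]) fun a =>
    bif a.isOut then push .Y [.out] else transSym .Y a

/-- Copies the description of a circuit from `D` to `E` and, for the output wires, to `Y`. -/
def transDesc : Prog :=
  loop .D (fun a => !a.isOut) fun o => o.elim skip fun a =>
    bif a.isOut then transOuts else transSym .E a

/-- A list of names, each one terminated by `out`. -/
def encNames (ws : List (List Sym)) : List Sym := ws.flatMap fun w => w ++ [.out]

/-- In a description `out` precedes each name, in `encNames` it follows. The first `out` has already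
been popped by `transDesc`, and one is pushed at the end, which turns the one format into the other.
-/
theorem runs_transOuts {m n a : ℕ} (os : List ((Fin m × Fin n) ⊕ Fin a))
    (w : (Fin m × Fin n) ⊕ Fin a) (S : Stacks)
    (hD : S .D = symWire w ++ os.flatMap fun w => Sym.out :: symWire w) :
    Runs transOuts S (update (update S .D [])
      .Y ((encNames ((w :: os).map newName)).reverse ++ S .Y)) (10 * (S .D).length + 3) := by
  have hf : ∀ a : Sym, a.isOut = false → (fun _ : Sym => true) a = true ∧
      (some a).elim (push .Y [.out]) (fun a => bif a.isOut then push .Y [.out] else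
        transSym .Y a) = transSym .Y a := fun a ha => ⟨rfl, by simp [ha]⟩
  have hw : ∀ w : (Fin m × Fin n) ⊕ Fin a, Consumes transOuts .Y (Sym.out :: symWire w)
      (Sym.out :: newName w) := fun w =>
    Consumes.append (u := [Sym.out]) (v := [Sym.out]) (by decide)
      (consumes_single rfl rfl (by decide)) (consumes_symWire hf (by decide) w)
  have h := (consumes_symWire hf (by decide) w).append (by decide)
    (Consumes.flatMap (by decide) hw os)
  rw [hD]
  refine h S _ [] 3 (by simpa using hD) ((runs_loop_nil (by simp) (runs_push _ _ _)).congr ?_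
    le_rfl)
  have hos : ∀ l : List ((Fin m × Fin n) ⊕ Fin a), (l.flatMap fun w => Sym.out :: newName w) ++
      [Sym.out] = Sym.out :: encNames (l.map newName) := by
    intro l
    induction l with
    | nil => rfl
    | cons w l ih => simp [encNames] at ih ⊢; exact ih
  have : encNames ((w :: os).map newName) = newName w ++ ((os.flatMap fun w =>
      Sym.out :: newName w) ++ [Sym.out]) := by
    rw [hos]; simp [encNames]
  rw [this]
  funext j
  cases j <;> simp

theorem runs_transDesc {m n : ℕ} (C : QCircuit (Fin m × Fin n)) (S : Stacks)
    (hD : S .D = C.desc) :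
    Runs transDesc S (update (update (update S .D [])
      .E ((List.replicate (2 * C.anc) Sym.prep ++ C.gates.flatMap (gateDesc newName)).reverse ++
        S .E)) .Y ((encNames (C.outputs.map newName)).reverse ++ S .Y))
      (10 * C.desc.length + 5) := by
  have hf : ∀ a : Sym, a.isOut = false → (fun a : Sym => !a.isOut) a = true ∧
      (some a).elim skip (fun a => bif a.isOut then transOuts else
        transSym .E a) = transSym .E a := fun a ha => ⟨by simp [ha], by simp [ha]⟩
  -- The number of ancillas is doubled since their indices become 2k + 1.
  have hp : Consumes transDesc .E (List.replicate C.anc Sym.prep)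
      (List.replicate (2 * C.anc) Sym.prep) := by
    have := Consumes.flatMap (P := transDesc) (k := .E) (by decide) (f := fun _ => [Sym.prep])
      (g := fun _ => [Sym.prep, Sym.prep])
      (fun _ => consumes_single (hf .prep rfl).1 (hf .prep rfl).2 (by decide))
      (List.replicate C.anc ())
    have h₂ : ∀ r : ℕ, (List.replicate r ()).flatMap (fun _ => [Sym.prep, Sym.prep]) =
        List.replicate (2 * r) Sym.prep := by
      intro r
      induction r with
      | zero => rfl
      | succ r ih => rw [List.replicate_succ, List.flatMap_cons, ih]; rfl
    rw [h₂] at this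
    simpa [← List.map_eq_flatMap] using this
  have h := hp.append (by decide) (Consumes.flatMap (by decide)
    (consumes_symGate hf (by decide)) C.gates)
  rw [QCircuit.desc] at hD ⊢
  rw [List.length_append, Nat.mul_add, Nat.add_assoc]
  refine h S _ _ _ hD ?_
  cases ho : C.outputs with
  | nil =>
    refine (runs_loop_nil (by simp) (runs_skip _)).congr ?_ (by simp)
    funext j
    cases j <;> simp [encNames]
  | cons w os =>
    refine (runs_loop_stop (a := Sym.out) (l := symWire w ++ os.flatMap fun w => Sym.out ::
      symWire w) (by simp) rfl (runs_transOuts os w _ (by simp))).congr ?_ ?_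
    · funext j
      cases j <;> simp
    · simp

end Programs

end

end QLearn

namespace QLearn

noncomputable section

section Programs

open Turing TM2 Function

/-! #### The whole program -/

/-- Moves the list of output wires from `Y` to `X` and counts them on `L`. -/
def countProg : Prog :=
  forEach .Y fun a => (push .X [a]).seq (bif a.isOut then push .L [.sep] else skip)

theorem runs_countProg (S : Stacks) :
    Runs countProg S (update (update (update S .Y []) .X ((S .Y).reverse ++ S .X)) .L
      (List.replicate ((S .Y).filter Sym.isOut).length Sym.sep ++ S .L))
      (4 * (S .Y).length + 3) := by
  generalize hl : S .Y = l
  induction l generalizing S with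
  | nil =>
    refine (runs_loop_nil hl (runs_skip S)).congr ?_ (by simp)
    funext j
    cases j <;> simp_all
  | cons a l ih =>
    cases ha : a.isOut
    · refine (runs_loop_cont hl rfl (c := 2) ((runs_push _ _ _).seq
        (show Runs (bif a.isOut then push .L [.sep] else skip) _ _ 1 by
          rw [ha]; exact runs_skip _)) (ih _ (by simp))).congr ?_ ?_
      · funext j
        cases j <;> simp [ha]
      · simp; omega
    · refine (runs_loop_cont hl rfl (c := 2) ((runs_push _ _ _).seq
        (show Runs (bif a.isOut then push .L [.sep] else skip) _ _ 1 by
          rw [ha]; exact runs_push _ _ _)) (ih _ (by simp))).congr ?_ ?_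
      · funext j
        cases j <;> simp [ha, ← List.replicate_append_replicate]
      · simp; omega

/-- Moves a mark from `T` to `U`. If it was the last one, then a layer is complete, and all marks
are moved back. -/
def divStep : Prog :=
  loop .T (fun _ => false) fun o => o.elim skip fun a => (push .U [a]).seq
    (loop .T (fun _ => false) fun o => o.elim ((push .G [.sep]).seq (move .U .T)) fun b =>
      push .T [b])

/-- Divides the number of marks on `L` by the number of marks on `T`. -/
def divProg : Prog := forEach .L fun _ => divStep

/-- The case of no wires: no mark is ever moved and no layer is counted, in agreement with division
by zero giving 0. -/
theorem runs_divProg_zero (S : Stacks) (hT : S .T = []) :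
    Runs divProg S (update S .L []) (5 * (S .L).length + 3) := by
  refine runs_forEach (fun S => S .T = []) (fun S => update S .L []) (fun S => 5 * (S .L).length + 3)
    (fun S _ hS => ⟨?_, by omega⟩) (fun S a l hT hS => ?_) S hT
  · rw [← hS, update_eq_self]
  · exact ⟨3, _, runs_loop_nil (by simpa using hT) (runs_skip _), by simp, by simpa using hT,
      by simp, by simp [hS]; omega⟩

/-- `T` and `U` together always hold `w` marks, and the number on `U` is the remainder so far. The
term 3u in the cost is the amortized price for moving `U` back to `T` when a layer is complete. -/
theorem runs_divProg_pos (w u g : ℕ) (hu : u < w) (S : Stacks)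
    (hT : S .T = List.replicate (w - u) Sym.sep) (hU : S .U = List.replicate u Sym.sep)
    (hG : S .G = List.replicate g Sym.sep) :
    Runs divProg S (update (update (update (update S .L [])
      .T (List.replicate (w - (u + (S .L).length) % w) Sym.sep))
      .U (List.replicate ((u + (S .L).length) % w) Sym.sep))
      .G (List.replicate (g + (u + (S .L).length) / w) Sym.sep))
      (14 * (S .L).length + 3 * u + 3) := by
  generalize hl : S .L = l
  induction l generalizing S u g with
  | nil =>
    refine (runs_loop_nil hl (runs_skip S)).congr ?_ (by simp)
    funext j
    cases j <;> simp_all [Nat.mod_eq_of_lt hu]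
  | cons a l ih =>
    obtain ⟨r, hr⟩ : ∃ r, w - u = r + 1 := ⟨w - u - 1, by omega⟩
    rw [hr, List.replicate_succ] at hT
    rcases r with _ | r
    · obtain rfl : w = u + 1 := by omega
      refine (runs_loop_cont hl rfl (runs_loop_stop (by simpa using hT) rfl
        ((runs_push _ _ _).seq (runs_loop_nil (by simp) ((runs_push _ _ _).seq
        (runs_move (by decide) _))))) (ih 0 (g + 1) (by omega) _ ?_ ?_ ?_ ?_)).congr ?_ ?_
      any_goals simp [hU, hG]
      · simp [← List.replicate_succ']
      · simp [← List.replicate_succ]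
      · have h₁ : u + (l.length + 1) = l.length + (u + 1) := by omega
        funext j
        cases j <;> simp [h₁, Nat.add_assoc]
        rw [Nat.add_comm 1]
      · omega
    · refine (runs_loop_cont hl rfl (runs_loop_stop (by simpa using hT) rfl
        ((runs_push _ _ _).seq (runs_loop_stop (a := Sym.sep) (l := List.replicate r Sym.sep)
          (by simp [List.replicate_succ]) rfl (runs_push _ _ _))))
        (ih (u + 1) g (by omega) _ ?_ ?_ ?_ ?_)).congr ?_ ?_
      any_goals simp [hU, hG]
      · rw [← List.replicate_succ]; congr 1; omega
      · rw [← List.replicate_succ]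
      · funext j
        cases j <;> simp [Nat.add_comm l.length 1, ← Nat.add_assoc]
      · omega

theorem runs_divProg (w : ℕ) (S : Stacks) (hT : S .T = List.replicate w Sym.sep)
    (hU : S .U = []) (hG : S .G = []) :
    ∃ r s, r + s = w ∧ Runs divProg S (update (update (update (update S .L [])
      .T (List.replicate r Sym.sep)) .U (List.replicate s Sym.sep))
      .G (List.replicate ((S .L).length / w) Sym.sep)) (14 * (S .L).length + 3) := by
  rcases Nat.eq_zero_or_pos w with rfl | hw
  · refine ⟨0, 0, rfl, (runs_divProg_zero S (by simpa using hT)).congr ?_ (by omega)⟩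
    funext j
    cases j <;> simp_all
  · have := runs_divProg_pos w 0 0 hw S (by simpa using hT) (by simpa using hU) (by simpa using hG)
    simp only [Nat.zero_add] at this
    exact ⟨_, _, Nat.sub_add_cancel (Nat.mod_lt _ hw).le, this⟩

/-- Registers one wire of the circuits that the learner describes. -/
def addWire : Prog :=
  (push .Q [.sep]).seq ((push .T (List.replicate 3 .sep)).seq (push .E (List.replicate 4 .prep)))

def setupInputs : Prog := (forEach .N fun a => (push .R [a]).seq addWire).seq (move .R .N)

def setupAncillas : Prog := forEach .A fun _ => addWire

theorem runs_addWire (S : Stacks) :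
    Runs addWire S (update (update (update S .Q (Sym.sep :: S .Q)) .T
      (List.replicate 3 Sym.sep ++ S .T)) .E (List.replicate 4 Sym.prep ++ S .E)) 3 := by
  refine ((runs_push _ _ _).seq ((runs_push _ _ _).seq (runs_push _ _ _))).congr ?_ le_rfl
  funext j
  cases j <;> simp

theorem runs_setupAncillas (S : Stacks) :
    Runs setupAncillas S (update (update (update (update S .A []) .Q
      (List.replicate (S .A).length Sym.sep ++ S .Q)) .T
      (List.replicate (3 * (S .A).length) Sym.sep ++ S .T)) .E
      (List.replicate (4 * (S .A).length) Sym.prep ++ S .E)) (5 * (S .A).length + 3) := by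
  generalize hl : S .A = l
  induction l generalizing S with
  | nil =>
    refine (runs_loop_nil hl (runs_skip S)).congr ?_ (by simp)
    funext j
    cases j <;> simp_all
  | cons a l ih =>
    refine (runs_loop_cont hl rfl (runs_addWire _) (ih _ (by simp))).congr ?_ ?_
    · funext j
      cases j <;> simp [Nat.mul_add, ← List.replicate_append_replicate]
    · simp; omega

theorem runs_setupInputs (S : Stacks) (hR : S .R = []) :
    Runs setupInputs S (update (update (update S .Q
      (List.replicate (S .N).length Sym.sep ++ S .Q)) .T
      (List.replicate (3 * (S .N).length) Sym.sep ++ S .T)) .E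
      (List.replicate (4 * (S .N).length) Sym.prep ++ S .E)) (9 * (S .N).length + 6) := by
  have h : ∀ (l : List Sym) (S : Stacks), S .N = l →
      Runs (forEach .N fun a => (push .R [a]).seq addWire) S
      (update (update (update (update (update S .N []) .R (l.reverse ++ S .R)) .Q
      (List.replicate l.length Sym.sep ++ S .Q)) .T
      (List.replicate (3 * l.length) Sym.sep ++ S .T)) .E
      (List.replicate (4 * l.length) Sym.prep ++ S .E)) (6 * l.length + 3) := by
    intro l
    induction l with
    | nil =>
      intro S hl
      refine (runs_loop_nil hl (runs_skip S)).congr ?_ (by simp)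
      funext j
      cases j <;> simp_all
    | cons a l ih =>
      intro S hl
      refine (runs_loop_cont hl rfl ((runs_push _ _ _).seq (runs_addWire _))
        (ih _ (by simp))).congr ?_ ?_
      · funext j
        cases j <;> simp [Nat.mul_add, ← List.replicate_append_replicate]
      · simp; omega
  refine ((h _ S rfl).seq (runs_move (by decide) _)).congr ?_ ?_
  · funext j
    cases j <;> simp [hR]
  · simp [hR]; omega

/-- Writes `hd`, the template `T` for each `i < n`, and `tl`. -/
def testProg (hd : List Sym) (T : List Tok) (tl : List Sym) : Prog :=
  (push .E hd).seq ((forEach .N fun _ => (emitTemplate T).seq incr).seq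
    ((clear .I).seq (push .E tl)))

theorem runs_testProg_loop (T : List Tok) (B : ℕ) (l : List Sym) (i : ℕ)
    (hB : (i + l.length).size ≤ B) (S : Stacks) (hN : S .N = l) (hI : S .I = symBits i)
    (hJ : S .J = []) :
    Runs (forEach .N fun _ => (emitTemplate T).seq incr) S
      (update (update (update S .N []) .E
        (((List.range' i l.length).flatMap fun i =>
          T.flatMap (Tok.render (symBits i))).reverse ++ S .E)) .I (symBits (i + l.length)))
      (l.length * (T.length * (7 * B + 6) + 6 * B + 9) + 3) := by
  induction l generalizing S i with
  | nil =>
    refine (runs_loop_nil hN (runs_skip S)).congr ?_ (by simp)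
    funext j
    cases j <;> simp_all
  | cons a l ih =>
    simp only [List.length_cons] at hB
    have hi : (symBits i).length ≤ B := by
      rw [length_symBits]; exact (Nat.size_le_size (by omega)).trans hB
    refine (runs_loop_cont hN rfl ((runs_emitTemplate T _ ?_).seq (runs_incr i _ ?_ ?_))
      (ih (i + 1) ?_ _ ?_ ?_ ?_)).congr ?_ ?_
    any_goals simp [hI, hJ]
    · rwa [Nat.add_right_comm]
    · funext j
      cases j <;> simp [List.range'_succ, Nat.add_right_comm, Nat.add_assoc]
    · have : T.length * (7 * (symBits i).length + 6) ≤ T.length * (7 * B + 6) := by gcongr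
      rw [Nat.add_mul]
      omega

def testOut (hd : List Sym) (T : List Tok) (tl : List Sym) (n : ℕ) : List Sym :=
  hd ++ ((List.range n).flatMap fun i => T.flatMap (Tok.render (symBits i))) ++ tl

theorem runs_testProg (hd : List Sym) (T : List Tok) (tl : List Sym) (S : Stacks)
    (hI : S .I = []) (hJ : S .J = []) :
    Runs (testProg hd T tl) S
      (update (update S .N []) .E ((testOut hd T tl (S .N).length).reverse ++ S .E))
      ((S .N).length * (T.length * (7 * (S .N).length.size + 6) + 6 * (S .N).length.size + 9) +
        3 * (S .N).length.size + 8) := by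
  refine ((runs_push _ _ _).seq ((runs_testProg_loop T _ _ 0 le_rfl _ rfl ?_ ?_).seq
    ((runs_clear _ _).seq (runs_push _ _ _)))).congr ?_ ?_
  · simpa [symBits] using hI
  · simpa using hJ
  · funext j
    cases j <;> simp [testOut, hI, List.range_eq_range']
  · simp [length_symBits]; omega

/-! #### Cutting a list into cells and layers -/

/-- Cuts a list into triples. -/
def cellsOf {α : Type} : List α → List (α × α × α)
  | a :: b :: c :: l => (a, b, c) :: cellsOf l
  | _ => []

/-- The first `k` pieces of length `q` of a list. -/
def layersOf {α : Type} (q : ℕ) : ℕ → List α → List (List α)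
  | 0, _ => []
  | k + 1, l => l.take q :: layersOf q k (l.drop q)

theorem length_cellsOf {α : Type} (l : List α) : (cellsOf l).length = l.length / 3 := by
  induction l using cellsOf.induct with
  | case1 a b c l ih => simp [cellsOf, ih]; omega
  | case2 l h =>
    rcases l with _ | ⟨a, _ | ⟨b, _ | ⟨c, l⟩⟩⟩
    · simp [cellsOf]
    · simp [cellsOf]
    · simp [cellsOf]
    · exact (h a b c l rfl).elim

theorem cellsOf_map {α β : Type} (f : α → β) (l : List α) :
    cellsOf (l.map f) = (cellsOf l).map fun c => (f c.1, f c.2.1, f c.2.2) := by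
  induction l using cellsOf.induct with
  | case1 a b c l ih => simp [cellsOf, ih]
  | case2 l h =>
    rcases l with _ | ⟨a, _ | ⟨b, _ | ⟨c, l⟩⟩⟩
    · rfl
    · simp [cellsOf]
    · simp [cellsOf]
    · exact (h a b c l rfl).elim

theorem layersOf_map {α β : Type} (f : α → β) (q k : ℕ) (l : List α) :
    layersOf q k (l.map f) = (layersOf q k l).map (List.map f) := by
  induction k generalizing l with
  | zero => rfl
  | succ k ih => simp [layersOf, ← ih]

theorem length_layersOf {α : Type} (q k : ℕ) (l : List α) : (layersOf q k l).length = k := by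
  induction k generalizing l with
  | zero => rfl
  | succ k ih => simp [layersOf, ih]

theorem length_of_mem_layersOf {α : Type} {q k : ℕ} {l : List α} (h : q * k ≤ l.length) :
    ∀ cs ∈ layersOf q k l, cs.length = q := by
  induction k generalizing l with
  | zero => simp [layersOf]
  | succ k ih =>
    rw [Nat.mul_succ] at h
    simp only [layersOf, List.mem_cons, forall_eq_or_imp]
    exact ⟨by simp; omega, ih (by simp; omega)⟩

theorem layersOf_append {α : Type} (q k : ℕ) (l : List α) :
    ∃ r, (layersOf q k l).flatten ++ r = l := by
  induction k generalizing l with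
  | zero => exact ⟨l, rfl⟩
  | succ k ih =>
    obtain ⟨r, hr⟩ := ih (l.drop q)
    exact ⟨r, by simp [layersOf, hr]⟩

theorem encNames_eq (ws : List (List Sym)) :
    ∃ r, encNames ws = (cellsOf ws).flatMap encCell ++ r := by
  induction ws using cellsOf.induct with
  | case1 a b c l ih =>
    obtain ⟨r, hr⟩ := ih
    exact ⟨r, by simp [encNames, cellsOf, encCell] at hr ⊢; exact hr⟩
  | case2 l h =>
    rcases l with _ | ⟨a, _ | ⟨b, _ | ⟨c, l⟩⟩⟩
    · exact ⟨_, rfl⟩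
    · exact ⟨_, rfl⟩
    · exact ⟨_, rfl⟩
    · exact (h a b c l rfl).elim

/-- The layers of the circuit diagram on `q` wires that is read on the wires `ws`. -/
def diagram {α : Type} (q : ℕ) (ws : List α) : List (List (α × α × α)) :=
  layersOf q (ws.length / (3 * q)) (cellsOf ws)

theorem diagram_map {α β : Type} (f : α → β) (q : ℕ) (ws : List α) :
    diagram q (ws.map f) = (diagram q ws).map (List.map fun c => (f c.1, f c.2.1, f c.2.2)) := by
  simp [diagram, cellsOf_map, layersOf_map]

theorem length_of_mem_diagram {α : Type} {q : ℕ} {ws : List α} :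
    ∀ cs ∈ diagram q ws, cs.length = q := by
  refine length_of_mem_layersOf ?_
  rw [length_cellsOf, Nat.mul_comm 3, ← Nat.div_div_eq_div_mul, Nat.div_right_comm]
  exact Nat.mul_div_le _ _

end Programs

end

end QLearn

namespace QLearn

noncomputable section

section Programs

open Turing TM2 Function

/-- The templates for the gates of the distinguisher: for the cells of a layer, and what is written
before, for each input qubit, and at the end of the final test. -/
structure Script : Type where
  cells : Templates
  hd : List Sym
  test : List Tok
  tl : List Sym

/-- The number of ancillas reserved for work wires. -/
def workCount : ℕ := 128

def readProg : Prog :=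
  setupInputs.seq (setupAncillas.seq ((push .E (List.replicate workCount .prep)).seq
    (transDesc.seq countProg)))

def distPre (T : Script) : Prog :=
  readProg.seq (divProg.seq ((layersProg T.cells).seq ((testProg T.hd T.test T.tl).seq
    ((clear .Q).seq ((clear .T).seq ((clear .X).seq (clear .U)))))))

/-- The description of the distinguisher. -/
def distOut (T : Script) {m n : ℕ} (C : QCircuit (Fin m × Fin n)) (a : ℕ) : List Sym :=
  List.replicate (4 * (n + a) + workCount + 2 * C.anc) Sym.prep ++
    (C.gates.flatMap (gateDesc newName) ++
    ((diagram (n + a) (C.outputs.map newName)).flatMap (layerOut T.cells) ++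
    testOut T.hd T.test T.tl n))

theorem isOut_symNat (i : ℕ) : ∀ a ∈ symNat i, a.isOut = false := by
  simp only [symNat, List.mem_append, List.mem_map, List.mem_singleton]
  rintro a (⟨b, -, rfl⟩ | rfl) <;> rfl

theorem isOut_newName {m n a : ℕ} (w : (Fin m × Fin n) ⊕ Fin a) :
    ∀ b ∈ newName w, b.isOut = false := by
  rcases w with ⟨c, j⟩ | k
  · simp only [newName, List.mem_cons, List.mem_append]
    rintro b (rfl | h | h)
    · rfl
    · exact isOut_symNat _ b h
    · exact isOut_symNat _ b h
  · simp only [newName, List.mem_cons]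
    rintro b (rfl | h)
    · rfl
    · exact isOut_symNat _ b h

theorem filter_isOut_encNames {ws : List (List Sym)} (h : ∀ w ∈ ws, ∀ a ∈ w, a.isOut = false) :
    ((encNames ws).filter Sym.isOut).length = ws.length := by
  induction ws with
  | nil => rfl
  | cons w ws ih =>
    simp only [List.mem_cons, forall_eq_or_imp] at h
    have hw : w.filter Sym.isOut = [] := by
      rw [List.filter_eq_nil_iff]
      intro a ha
      simp [h.1 a ha]
    have := ih h.2
    simp only [encNames] at this
    simp only [encNames, List.flatMap_cons, List.filter_append, hw, List.nil_append]
    simp [List.filter_cons, Sym.isOut, this]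

theorem length_succBits (l : List Bool) : (succBits l).length ≤ l.length + 1 := by
  induction l with
  | nil => simp [succBits]
  | cons b l ih => cases b <;> simp [succBits]; omega

theorem length_newName {m n a : ℕ} (w : (Fin m × Fin n) ⊕ Fin a) :
    (newName w).length ≤ (symWire w).length + 1 := by
  rcases w with ⟨c, j⟩ | k
  · have := length_succBits (Nat.bits c)
    simp [newName, symWire, symNat, bits_succ]
    omega
  · simp [newName, symWire, symNat]

theorem length_encNames {m n a : ℕ} (os : List ((Fin m × Fin n) ⊕ Fin a)) :
    (encNames (os.map newName)).length ≤
      2 * (os.flatMap fun w => Sym.out :: symWire w).length := by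
  induction os with
  | nil => simp [encNames]
  | cons w os ih =>
    have h := length_newName w
    have h₂ : 0 < (symWire w).length := by
      rcases w with ⟨c, j⟩ | k <;> simp [symWire]
    simp only [encNames, List.map_cons, List.flatMap_cons, List.length_append, List.length_cons,
      List.length_nil] at ih ⊢
    omega

theorem length_le_flatMap_out {m n a : ℕ} (os : List ((Fin m × Fin n) ⊕ Fin a)) :
    os.length ≤ (os.flatMap fun w => Sym.out :: symWire w).length := by
  induction os with
  | nil => simp
  | cons w os ih => simp at ih ⊢; omega

theorem forall_mem_cellsOf {α : Type} {p : α → Prop} {l : List α} (h : ∀ a ∈ l, p a) :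
    ∀ c ∈ cellsOf l, p c.1 ∧ p c.2.1 ∧ p c.2.2 := by
  induction l using cellsOf.induct with
  | case1 a b c l ih =>
    simp only [List.mem_cons, forall_eq_or_imp] at h
    simp only [cellsOf, List.mem_cons, forall_eq_or_imp]
    exact ⟨⟨h.1, h.2.1, h.2.2.1⟩, ih h.2.2.2⟩
  | case2 l hl =>
    rcases l with _ | ⟨a, _ | ⟨b, _ | ⟨c, l⟩⟩⟩
    · simp [cellsOf]
    · simp [cellsOf]
    · simp [cellsOf]
    · exact (hl a b c l rfl).elim

theorem mem_cellsOf_of_mem_diagram {α : Type} {q : ℕ} {l : List α} {cs : List (α × α × α)}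
    (h : cs ∈ diagram q l) {c : α × α × α} (hc : c ∈ cs) : c ∈ cellsOf l := by
  obtain ⟨r, hr⟩ := layersOf_append q (l.length / (3 * q)) (cellsOf l)
  rw [← hr]
  exact List.mem_append_left _ (List.mem_flatten_of_mem h hc)

/-- The remainder `r` is the incomplete last layer or cell; it stays on `X` and is discarded. -/
theorem encNames_eq_diagram (q : ℕ) (ws : List (List Sym)) : ∃ r,
    encNames ws = (diagram q ws).flatMap (fun cs => cs.flatMap encCell) ++ r := by
  obtain ⟨r, hr⟩ := encNames_eq ws
  obtain ⟨r', hr'⟩ := layersOf_append q (ws.length / (3 * q)) (cellsOf ws)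
  refine ⟨r'.flatMap encCell ++ r, ?_⟩
  rw [hr]
  conv_lhs => rw [← hr']
  simp [diagram, List.flatMap_def, List.map_flatten, List.flatten_flatten,
    Function.comp_def]

/-- The point is that Λ layers of q cells satisfy 3Λq ≤ k ≤ d: the total number of cells, not merely
the number per layer, is bounded by the length of the description. Each cell costs O(z + 1), where z
is the length of an index. The constant 500 is generous. -/
theorem distPre_cost {n a d k e x q r s τ τ' z z' Λ : ℕ} (hq : q = n + a) (hk : k ≤ d)
    (hex : e + x ≤ 2 * d) (hΛ : Λ ≤ k) (hΛq : Λ * (3 * q) ≤ k) (hrs : r + s = 3 * q)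
    (hz : z' ≤ z) :
    9 * n + 5 * a + 18 * d + 18 + (14 * k + 3 + (56 * e +
      Λ * (4 * (q * (τ * (7 * z + 6) + 6 * z + 46)) + 12 * z + 50) + 3 +
      (n * (τ' * (7 * z' + 6) + 6 * z' + 9) + 3 * z' + 8 +
      (3 * q + 3 + (3 * r + 3 + (3 * x + 3 + (3 * s + 3))))))) ≤
    500 * (τ + τ' + 1) * ((q + d + 1) * (z + 1)) := by
  have h₁ : Λ * q * (τ * (7 * z + 6) + 6 * z + 46) ≤
      (7 * τ + 46) * ((q + d + 1) * (z + 1)) := by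
    calc Λ * q * (τ * (7 * z + 6) + 6 * z + 46)
        ≤ (q + d + 1) * ((7 * τ + 46) * (z + 1)) := by
          refine Nat.mul_le_mul (by nlinarith) (by nlinarith [Nat.zero_le (τ * z)])
      _ = _ := by ring
  have h₂ : Λ * (12 * z + 50) ≤ 50 * ((q + d + 1) * (z + 1)) := by
    calc Λ * (12 * z + 50) ≤ (q + d + 1) * (50 * (z + 1)) :=
          Nat.mul_le_mul (by omega) (by omega)
      _ = _ := by ring
  have h₃ : n * (τ' * (7 * z' + 6) + 6 * z' + 9) ≤ (7 * τ' + 9) * ((q + d + 1) * (z + 1)) := by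
    calc n * (τ' * (7 * z' + 6) + 6 * z' + 9) ≤ (q + d + 1) * (τ' * (7 * z + 6) + 6 * z + 9) := by
          gcongr; omega
      _ ≤ (q + d + 1) * ((7 * τ' + 9) * (z + 1)) := by
          refine Nat.mul_le_mul_left _ (by nlinarith [Nat.zero_le (τ' * z)])
      _ = _ := by ring
  have h₄ : q + d + 1 ≤ (q + d + 1) * (z + 1) := Nat.le_mul_of_pos_right _ (by omega)
  have h₅ : z ≤ (q + d + 1) * (z + 1) := by nlinarith
  have h₆ : Λ * (4 * (q * (τ * (7 * z + 6) + 6 * z + 46)) + 12 * z + 50) =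
      4 * (Λ * q * (τ * (7 * z + 6) + 6 * z + 46)) + Λ * (12 * z + 50) := by ring
  rw [h₆]
  generalize hW : (q + d + 1) * (z + 1) = W at *
  have h₇ : 500 * (τ + τ' + 1) * W = 500 * (τ * W) + 500 * (τ' * W) + 500 * W := by ring
  have h₈ : (7 * τ + 46) * W = 7 * (τ * W) + 46 * W := by ring
  have h₉ : (7 * τ' + 9) * W = 7 * (τ' * W) + 9 * W := by ring
  rw [h₇]
  rw [h₈] at h₁
  rw [h₉] at h₃
  omega

theorem runs_distPre (T : Script) {m n : ℕ} (C : QCircuit (Fin m × Fin n)) (a : ℕ) (S : Stacks)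
    (hN : (S .N).length = n) (hA : (S .A).length = a) (hD : S .D = C.desc)
    (hS : ∀ k, k ≠ .N → k ≠ .A → k ≠ .D → S k = []) :
    Runs (distPre T) S (update (fun _ => []) .E (distOut T C a).reverse)
      ((500 * (T.cells.size + T.test.length + 1)) *
        ((n + a + C.desc.length + 1) * ((n + a).size + 1))) := by
  set ws := C.outputs.map newName with hws
  set q := n + a with hq
  have hwf : ∀ w ∈ ws, ∀ b ∈ w, b.isOut = false := by
    intro w hw
    obtain ⟨o, -, rfl⟩ := List.mem_map.1 hw
    exact isOut_newName o
  have hlen : (encNames ws).length ≤ 2 * C.desc.length := by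
    refine (length_encNames _).trans ?_
    simp [QCircuit.desc]; omega
  have hlen' : ws.length ≤ C.desc.length := by
    rw [hws, List.length_map]
    refine (length_le_flatMap_out _).trans ?_
    simp [QCircuit.desc]; omega
  obtain ⟨X, hX⟩ := encNames_eq_diagram q ws
  have hcnt : ((encNames ws).filter Sym.isOut).length = ws.length := filter_isOut_encNames hwf
  -- the state before the layers are counted
  let S₁ : Stacks := update (update (update (update (update (update (fun _ => []) .N (S .N)) .Q
    (List.replicate q Sym.sep)) .T (List.replicate (3 * q) Sym.sep)) .E
    (List.replicate (4 * q + workCount + 2 * C.anc) Sym.prep ++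
      C.gates.flatMap (gateDesc newName)).reverse) .X (encNames ws)) .L
      (List.replicate ws.length Sym.sep)
  have h₁ : Runs readProg S S₁ (9 * n + 5 * a + 18 * C.desc.length + 18) := by
    refine ((runs_setupInputs S (hS _ (by decide) (by decide) (by decide))).seq
      ((runs_setupAncillas _).seq ((runs_push _ _ _).seq ((runs_transDesc C _ ?_).seq
      (runs_countProg _))))).congr ?_ ?_
    · simpa using hD
    · have := hS
      funext j
      cases j <;> simp [S₁, hS, hA, hN, ← hws]
      · omega
      · exact hcnt
      · omega
      · omega
    · simp [hS, hA, hN, ← hws]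
      omega
  have hlayers : ∀ cs ∈ diagram q ws, cs.length = q ∧ ∀ c ∈ cs, CellName.WF c := fun cs hcs =>
    ⟨length_of_mem_diagram cs hcs, fun c hc =>
      forall_mem_cellsOf hwf c (mem_cellsOf_of_mem_diagram hcs hc)⟩
  have hnum : (diagram q ws).length = ws.length / (3 * q) := length_layersOf _ _ _
  -- The marks left on `T` and `U` matter only because they must be cleared: a machine that halts
  -- correctly leaves all stacks except the output stack empty.
  obtain ⟨r, s, hrs, h₂⟩ := runs_divProg (3 * q) S₁ (by simp [S₁]) (by simp [S₁]) (by simp [S₁])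
  refine (h₁.seq (h₂.seq ((runs_layersProg T.cells q (diagram q ws) hlayers X _ ?_ ?_ ?_ ?_ ?_ ?_
    ?_ ?_).seq ((runs_testProg T.hd T.test T.tl _ ?_ ?_).seq ((runs_clear _ _).seq
    ((runs_clear _ _).seq ((runs_clear _ _).seq (runs_clear _ _)))))))).congr ?_ ?_
  any_goals simp [S₁, hX, hnum]
  · funext j
    cases j <;> simp [distOut, hN]
    rfl
  · rw [hN]
    refine distPre_cost hq hlen' ?_ (Nat.div_le_self _ _) (Nat.div_mul_le_self _ _) hrs
      (Nat.size_le_size (by omega))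
    simpa [hX] using hlen

end Programs

end

end QLearn

namespace QLearn

noncomputable section

section Machines

open Turing TM2 Function

/-! #### Growth of the stacks -/

/-- The number of symbols that a statement pushes. -/
def pushes {K : Type} {Γ : K → Type} {Λ σ : Type} : Stmt Γ Λ σ → ℕ
  | .push _ _ q => pushes q + 1
  | .peek _ _ q => pushes q
  | .pop _ _ q => pushes q
  | .load _ q => pushes q
  | .branch _ q₁ q₂ => max (pushes q₁) (pushes q₂)
  | .goto _ => 0
  | .halt => 0

variable {K : Type} [DecidableEq K] {Γ : K → Type} {Λ σ : Type}

theorem length_stepAux_le (q : Stmt Γ Λ σ) (v : σ) (S : ∀ k, List (Γ k)) (k : K) :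
    ((stepAux q v S).stk k).length ≤ (S k).length + pushes q := by
  induction q generalizing v S with
  | push j f q ih =>
    refine (ih _ _).trans ?_
    by_cases h : k = j
    · subst h; simp [pushes]; omega
    · simp [h, pushes]
  | peek j f q ih => exact ih _ _
  | pop j f q ih =>
    refine (ih _ _).trans ?_
    by_cases h : k = j
    · subst h; simp [pushes]
    · simp [h, pushes]
  | load f q ih => exact ih _ _
  | branch f q₁ q₂ ih₁ ih₂ =>
    simp only [stepAux, pushes]
    cases f v
    · exact (ih₂ _ _).trans (by omega)
    · exact (ih₁ _ _).trans (by omega)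
  | goto l => simp [pushes]
  | halt => simp [pushes]

/-- A program has finitely many statements, each with boundedly many pushes, so a stack grows at
most linearly in time. -/
theorem exists_length_le [Fintype Λ] (m : Λ → Stmt Γ Λ σ) : ∃ A : ℕ, ∀ n c c' k,
    Steps m n c c' → (c'.stk k).length ≤ (c.stk k).length + A * n := by
  refine ⟨Finset.univ.sup fun l => pushes (m l), fun n => ?_⟩
  induction n with
  | zero => rintro c c' k h; cases h; simp
  | succ n ih =>
    rintro ⟨l, v, S⟩ c' k ⟨c₁, h₁, h⟩
    cases l with
    | none => simp at h₁
    | some l =>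
      simp only [step, Option.some.injEq] at h₁
      refine (ih _ _ k h).trans ?_
      have h₂ := length_stepAux_le (m l) v S k
      have h₃ : pushes (m l) ≤ Finset.univ.sup fun l => pushes (m l) :=
        Finset.le_sup (f := fun l => pushes (m l)) (Finset.mem_univ l)
      rw [← h₁, Nat.mul_succ]
      dsimp only at h₂ ⊢
      omega

/-! #### Machines as programs -/

/-- The program of a machine. -/
def Mach.ofTM (M : FinTM2) : Mach M.Γ M.σ :=
  letI := M.ΛFin
  ⟨M.Λ, M.main, M.m⟩

theorem initList_eq (M : FinTM2) (s : List (M.Γ M.k₀)) :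
    initList M s = ⟨some M.main, M.initialState, update (fun _ => []) M.k₀ s⟩ := by
  unfold initList
  congr 1
  funext k
  by_cases h : k = M.k₀
  · subst h; simp
  · simp [h]

theorem haltList_eq (M : FinTM2) (s : List (M.Γ M.k₁)) :
    haltList M s = ⟨none, M.initialState, update (fun _ => []) M.k₁ s⟩ := by
  unfold haltList
  congr 1
  funext k
  by_cases h : k = M.k₁
  · subst h; simp
  · simp [h]

theorem runs_ofTM (M : FinTM2) {s : List (M.Γ M.k₀)} {s' : List (M.Γ M.k₁)} {c : ℕ}
    (h : TM2OutputsInTime M s (some s') c) :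
    Runs (Mach.ofTM M) (update (fun _ => []) M.k₀ s) (update (fun _ => []) M.k₁ s') c := by
  obtain ⟨⟨r, hr⟩, hle⟩ := h
  refine ⟨r, hle, steps_iff.2 ?_⟩
  rw [Option.map_some, initList_eq, haltList_eq] at hr
  exact hr

theorem length_unaryEncodeNat (n : ℕ) : (Computability.unaryEncodeNat n).length = n :=
  Computability.unary_decode_encode_nat n

theorem unaryEncodeNat_eq (n : ℕ) : Computability.unaryEncodeNat n = List.replicate n true := by
  induction n with
  | zero => rfl
  | succ n ih => rw [Computability.unaryEncodeNat, ih]; rfl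

/-- This converts the time bounds for the learner and for a(n) into bounds on the length of the
description and on a(n) itself, in which the cost of the rewriting is expressed. -/
theorem WritableInTime.length_isBigO {A : Type} {t : ℕ → ℝ} {f : ℕ → List A}
    (ht : (fun n : ℕ => (n : ℝ)) =O[atTop] t) (h : WritableInTime t f) :
    (fun n => ((f n).length : ℝ)) =O[atTop] t := by
  obtain ⟨M, hM⟩ := h
  obtain ⟨B, hB⟩ := @exists_length_le M.tm.K _ _ _ _ M.tm.ΛFin M.tm.m
  have hle : ∀ n, (f n).length ≤ n + B * M.time n := by
    intro n
    obtain ⟨r, hr, hs⟩ := runs_ofTM M.tm (M.outputsFun n)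
    have h₁ := hB _ _ _ M.tm.k₁ hs
    simp only [update_self, List.length_map, id] at h₁
    have h₂ : ((update (fun _ => []) M.tm.k₀ (List.map M.inputAlphabet.invFun
        (Computability.unaryEncodeNat n)) : ∀ k, List (M.tm.Γ k)) M.tm.k₁).length ≤ n := by
      by_cases hk : M.tm.k₁ = M.tm.k₀
      · have : ∀ k, k = M.tm.k₀ → ((update (fun _ => []) M.tm.k₀ (List.map
            M.inputAlphabet.invFun (Computability.unaryEncodeNat n)) :
            ∀ k, List (M.tm.Γ k)) k).length ≤ n := by
          rintro k rfl
          simp [length_unaryEncodeNat]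
        exact this _ hk
      · rw [update_of_ne hk]; simp
    rw [length_unaryEncodeNat] at hr
    have h₃ : B * r ≤ B * M.time n := Nat.mul_le_mul_left _ hr
    omega
  refine IsBigO.trans (IsBigO.of_bound 1 (Eventually.of_forall fun n => ?_))
    (ht.add (hM.const_mul_left (B : ℝ)))
  have := hle n
  simp only [Real.norm_natCast, one_mul]
  rw [Real.norm_of_nonneg (by positivity)]
  exact_mod_cast this

end Machines

section Programs

open Turing TM2 Function

theorem exists_length_runs_le (P : Prog) : ∃ A : ℕ, ∀ S S' c k,
    Runs P S S' c → (S' k).length ≤ (S k).length + A * c := by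
  obtain ⟨A, hA⟩ := exists_length_le P.m
  refine ⟨A, fun S S' c k ⟨n, hn, h⟩ => (hA _ _ _ k h).trans ?_⟩
  have := Nat.mul_le_mul_left A hn
  simp only
  omega

/-- The program that transforms the description of the learner on `X` (reversed) to that of the
distinguisher on `O`. -/
def distProg (T : Script) : Prog := (move .X .D).seq ((distPre T).seq (move .E .O))

theorem exists_runs_distProg (T : Script) : ∃ A : ℕ, ∀ {m n : ℕ}
    (C : QCircuit (Fin m × Fin n)) (a : ℕ),
    Runs (distProg T) (update (update (update (fun _ => []) .N (List.replicate n .sep)) .A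
      (List.replicate a .sep)) .X C.desc.reverse) (update (fun _ => []) .O (distOut T C a))
      (A * ((n + a + C.desc.length + 1) * ((n + a).size + 1))) := by
  obtain ⟨B, hB⟩ := exists_length_runs_le (distPre T)
  obtain ⟨c, hc⟩ : ∃ c : ℕ, ∀ {m n : ℕ} (C : QCircuit (Fin m × Fin n)) (a : ℕ),
      Runs (distPre T) (update (update (update (fun _ => []) .N (List.replicate n .sep)) .A
        (List.replicate a .sep)) .D C.desc) (update (fun _ => []) .E (distOut T C a).reverse)
        (c * ((n + a + C.desc.length + 1) * ((n + a).size + 1))) :=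
    ⟨_, fun C a => runs_distPre T C a _ (by simp) (by simp) (by simp)
      (fun k h₁ h₂ h₃ => by simp [h₁, h₂, h₃])⟩
  refine ⟨(3 * B + 1) * c + 9, fun {m n} C a => ?_⟩
  have h := hc C a
  -- The length of the output is not computed; it is bounded by the time used to write it, which
  -- suffices to pay for the final reversal.
  have hl := hB _ _ _ .E h
  simp at hl
  refine ((runs_move (by decide) _).seq ((h.congr' ?_ rfl).seq (runs_move (by decide) _))).congr
    ?_ ?_
  · funext j; cases j <;> simp
  · funext j; cases j <;> simp
  · simp
    have h₄ : n + a + C.desc.length + 1 ≤ (n + a + C.desc.length + 1) * ((n + a).size + 1) :=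
      Nat.le_mul_of_pos_right _ (by omega)
    generalize (n + a + C.desc.length + 1) * ((n + a).size + 1) = W at *
    nlinarith

end Programs

end

end QLearn

namespace QLearn

noncomputable section

/-! ### Joining the machines of the learner and of a(n) with the rewriting program -/

section Compose

open Turing TM2 Function

/-- The stacks of three machines. -/
abbrev JointStk (M M' : FinTM2) : Type := Stk ⊕ (M.K ⊕ M'.K)

abbrev JointSym (M M' : FinTM2) : JointStk M M' → Type :=
  Sum.elim (fun _ => Sym) (Sum.elim M.Γ M'.Γ)

abbrev JointState (M M' : FinTM2) : Type := Option Sym × M.σ × M'.σ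

variable {M M' : FinTM2}

/-- The joint contents of the stacks. -/
def joint (s : Stacks) (x : ∀ k, List (M.Γ k)) (y : ∀ k, List (M'.Γ k)) :
    ∀ k, List (JointSym M M' k)
  | .inl k => s k
  | .inr (.inl k) => x k
  | .inr (.inr k) => y k

theorem update_joint_own (s : Stacks) (x : ∀ k, List (M.Γ k)) (y : ∀ k, List (M'.Γ k)) (k : Stk)
    (l : List Sym) : update (joint s x y) (.inl k) l = joint (update s k l) x y := by
  funext j
  rcases j with j | j | j
  · by_cases h : j = k
    · subst h; exact (update_self _ _ _).trans (update_self j l s).symm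
    · exact (update_of_ne (by simpa using h) _ _).trans (update_of_ne h _ _).symm
  · exact update_of_ne (by simp) _ _
  · exact update_of_ne (by simp) _ _

theorem update_joint_left (s : Stacks) (x : ∀ k, List (M.Γ k)) (y : ∀ k, List (M'.Γ k)) (k : M.K)
    (l : List (M.Γ k)) :
    update (joint s x y) (.inr (.inl k)) l = joint s (update x k l) y := by
  funext j
  rcases j with j | j | j
  · exact update_of_ne (by simp) _ _
  · by_cases h : j = k
    · subst h; exact (update_self _ _ _).trans (update_self j l x).symm
    · exact (update_of_ne (by simpa using h) _ _).trans (update_of_ne h _ _).symm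
  · exact update_of_ne (by simp) _ _

theorem update_joint_right (s : Stacks) (x : ∀ k, List (M.Γ k)) (y : ∀ k, List (M'.Γ k))
    (k : M'.K) (l : List (M'.Γ k)) :
    update (joint s x y) (.inr (.inr k)) l = joint s x (update y k l) := by
  funext j
  rcases j with j | j | j
  · exact update_of_ne (by simp) _ _
  · exact update_of_ne (by simp) _ _
  · by_cases h : j = k
    · subst h; exact (update_self _ _ _).trans (update_self j l y).symm
    · exact (update_of_ne (by simpa using h) _ _).trans (update_of_ne h _ _).symm

instance : Scratch Sym (JointState M M') where
  put o := (o, M.initialState, M'.initialState)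
  get v := v.1
  get_put _ := rfl

/-- Runs a program, or one of the machines, on the joint stacks. -/
def liftOwn (P : Prog) : Mach (JointSym M M') (JointState M M') :=
  Mach.lift (Γ' := JointSym M M') Sum.inl
    ⟨fun v => v.1, fun a v => (a, v.2), fun _ _ => rfl, fun _ _ _ => rfl, fun _ => rfl⟩ P

def liftLeft : Mach (JointSym M M') (JointState M M') :=
  Mach.lift (Γ' := JointSym M M') (fun k => Sum.inr (Sum.inl k))
    ⟨fun v => v.2.1, fun a v => (v.1, a, v.2.2), fun _ _ => rfl, fun _ _ _ => rfl, fun _ => rfl⟩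
    (Mach.ofTM M)

def liftRight : Mach (JointSym M M') (JointState M M') :=
  Mach.lift (Γ' := JointSym M M') (fun k => Sum.inr (Sum.inr k))
    ⟨fun v => v.2.2, fun a v => (v.1, v.2.1, a), fun _ _ => rfl, fun _ _ _ => rfl, fun _ => rfl⟩
    (Mach.ofTM M')

theorem runs_liftOwn {P : Prog} {s s' : Stacks} {c : ℕ} (h : Runs P s s' c)
    (x : ∀ k, List (M.Γ k)) (y : ∀ k, List (M'.Γ k)) :
    Runs (liftOwn P) (joint s x y) (joint s' x y) c := by
  refine Runs.lift (F := joint s x y) (S₁ := s') (fun _ _ h => Sum.inl_injective h) _ rfl h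
    ⟨fun _ => rfl, ?_⟩
  rintro (k | k | k) hk
  · exact (hk k rfl).elim
  · rfl
  · rfl

theorem runs_liftLeft {x x' : ∀ k, List (M.Γ k)} {c : ℕ} (h : Runs (Mach.ofTM M) x x' c)
    (s : Stacks) (y : ∀ k, List (M'.Γ k)) :
    Runs liftLeft (joint s x y) (joint s x' y) c := by
  refine Runs.lift (F := joint s x y) (S₁ := x')
    (fun _ _ h => Sum.inl_injective (Sum.inr_injective h)) _ rfl h ⟨fun _ => rfl, ?_⟩
  rintro (k | k | k) hk
  · rfl
  · exact (hk k rfl).elim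
  · rfl

theorem runs_liftRight {y y' : ∀ k, List (M'.Γ k)} {c : ℕ} (h : Runs (Mach.ofTM M') y y' c)
    (s : Stacks) (x : ∀ k, List (M.Γ k)) :
    Runs liftRight (joint s x y) (joint s x y') c := by
  refine Runs.lift (F := joint s x y) (S₁ := y')
    (fun _ _ h => Sum.inr_injective (Sum.inr_injective h)) _ rfl h ⟨fun _ => rfl, ?_⟩
  rintro (k | k | k) hk
  · rfl
  · rfl
  · exact (hk k rfl).elim

/-- Pops the symbols of the stack `k` and runs `g` for each of them. -/
def drain {k : JointStk M M'} (e : JointSym M M' k → Sym)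
    (g : Sym → Mach (JointSym M M') (JointState M M')) : Mach (JointSym M M') (JointState M M') :=
  Mach.popLoop k e (fun _ => true) fun o => o.elim (liftOwn skip) g

/-- The machine that runs `M` and `M'` on copies of the input, and then the program `P`, with the
outputs on the stacks `X` and `A`. -/
def composeProg (P : Prog) (one : M.Γ M.k₀) (one' : M'.Γ M'.k₀) (e : M.Γ M.k₁ → Sym) :
    Mach (JointSym M M') (JointState M M') :=
  (drain (k := .inr (.inl M.k₀)) (fun _ => .sep) fun _ =>
    (liftOwn ((push .N [.sep]).seq (push .A [.sep]))).seq
      (Mach.pushList (.inr (.inr M'.k₀)) [one'])).seq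
  ((drain (k := .inl .A) (fun a => a) fun _ => Mach.pushList (.inr (.inl M.k₀)) [one]).seq
  (liftLeft.seq (liftRight.seq
  ((drain (k := .inr (.inr M'.k₁)) (fun _ => .sep) fun _ => liftOwn (push .A [.sep])).seq
  ((drain (k := .inr (.inl M.k₁)) e fun a => liftOwn (push .X [a])).seq (liftOwn P))))))

/-- The input is consumed while being copied to `N`, to `A` and to the input stack of `M'`. Then `A`
is emptied to restore the input of `M`, and is free again to receive the output of `M'`. Draining
the output of `M` reverses it, hence the reversed list on `X`. -/
theorem runs_composeProg (P : Prog) (one : M.Γ M.k₀) (one' : M'.Γ M'.k₀) (e : M.Γ M.k₁ → Sym)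
    {n c c' c'' : ℕ} {u : List (M.Γ M.k₁)} {v : List (M'.Γ M'.k₁)} {w : List Sym}
    (h : TM2OutputsInTime M (List.replicate n one) (some u) c)
    (h' : TM2OutputsInTime M' (List.replicate n one') (some v) c')
    (hP : Runs P (update (update (update (fun _ => []) .N (List.replicate n .sep)) .A
      (List.replicate v.length .sep)) .X (u.map e).reverse) (update (fun _ => []) .O w) c'') :
    Runs (composeProg P one one' e)
      (joint (fun _ => []) (update (fun _ => []) M.k₀ (List.replicate n one)) fun _ => [])
      (joint (update (fun _ => []) .O w) (fun _ => []) fun _ => [])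
      (c + c' + c'' + 8 * n + 3 * v.length + 3 * u.length + 12) := by
  have h₁ : ∀ (s : Stacks) (x : ∀ k, List (M.Γ k)) (y : ∀ k, List (M'.Γ k)) (l : List (M.Γ M.k₀)),
      x M.k₀ = l → Runs (drain (k := .inr (.inl M.k₀)) (fun _ => .sep) fun _ =>
      (liftOwn ((push .N [.sep]).seq (push .A [.sep]))).seq
        (Mach.pushList (.inr (.inr M'.k₀)) [one'])) (joint s x y)
      (joint (update (update s .N (List.replicate l.length .sep ++ s .N)) .A
        (List.replicate l.length .sep ++ s .A)) (update x M.k₀ [])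
        (update y M'.k₀ (List.replicate l.length one' ++ y M'.k₀))) (5 * l.length + 3) := by
    intro s x y l hl
    induction l generalizing s x y with
    | nil =>
      refine (runs_popLoop_nil (S := joint s x y) (k := (.inr (.inl M.k₀) : JointStk M M'))
        (show joint s x y (.inr (.inl M.k₀)) = [] from hl) (runs_liftOwn (runs_skip s) x y)).congr ?_ (by simp)
      congr 1
      · funext j; cases j <;> simp
      · rw [← hl, update_eq_self]
      · simp
    | cons b l ih =>
      refine (runs_popLoop_cont (S := joint s x y) (k := .inr (.inl M.k₀)) hl rfl (c := 3) (c' := 5 * l.length + 3)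
        (S' := joint (update (update s .N (.sep :: s .N)) .A (.sep :: s .A))
          (update x M.k₀ l) (update y M'.k₀ (one' :: y M'.k₀))) ?_ (ih _ _ _ (by simp))).congr
          ?_ (by simp; omega)
      · rw [update_joint_left]
        refine ((runs_liftOwn ((runs_push _ _ _).seq (runs_push _ _ _)) _ _).seq
          (runs_pushList _ _ _)).congr ?_ le_rfl
        refine (update_joint_right _ _ _ _ _).trans ?_
        congr 1
      · congr 1
        · funext j; cases j <;> simp [List.replicate_succ']
        · simp
        · simp [List.replicate_succ']
  have h₂ : ∀ (s : Stacks) (x : ∀ k, List (M.Γ k)) (y : ∀ k, List (M'.Γ k)) (l : List Sym),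
      s .A = l → Runs (drain (k := .inl .A) (fun a => a) fun _ =>
        Mach.pushList (.inr (.inl M.k₀)) [one]) (joint s x y)
      (joint (update s .A []) (update x M.k₀ (List.replicate l.length one ++ x M.k₀)) y)
      (3 * l.length + 3) := by
    intro s x y l hl
    induction l generalizing s x y with
    | nil =>
      refine (runs_popLoop_nil (S := joint s x y) (k := (.inl .A : JointStk M M'))
        (show joint s x y (.inl .A) = [] from hl) (runs_liftOwn (runs_skip s) x y)).congr ?_ (by simp)
      congr 1
      · rw [← hl, update_eq_self]
      · simp
    | cons b l ih =>
      refine (runs_popLoop_cont (S := joint s x y) (k := .inl .A) hl rfl (c := 1) (c' := 3 * l.length + 3)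
        (S' := joint (update s .A l) (update x M.k₀ (one :: x M.k₀)) y) ?_
          (ih _ _ _ (by simp))).congr ?_ (by simp; omega)
      · rw [update_joint_own]
        refine (runs_pushList _ _ _).congr ?_ le_rfl
        refine (update_joint_left _ _ _ _ _).trans ?_
        congr 1
      · congr 1
        · simp
        · simp [List.replicate_succ']
  have h₃ : ∀ (s : Stacks) (x : ∀ k, List (M.Γ k)) (y : ∀ k, List (M'.Γ k))
      (l : List (M'.Γ M'.k₁)), y M'.k₁ = l →
      Runs (drain (k := .inr (.inr M'.k₁)) (fun _ => .sep) fun _ => liftOwn (push .A [.sep]))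
      (joint s x y) (joint (update s .A (List.replicate l.length .sep ++ s .A)) x
        (update y M'.k₁ [])) (3 * l.length + 3) := by
    intro s x y l hl
    induction l generalizing s x y with
    | nil =>
      refine (runs_popLoop_nil (S := joint s x y) (k := (.inr (.inr M'.k₁) : JointStk M M'))
        (show joint s x y (.inr (.inr M'.k₁)) = [] from hl) (runs_liftOwn (runs_skip s) x y)).congr ?_ (by simp)
      congr 1
      · simp
      · rw [← hl, update_eq_self]
    | cons b l ih =>
      refine (runs_popLoop_cont (S := joint s x y) (k := .inr (.inr M'.k₁)) hl rfl (c := 1) (c' := 3 * l.length + 3)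
        (S' := joint (update s .A (.sep :: s .A)) x (update y M'.k₁ l)) ?_
          (ih _ _ _ (by simp))).congr ?_ (by simp; omega)
      · rw [update_joint_right]
        exact runs_liftOwn (runs_push _ _ _) _ _
      · congr 1
        · simp [List.replicate_succ']
        · simp
  have h₄ : ∀ (s : Stacks) (x : ∀ k, List (M.Γ k)) (y : ∀ k, List (M'.Γ k))
      (l : List (M.Γ M.k₁)), x M.k₁ = l →
      Runs (drain (k := .inr (.inl M.k₁)) e fun a => liftOwn (push .X [a]))
      (joint s x y) (joint (update s .X ((l.map e).reverse ++ s .X)) (update x M.k₁ []) y)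
      (3 * l.length + 3) := by
    intro s x y l hl
    induction l generalizing s x y with
    | nil =>
      refine (runs_popLoop_nil (S := joint s x y) (k := (.inr (.inl M.k₁) : JointStk M M'))
        (show joint s x y (.inr (.inl M.k₁)) = [] from hl) (runs_liftOwn (runs_skip s) x y)).congr ?_ (by simp)
      congr 1
      · simp
      · rw [← hl, update_eq_self]
    | cons b l ih =>
      refine (runs_popLoop_cont (S := joint s x y) (k := .inr (.inl M.k₁)) hl rfl (c := 1) (c' := 3 * l.length + 3)
        (S' := joint (update s .X (e b :: s .X)) (update x M.k₁ l) y) ?_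
          (ih _ _ _ (by simp))).congr ?_ (by simp; omega)
      · rw [update_joint_left]
        exact runs_liftOwn (runs_push _ _ _) _ _
      · congr 1
        · simp
        · simp
  refine ((h₁ _ _ _ _ (update_self _ _ _)).seq ((h₂ _ _ _ _ (update_self _ _ _)).seq
    ((runs_liftLeft ((runs_ofTM M h).congr' ?_ rfl) _ _).seq
    ((runs_liftRight ((runs_ofTM M' h').congr' ?_ rfl) _ _).seq
    ((h₃ _ _ _ _ (update_self _ _ _)).seq ((h₄ _ _ _ _ (update_self _ _ _)).seq
    (runs_liftOwn (hP.congr' ?_ rfl) _ _))))))).congr ?_ ?_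
  · simp
  · simp
  · funext j; cases j <;> simp
  · congr 1 <;> simp
  · simp
    omega

/-- The composed machine. -/
def composeTM (P : Prog) (one : M.Γ M.k₀) (one' : M'.Γ M'.k₀) (e : M.Γ M.k₁ → Sym) : FinTM2 :=
  letI := M.kFin
  letI := M'.kFin
  letI := M.σFin
  letI := M'.σFin
  letI : Fintype (JointSym M M' (.inr (.inl M.k₀))) := M.Γk₀Fin
  { K := JointStk M M'
    k₀ := .inr (.inl M.k₀)
    k₁ := .inl .O
    Γ := JointSym M M'
    Λ := (composeProg P one one' e).Λ
    main := (composeProg P one one' e).main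
    σ := JointState M M'
    initialState := default
    m := (composeProg P one one' e).m }

theorem outputs_composeTM {P : Prog} {one : M.Γ M.k₀} {one' : M'.Γ M'.k₀} {e : M.Γ M.k₁ → Sym}
    {n c : ℕ} {w : List Sym}
    (h : Runs (composeProg P one one' e)
      (joint (fun _ => []) (update (fun _ => []) M.k₀ (List.replicate n one)) fun _ => [])
      (joint (update (fun _ => []) .O w) (fun _ => []) fun _ => []) c) :
    Nonempty (TM2OutputsInTime (composeTM P one one' e) (List.replicate n one) (some w) c) := by
  obtain ⟨r, hr, h⟩ := h
  refine ⟨⟨⟨r, ?_⟩, hr⟩⟩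
  have h₀ := initList_eq (composeTM P one one' e) (List.replicate n one)
  have h₁ := haltList_eq (composeTM P one one' e) w
  refine (congrArg (fun x => (flip Bind.bind (composeTM P one one' e).step)^[r] (some x)) h₀).trans
    (Eq.trans ?_ ((steps_iff.1 h).trans (congrArg some (Eq.trans ?_ h₁.symm))))
  · congr 3
    have := update_joint_left (M := M) (M' := M') (fun _ => []) (fun _ => []) (fun _ => []) M.k₀
      (List.replicate n one)
    rw [← this]
    congr 1
    funext j
    rcases j with j | j | j <;> rfl
  · congr 2
    have := update_joint_own (M := M) (M' := M') (fun _ => []) (fun _ => []) (fun _ => []) .O w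
    rw [← this]
    congr 1
    funext j
    rcases j with j | j | j <;> rfl

end Compose

end

end QLearn

namespace QLearn

noncomputable section

/-! ### The time bound t log t -/

section Compose

open Turing TM2 Function

theorem size_add_one_isBigO {t : ℕ → ℝ} (ht : Tendsto t atTop atTop) {f : ℕ → ℕ}
    (hf : (fun n => (f n : ℝ)) =O[atTop] t) :
    (fun n => (((f n).size + 1 : ℕ) : ℝ)) =O[atTop] fun n => Real.logb 2 (t n) := by
  obtain ⟨K, hK, hb⟩ := hf.exists_pos
  have hlog : Tendsto (fun n => Real.logb 2 (t n)) atTop atTop :=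
    (Real.tendsto_logb_atTop (by norm_num)).comp ht
  refine IsBigO.of_bound (1 + (Real.logb 2 (K + 1) + 2)) ?_
  filter_upwards [hb.bound, ht.eventually_ge_atTop 1, hlog.eventually_ge_atTop 1] with n h₁ h₂ h₃
  rw [Real.norm_natCast, Real.norm_of_nonneg (by linarith)] at h₁
  rw [Real.norm_natCast, Real.norm_of_nonneg (by linarith)]
  have h₅ : 0 ≤ Real.logb 2 (K + 1) := Real.logb_nonneg (by norm_num) (by linarith)
  -- Taking K + 1 in place of K makes the inequality f n < (K + 1) t n strict, as `Nat.size_le`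
  -- requires, and keeps the logarithm nonnegative.
  have h₄ : (f n).size ≤ ⌈Real.logb 2 ((K + 1) * t n)⌉₊ := by
    rw [Nat.size_le]
    have : (f n : ℝ) < (2 : ℝ) ^ ⌈Real.logb 2 ((K + 1) * t n)⌉₊ := by
      refine lt_of_lt_of_le (b := (K + 1) * t n) (by nlinarith) ?_
      rw [← Real.rpow_natCast, ← Real.logb_le_iff_le_rpow (by norm_num) (by positivity)]
      exact Nat.le_ceil _
    exact_mod_cast this
  have h₆ : ((f n).size : ℝ) ≤ Real.logb 2 ((K + 1) * t n) + 1 := by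
    refine (Nat.cast_le.2 h₄).trans (Nat.ceil_lt_add_one ?_).le
    exact Real.logb_nonneg (by norm_num) (by nlinarith)
  rw [Real.logb_mul (by positivity) (by positivity)] at h₆
  push_cast
  nlinarith

/-- Since n, a(n) and the length of the learner's description are O(t), the cost (n + a + length +
1)(size(n + a) + 1) is O(t) times O(log t); the runs of the two given machines and the copying are
only O(t). As t tends to infinity, log t is eventually at least 1. -/
theorem WritableInTime.distOut (T : Script) {m : ℕ → ℕ} {t : ℕ → ℝ}
    {C : ∀ n, QCircuit (Fin (m n) × Fin n)} {a : ℕ → ℕ} (ht_pos : ∀ n, 0 < t n)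
    (ht : (fun n : ℕ => (n : ℝ)) =O[atTop] t) (hC : WritableInTime t fun n => (C n).desc)
    (ha : WritableInTime t fun n => Computability.unaryEncodeNat (a n)) :
    WritableInTime (fun n => t n * Real.logb 2 (t n)) fun n => distOut T (C n) (a n) := by
  have hd := hC.length_isBigO ht
  have hal := ha.length_isBigO ht
  simp only [length_unaryEncodeNat] at hal
  obtain ⟨M, hM⟩ := hC
  obtain ⟨M', hM'⟩ := ha
  obtain ⟨A, hA⟩ := exists_runs_distProg T
  let one := M.inputAlphabet.symm true
  let one' := M'.inputAlphabet.symm true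
  have hrun : ∀ n, Nonempty (TM2OutputsInTime
      (composeTM (distProg T) one one' M.outputAlphabet) (List.replicate n one)
      (some (QLearn.distOut T (C n) (a n)))
      (M.time n + M'.time n +
        A * ((n + a n + (C n).desc.length + 1) * ((n + a n).size + 1)) + 8 * n + 3 * a n +
          3 * (C n).desc.length + 12)) := by
    intro n
    have h := M.outputsFun n
    have h' := M'.outputsFun n
    rw [length_unaryEncodeNat] at h h'
    rw [unaryEncodeNat_eq, List.map_replicate] at h h'
    refine outputs_composeTM ?_
    have := runs_composeProg (distProg T) one one' M.outputAlphabet h h'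
      ((hA (C n) (a n)).congr' ?_ rfl)
    · simpa [length_unaryEncodeNat] using this
    · simp [length_unaryEncodeNat]
  have ht' : Tendsto t atTop atTop := by
    obtain ⟨K, hK, hb⟩ := ht.exists_pos
    refine tendsto_atTop_mono' atTop (f₁ := fun n : ℕ => K⁻¹ * n) ?_
      (tendsto_natCast_atTop_atTop.const_mul_atTop (inv_pos.2 hK))
    filter_upwards [hb.bound] with n hn
    rw [Real.norm_natCast, Real.norm_of_nonneg (ht_pos n).le] at hn
    rwa [inv_mul_le_iff₀ hK]
  have hlog : Tendsto (fun n => Real.logb 2 (t n)) atTop atTop :=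
    (Real.tendsto_logb_atTop (by norm_num)).comp ht'
  have h1 : (fun _ => (1 : ℝ)) =O[atTop] t :=
    IsBigO.of_bound 1 (by
      filter_upwards [ht'.eventually_ge_atTop 1] with n hn
      rw [Real.norm_of_nonneg (ht_pos n).le]; simpa using hn)
  have hmul : ∀ {f : ℕ → ℝ}, f =O[atTop] t → f =O[atTop] fun n => t n * Real.logb 2 (t n) := by
    intro f hf
    refine hf.trans (IsBigO.of_bound 1 ?_)
    filter_upwards [hlog.eventually_ge_atTop 1] with n hn
    have := ht_pos n
    rw [Real.norm_of_nonneg this.le, Real.norm_of_nonneg (by nlinarith)]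
    nlinarith
  let N : Turing.TM2ComputableInTime Computability.unaryEncodeNat (id : List Sym → List Sym)
      (fun n => QLearn.distOut T (C n) (a n)) :=
    { tm := composeTM (distProg T) one one' M.outputAlphabet
      inputAlphabet := M.inputAlphabet
      outputAlphabet := Equiv.refl Sym
      time := fun n => M.time n + M'.time n +
        A * ((n + a n + (C n).desc.length + 1) * ((n + a n).size + 1)) + 8 * n + 3 * a n +
          3 * (C n).desc.length + 12
      outputsFun := fun n => by
        rw [length_unaryEncodeNat, unaryEncodeNat_eq, List.map_replicate]
        have := (hrun n).some
        rw [← List.map_id (QLearn.distOut T (C n) (a n))] at this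
        exact this }
  refine ⟨N, ?_⟩
  have hsum : (fun n => ((n + a n + (C n).desc.length + 1 : ℕ) : ℝ)) =O[atTop] t := by
    push_cast
    exact ((ht.add hal).add hd).add h1
  have hsz := size_add_one_isBigO ht' (f := fun n => n + a n) (by push_cast; exact ht.add hal)
  have hprod := (hsum.mul hsz).const_mul_left (A : ℝ)
  have h12 := (hmul h1).const_mul_left 12
  have := (((((hmul hM).add (hmul hM')).add hprod).add ((hmul ht).const_mul_left 8)).add
    ((hmul hal).const_mul_left 3)).add ((hmul hd).const_mul_left 3) |>.add h12
  refine this.congr_left fun n => ?_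
  change _ = ((M.time n + M'.time n +
        A * ((n + a n + (C n).desc.length + 1) * ((n + a n).size + 1)) + 8 * n + 3 * a n +
          3 * (C n).desc.length + 12 : ℕ) : ℝ)
  push_cast
  ring

end Compose

end

end QLearn

namespace QLearn

noncomputable section

/-! ### Operators, gates and channels on a part of a register -/

section Register

open Function Matrix

set_option linter.unusedSectionVars false

variable {α β W : Type}

theorem extend_self (f : α ↪ β) (x : β → Bool) : extend f (x ∘ f) x = x := by
  funext b
  by_cases hb : ∃ a, f a = b
  · obtain ⟨a, rfl⟩ := hb
    simp [f.injective.extend_apply]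
  · rw [extend_apply' _ _ _ hb]

theorem extend_extend (f : α ↪ β) (u w : α → Bool) (x : β → Bool) :
    extend f u (extend f w x) = extend f u x := by
  funext b
  by_cases hb : ∃ a, f a = b
  · obtain ⟨a, rfl⟩ := hb
    simp [f.injective.extend_apply]
  · rw [extend_apply' _ _ _ hb, extend_apply' _ _ _ hb, extend_apply' _ _ _ hb]

theorem extend_comp_self (f : α ↪ β) (u : α → Bool) (x : β → Bool) : extend f u x ∘ f = u :=
  extend_comp f.injective u x

variable [Fintype α] [DecidableEq α] [Fintype β] [DecidableEq β] [Fintype W] [DecidableEq W]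

/-- The operator `M` on the wires `f a`. -/
def liftOp (f : α ↪ β) (M : Op α) : Op β :=
  Matrix.of fun x y => if extend f (y ∘ f) x = y then M (x ∘ f) (y ∘ f) else 0

theorem liftOp_mulVec (f : α ↪ β) (M : Op α) (v : (β → Bool) → ℂ) (x : β → Bool) :
    (liftOp f M *ᵥ v) x = ∑ u, M (x ∘ f) u * v (extend f u x) := by
  simp only [mulVec, dotProduct, liftOp, of_apply, ite_mul, zero_mul]
  rw [← Finset.sum_filter]
  refine Finset.sum_nbij' (fun y => y ∘ f) (fun u => extend f u x) (by simp) ?_ ?_ ?_ ?_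
  · intro u _
    simp [extend_comp_self]
  · intro y hy
    simpa using hy
  · intro u _
    simp [extend_comp_self]
  · intro y hy
    simp only [Finset.mem_filter, Finset.mem_univ, true_and] at hy
    simp [hy]

theorem eq_of_mulVec_eq {M N : Op W} (h : ∀ v, M *ᵥ v = N *ᵥ v) : M = N := by
  ext x y
  simpa using congrFun (h (Pi.single y 1)) x

theorem liftOp_mul (f : α ↪ β) (M N : Op α) : liftOp f (M * N) = liftOp f M * liftOp f N := by
  refine eq_of_mulVec_eq fun v => ?_
  rw [← mulVec_mulVec]
  funext x
  simp only [liftOp_mulVec, extend_comp_self, extend_extend, mul_apply, Finset.mul_sum,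
    Finset.sum_mul]
  rw [Finset.sum_comm]
  simp [mul_assoc]

theorem liftOp_one (f : α ↪ β) : liftOp f (1 : Op α) = 1 := by
  refine eq_of_mulVec_eq fun v => ?_
  funext x
  simp [liftOp_mulVec, one_apply, extend_self]

theorem liftOp_conjTranspose (f : α ↪ β) (M : Op α) : (liftOp f M)ᴴ = liftOp f Mᴴ := by
  ext x y
  simp only [conjTranspose_apply, liftOp, of_apply]
  have : extend f (x ∘ f) y = x ↔ extend f (y ∘ f) x = y := by
    constructor <;> intro h
    · rw [← h, extend_extend, extend_self]
    · rw [← h, extend_extend, extend_self]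
  by_cases h : extend f (y ∘ f) x = y
  · simp [h, this.2 h]
  · rw [if_neg h, if_neg fun h₁ => h (this.1 h₁), star_zero]

/-! #### Gates -/

/-- Renames the wires of a gate. -/
def UGate.map (f : α ↪ β) : UGate α → UGate β
  | .had w => .had (f w)
  | .tee w => .tee (f w)
  | .cnot c t h => .cnot (f c) (f t) (f.injective.ne h)

def Gate.map (f : α ↪ β) : Gate α → Gate β
  | .unitary g => .unitary (g.map f)
  | .measure w => .measure (f w)
  | .reset w => .reset (f w)

theorem extend_eq_iff (f : α ↪ β) (x y : β → Bool) :
    extend f (y ∘ f) x = y ↔ ∀ b, (∀ a, f a ≠ b) → x b = y b := by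
  constructor
  · intro h b hb
    rw [← h, extend_apply' _ _ _ (by simpa using hb)]
  · intro h
    funext b
    by_cases hb : ∃ a, f a = b
    · obtain ⟨a, rfl⟩ := hb
      simp [f.injective.extend_apply]
    · rw [extend_apply' _ _ _ hb]
      exact h b (by simpa using hb)

theorem onWire_map (f : α ↪ β) (u : Matrix Bool Bool ℂ) (w : α) :
    onWire u (f w) = liftOp f (onWire u w) := by
  ext x y
  simp only [onWire, liftOp, of_apply, extend_eq_iff, Function.comp_apply]
  have : (∀ v, v ≠ f w → x v = y v) ↔
      (∀ b, (∀ a, f a ≠ b) → x b = y b) ∧ ∀ v, v ≠ w → x (f v) = y (f v) := by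
    constructor
    · intro h
      exact ⟨fun b hb => h b (hb w).symm, fun v hv => h _ (f.injective.ne hv)⟩
    · rintro ⟨h, h'⟩ v hv
      by_cases hb : ∃ a, f a = v
      · obtain ⟨a, rfl⟩ := hb
        exact h' a fun h => hv (h ▸ rfl)
      · exact h v (by simpa using hb)
  by_cases h₁ : ∀ b, (∀ a, f a ≠ b) → x b = y b
  · by_cases h₂ : ∀ v, v ≠ w → x (f v) = y (f v)
    · rw [if_pos (this.2 ⟨h₁, h₂⟩), if_pos h₁, if_pos h₂]
    · rw [if_neg fun h => h₂ (this.1 h).2, if_pos h₁, if_neg h₂]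
  · rw [if_neg fun h => h₁ (this.1 h).1, if_neg h₁]

theorem UGate.mat_map (f : α ↪ β) (g : UGate α) : (g.map f).mat = liftOp f g.mat := by
  rcases g with w | w | ⟨c, t, h⟩
  · exact onWire_map f _ w
  · exact onWire_map f _ w
  · ext x y
    simp only [UGate.map, UGate.mat, liftOp, of_apply, Function.comp_apply, extend_eq_iff]
    have : x = update y (f t) (xor (y (f t)) (y (f c))) ↔ (∀ b, (∀ a, f a ≠ b) → x b = y b) ∧
        x ∘ f = update (y ∘ f) t (xor (y (f t)) (y (f c))) := by
      constructor
      · intro h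
        refine ⟨fun b hb => ?_, ?_⟩
        · rw [h, update_of_ne (hb t).symm]
        · rw [h, update_comp_eq_of_injective _ f.injective]
      · rintro ⟨h, h'⟩
        rw [← update_comp_eq_of_injective _ f.injective] at h'
        funext b
        by_cases hb : ∃ a, f a = b
        · obtain ⟨a, rfl⟩ := hb
          exact congrFun h' a
        · have hb' : ∀ a, f a ≠ b := by simpa using hb
          rw [h b hb', update_of_ne (hb' t).symm]
    by_cases h₁ : ∀ b, (∀ a, f a ≠ b) → x b = y b
    · by_cases h₂ : x ∘ f = update (y ∘ f) t (xor (y (f t)) (y (f c)))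
      · rw [if_pos (this.2 ⟨h₁, h₂⟩), if_pos h₁, if_pos h₂]
      · rw [if_neg fun h => h₂ (this.1 h).2, if_pos h₁, if_neg h₂]
    · rw [if_neg fun h => h₁ (this.1 h).1, if_neg h₁]

/-- The one-wire register `w`. -/
def wireEmb (w : W) : Unit ↪ W := ⟨fun _ => w, fun _ _ _ => rfl⟩

theorem wireEmb_apply (w : W) (a : Unit) : wireEmb w a = w := rfl

theorem onWire_eq_liftOp (u : Matrix Bool Bool ℂ) (w : W) :
    onWire u w = liftOp (wireEmb w)
      (Matrix.of fun x y => u (x ()) (y ())) := by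
  ext x y
  simp only [onWire, liftOp, of_apply, extend_eq_iff, Function.comp_apply, wireEmb_apply]
  congr 1
  refine propext ⟨fun h b hb => h b (hb ()).symm, fun h b hb => h b fun _ => hb.symm⟩

theorem onWire_conjTranspose_mul (u : Matrix Bool Bool ℂ) (hu : uᴴ * u = 1) (w : W) :
    (onWire u w)ᴴ * onWire u w = 1 := by
  rw [onWire_eq_liftOp, liftOp_conjTranspose, ← liftOp_mul, ← liftOp_one (wireEmb w)]
  congr 1
  ext x y
  have h := congrFun (congrFun hu (x ())) (y ())
  rw [mul_apply] at h ⊢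
  rw [← (Equiv.funUnique Unit Bool).symm.sum_comp]
  simp only [conjTranspose_apply, of_apply, one_apply] at h ⊢
  refine h.trans ?_
  congr 1
  exact propext ⟨fun h => funext fun _ => h, fun h => congrFun h ()⟩

theorem sqrt_two_mul_self : (Real.sqrt 2 : ℂ) * Real.sqrt 2 = 2 := by
  rw [← Complex.ofReal_mul, Real.mul_self_sqrt (by norm_num)]
  norm_num

theorem hadMatrix_conjTranspose_mul : hadMatrixᴴ * hadMatrix = 1 := by
  have h := sqrt_two_mul_self
  have h0 : (Real.sqrt 2 : ℂ) ≠ 0 := by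
    intro h0; rw [h0] at h; norm_num at h
  ext a b
  cases a <;> cases b <;>
    simp [hadMatrix, mul_apply, one_apply] <;> field_simp <;> (try rw [pow_two, h]) <;> norm_num

/-- The eighth root of unity in the gate `T`. -/
def omega8 : ℂ := Complex.exp (Complex.I * (Real.pi / 4))

theorem teeMatrix_conjTranspose_mul : teeMatrixᴴ * teeMatrix = 1 := by
  have : (starRingEnd ℂ) omega8 * omega8 = 1 := by
    have h4 : (starRingEnd ℂ) 4 = 4 := Complex.conj_ofNat 4
    rw [omega8, ← Complex.exp_conj, ← Complex.exp_add]
    simp [h4]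
  rw [teeMatrix, diagonal_conjTranspose, diagonal_mul_diagonal, ← diagonal_one]
  congr 1
  funext a
  cases a
  · simp
  · simpa [omega8] using this

theorem update_xor_involutive {c t : W} (h : c ≠ t) (y : W → Bool) :
    update (update y t (xor (y t) (y c))) t
      (xor (update y t (xor (y t) (y c)) t) (update y t (xor (y t) (y c)) c)) = y := by
  simp [update_of_ne h]

theorem UGate.cnot_mulVec {c t : W} (h : c ≠ t) (v : (W → Bool) → ℂ) (x : W → Bool) :
    ((UGate.cnot c t h).mat *ᵥ v) x = v (update x t (xor (x t) (x c))) := by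
  simp only [mulVec, dotProduct, UGate.mat, of_apply, ite_mul, one_mul, zero_mul]
  rw [Finset.sum_eq_single (update x t (xor (x t) (x c)))]
  · rw [if_pos (update_xor_involutive h x).symm]
  · intro y _ hy
    refine if_neg fun hx => hy ?_
    rw [hx, update_xor_involutive h]
  · simp

theorem UGate.conjTranspose_mul (g : UGate W) : g.matᴴ * g.mat = 1 := by
  rcases g with w | w | ⟨c, t, h⟩
  · exact onWire_conjTranspose_mul _ hadMatrix_conjTranspose_mul w
  · exact onWire_conjTranspose_mul _ teeMatrix_conjTranspose_mul w
  · have hH : (UGate.cnot c t h).matᴴ = (UGate.cnot c t h).mat := by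
      ext x y
      simp only [conjTranspose_apply, UGate.mat, of_apply]
      have : y = update x t (xor (x t) (x c)) ↔ x = update y t (xor (y t) (y c)) := by
        constructor <;> (intro h'; rw [h', update_xor_involutive h])
      simp only [this]
      split_ifs <;> simp
    rw [hH]
    refine eq_of_mulVec_eq fun v => ?_
    rw [← mulVec_mulVec]
    funext x
    rw [UGate.cnot_mulVec, UGate.cnot_mulVec, update_xor_involutive h, one_mulVec]

theorem UGate.had_mulVec (w : W) (v : (W → Bool) → ℂ) (x : W → Bool) :
    ((UGate.had w).mat *ᵥ v) x =
      (v (update x w false) + (if x w then -1 else 1) * v (update x w true)) / Real.sqrt 2 := by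
  rw [UGate.mat, onWire_eq_liftOp, liftOp_mulVec, ← (Equiv.funUnique Unit Bool).symm.sum_comp]
  have : ∀ b, extend (wireEmb w) (fun _ => b) x = update x w b := by
    intro b
    funext a
    by_cases ha : a = w
    · subst ha
      rw [update_self]
      exact (wireEmb a).injective.extend_apply (fun _ => b) x ()
    · rw [extend_apply' _ _ _ (by simpa [wireEmb_apply] using Ne.symm ha), update_of_ne ha]
  have h' : ∀ b, (Equiv.funUnique Unit Bool).symm b = fun _ => b := fun b => rfl
  simp only [h', this, of_apply, Function.comp_apply, wireEmb_apply, Fintype.univ_bool,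
    Finset.mem_singleton, Bool.true_eq_false, not_false_eq_true, Finset.sum_insert,
    Finset.sum_singleton, hadMatrix]
  rcases Bool.eq_false_or_eq_true (x w) with h | h <;> simp [h] <;> ring

theorem UGate.tee_mulVec (w : W) (v : (W → Bool) → ℂ) (x : W → Bool) :
    ((UGate.tee w).mat *ᵥ v) x = omega8 ^ (x w).toNat * v x := by
  simp only [mulVec, dotProduct, UGate.mat, onWire, teeMatrix, of_apply, ite_mul, zero_mul]
  rw [Finset.sum_eq_single x]
  · cases h : x w <;> simp [omega8]
  · intro y _ hy
    split_ifs with h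
    · rw [diagonal_apply_ne, zero_mul]
      intro hw
      refine hy (funext fun a => ?_)
      by_cases ha : a = w
      · rw [ha, hw]
      · exact (h a ha).symm
    · rfl
  · simp

/-! #### Lists of gates -/

/-- The action of a list of gates on vectors. -/
def act (gs : List (UGate W)) (v : (W → Bool) → ℂ) : (W → Bool) → ℂ :=
  gs.foldl (fun v g => g.mat *ᵥ v) v

theorem act_nil (v : (W → Bool) → ℂ) : act [] v = v := rfl

theorem act_cons (g : UGate W) (gs : List (UGate W)) (v : (W → Bool) → ℂ) :
    act (g :: gs) v = act gs (g.mat *ᵥ v) := rfl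

theorem act_append (gs gs' : List (UGate W)) (v : (W → Bool) → ℂ) :
    act (gs ++ gs') v = act gs' (act gs v) := List.foldl_append

/-- The product of a list of gates. -/
def matOf : List (UGate W) → Op W
  | [] => 1
  | g :: gs => matOf gs * g.mat

theorem matOf_mulVec (gs : List (UGate W)) (v : (W → Bool) → ℂ) : matOf gs *ᵥ v = act gs v := by
  induction gs generalizing v with
  | nil => simp [matOf, act_nil]
  | cons g gs ih => rw [matOf, ← mulVec_mulVec, ih, act_cons]

theorem matOf_conjTranspose_mul (gs : List (UGate W)) : (matOf gs)ᴴ * matOf gs = 1 := by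
  induction gs with
  | nil => simp [matOf]
  | cons g gs ih =>
    rw [matOf, conjTranspose_mul, Matrix.mul_assoc, ← Matrix.mul_assoc _ _ g.mat, ih,
      Matrix.one_mul, g.conjTranspose_mul]

theorem foldl_apply_unitary (gs : List (UGate W)) (ρ : Op W) :
    (gs.map Gate.unitary).foldl (fun σ g => g.apply σ) ρ = matOf gs * ρ * (matOf gs)ᴴ := by
  induction gs generalizing ρ with
  | nil => simp [matOf]
  | cons g gs ih =>
    rw [List.map_cons, List.foldl_cons, ih, matOf, conjTranspose_mul, Gate.apply]
    simp only [Matrix.mul_assoc]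

theorem sum_norm_act (gs : List (UGate W)) (v : (W → Bool) → ℂ) :
    ∑ x, ‖act gs v x‖ ^ 2 = ∑ x, ‖v x‖ ^ 2 := by
  have key : ∀ u : (W → Bool) → ℂ, ((∑ x, ‖u x‖ ^ 2 : ℝ) : ℂ) = star u ⬝ᵥ u := by
    intro u
    simp only [dotProduct, Pi.star_apply, Complex.ofReal_sum]
    refine Finset.sum_congr rfl fun x _ => ?_
    rw [Complex.ofReal_pow, ← Complex.conj_mul']; rfl
  have : ((∑ x, ‖act gs v x‖ ^ 2 : ℝ) : ℂ) = (∑ x, ‖v x‖ ^ 2 : ℝ) := by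
    rw [key, key, ← matOf_mulVec, star_mulVec, dotProduct_mulVec, vecMul_vecMul,
      matOf_conjTranspose_mul, vecMul_one]
  exact_mod_cast this

theorem act_sum {ι : Type} (s : Finset ι) (gs : List (UGate W)) (v : ι → (W → Bool) → ℂ) :
    act gs (∑ i ∈ s, v i) = ∑ i ∈ s, act gs (v i) := by
  simp only [← matOf_mulVec, mulVec_sum]

theorem act_smul (gs : List (UGate W)) (c : ℂ) (v : (W → Bool) → ℂ) :
    act gs (c • v) = c • act gs v := by
  simp only [← matOf_mulVec, mulVec_smul]

theorem act_add (gs : List (UGate W)) (v v' : (W → Bool) → ℂ) :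
    act gs (v + v') = act gs v + act gs v' := by
  simp only [← matOf_mulVec, mulVec_add]

/-- By `hr` the factor `r` is constant along the wires in the range of `f`, so it is a spectator for
gates on these wires. -/
theorem act_map (f : α ↪ β) (gs : List (UGate α)) (u : (α → Bool) → ℂ) (r : (β → Bool) → ℂ)
    (hr : ∀ w x, r (extend f w x) = r x) :
    act (gs.map (UGate.map f)) (fun x => u (x ∘ f) * r x) = fun x => act gs u (x ∘ f) * r x := by
  induction gs generalizing u with
  | nil => rfl
  | cons g gs ih =>
    rw [List.map_cons, act_cons, act_cons, ← ih]
    congr 1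
    funext x
    rw [UGate.mat_map, liftOp_mulVec]
    simp only [extend_comp_self, hr, mulVec, dotProduct, Finset.sum_mul, mul_assoc]

/-- A vector all of whose nonzero coordinates satisfy `S`. -/
def Supp (S : (W → Bool) → Prop) (v : (W → Bool) → ℂ) : Prop := ∀ x, v x ≠ 0 → S x

theorem eq_sum_single (v : (W → Bool) → ℂ) :
    v = ∑ x, v x • (Pi.single x 1 : (W → Bool) → ℂ) := by
  funext y
  simp [Finset.sum_apply, Pi.single_apply]

/-- By linearity it suffices to treat basis vectors, and each of them factors into a basis vector on
the wires of `f` and a spectator. Thus identities verified on a few wires, and only for admissible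
basis states, carry over to the whole register. -/
theorem act_congr_map (f : α ↪ β) {gs gs' : List (UGate α)} {S : (α → Bool) → Prop}
    (h : ∀ x, S x → act gs (Pi.single x 1) = act gs' (Pi.single x 1)) {v : (β → Bool) → ℂ}
    (hv : Supp (fun x => S (x ∘ f)) v) :
    act (gs.map (UGate.map f)) v = act (gs'.map (UGate.map f)) v := by
  rw [eq_sum_single v, act_sum, act_sum]
  refine Finset.sum_congr rfl fun x _ => ?_
  rw [act_smul, act_smul]
  by_cases hx : v x = 0
  · simp [hx]
  have hS := hv x hx
  have hs : (Pi.single x 1 : (β → Bool) → ℂ) = fun y =>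
      (Pi.single (x ∘ f) 1 : (α → Bool) → ℂ) (y ∘ f) *
        (if extend f (x ∘ f) y = x then 1 else 0) := by
    funext y
    simp only [Pi.single_apply]
    by_cases hy : y = x
    · subst hy; simp [extend_self]
    · rw [if_neg hy]
      by_cases h₁ : y ∘ f = x ∘ f
      · rw [if_pos h₁, ← h₁, extend_self, if_neg hy, mul_zero]
      · rw [if_neg h₁, zero_mul]
  rw [hs, act_map, act_map, h _ hS] <;> simp [extend_extend]

/-- The wire that a gate acts on. -/
def UGate.target : UGate W → W
  | .had w => w
  | .tee w => w
  | .cnot _ t _ => t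

theorem UGate.mat_ne_zero {g : UGate W} {x y : W → Bool} (h : g.mat x y ≠ 0) {w : W}
    (hw : w ≠ g.target) : x w = y w := by
  rcases g with v | v | ⟨c, t, hct⟩
  · simp only [UGate.mat, onWire, of_apply, ne_eq, ite_eq_right_iff, Classical.not_imp] at h
    exact h.1 w hw
  · simp only [UGate.mat, onWire, of_apply, ne_eq, ite_eq_right_iff, Classical.not_imp] at h
    exact h.1 w hw
  · simp only [UGate.mat, of_apply, ne_eq, ite_eq_right_iff, Classical.not_imp] at h
    rw [h.1]
    exact update_of_ne hw _ _

theorem matOf_ne_zero {gs : List (UGate W)} {x y : W → Bool} (h : matOf gs x y ≠ 0) {w : W}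
    (hw : ∀ g ∈ gs, w ≠ g.target) : x w = y w := by
  induction gs generalizing y with
  | nil =>
    simp only [matOf, one_apply, ne_eq, ite_eq_right_iff, Classical.not_imp] at h
    rw [h.1]
  | cons g gs ih =>
    rw [matOf, mul_apply] at h
    obtain ⟨z, -, hz⟩ := Finset.exists_ne_zero_of_sum_ne_zero h
    simp only [List.mem_cons, forall_eq_or_imp] at hw
    exact (ih (left_ne_zero_of_mul hz) hw.2).trans
      (UGate.mat_ne_zero (right_ne_zero_of_mul hz) hw.1)

/-- A gate changes no wire except its target, so a condition on the remaining wires survives. -/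
theorem Supp.act {gs : List (UGate W)} {S : (W → Bool) → Prop} {v : (W → Bool) → ℂ}
    (hv : Supp S v) (hS : ∀ x y, (∀ w, (∀ g ∈ gs, w ≠ g.target) → x w = y w) → S y → S x) :
    Supp S (act gs v) := by
  intro x hx
  rw [← matOf_mulVec, mulVec, dotProduct] at hx
  obtain ⟨y, -, hy⟩ := Finset.exists_ne_zero_of_sum_ne_zero hx
  exact hS x y (fun w hw => matOf_ne_zero (left_ne_zero_of_mul hy) hw)
    (hv y (right_ne_zero_of_mul hy))

/-! #### Channels on a part of a register -/

/-- The product of `σ` on the wires `f a` and `τ` on the other wires. -/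
def tens (f : α ↪ β) (σ : Op α) (τ : Op β) : Op β :=
  Matrix.of fun x y => σ (x ∘ f) (y ∘ f) * τ x y

theorem tens_conjTranspose (f : α ↪ β) (σ : Op α) (τ : Op β) :
    (tens f σ τ)ᴴ = tens f σᴴ τᴴ := by
  ext x y
  simp [tens]

theorem liftOp_mul_tens (f : α ↪ β) (M σ : Op α) (τ : Op β)
    (hτ : ∀ w x y, τ (extend f w x) y = τ x y) :
    liftOp f M * tens f σ τ = tens f (M * σ) τ := by
  ext x y
  have := liftOp_mulVec f M (fun x => tens f σ τ x y) x
  refine this.trans ?_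
  simp [tens, extend_comp_self, hτ, mul_apply, Finset.sum_mul, mul_assoc]

/-- `τ` does not see the wires of `f` in either index, so `tens f σ τ` is a product state up to
notation and the channel acts on `σ` alone. -/
theorem Gate.apply_map (f : α ↪ β) (g : Gate α) (σ : Op α) (τ : Op β)
    (hτ : ∀ w x y, τ (extend f w x) y = τ x y) (hτ' : ∀ w x y, τ x (extend f w y) = τ x y) :
    (g.map f).apply (tens f σ τ) = tens f (g.apply σ) τ := by
  rcases g with g | w | w
  · simp only [Gate.map, Gate.apply, UGate.mat_map]
    rw [liftOp_mul_tens f _ _ _ hτ]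
    -- Passing to adjoints turns the multiplication from the right into one from the left.
    refine conjTranspose_injective ?_
    rw [conjTranspose_mul, conjTranspose_conjTranspose, tens_conjTranspose, liftOp_mul_tens,
      tens_conjTranspose]
    · simp
    · intro u x y
      simp [hτ']
  · ext x y
    simp only [Gate.map, Gate.apply, tens, of_apply, Function.comp_apply, ite_mul, zero_mul]
  · have hu : ∀ (x : β → Bool) b, update x (f w) b = extend f (update (x ∘ f) w b) x := by
      intro x b
      funext a
      by_cases ha : ∃ c, f c = a
      · obtain ⟨c, rfl⟩ := ha
        rw [f.injective.extend_apply]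
        by_cases hc : c = w
        · subst hc; simp
        · rw [update_of_ne hc, update_of_ne (f.injective.ne hc)]; rfl
      · rw [extend_apply' _ _ _ ha, update_of_ne]
        rintro rfl
        exact ha ⟨w, rfl⟩
    ext x y
    simp only [Gate.map, Gate.apply, tens, of_apply, Function.comp_apply, ite_mul, zero_mul, hu,
      extend_comp_self, hτ, hτ', Finset.sum_mul]

theorem foldl_apply_map (f : α ↪ β) (gs : List (Gate α)) (σ : Op α) (τ : Op β)
    (hτ : ∀ w x y, τ (extend f w x) y = τ x y) (hτ' : ∀ w x y, τ x (extend f w y) = τ x y) :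
    (gs.map (Gate.map f)).foldl (fun σ g => g.apply σ) (tens f σ τ) =
      tens f (gs.foldl (fun σ g => g.apply σ) σ) τ := by
  induction gs generalizing σ with
  | nil => rfl
  | cons g gs ih => rw [List.map_cons, List.foldl_cons, Gate.apply_map f g σ τ hτ hτ', ih]; rfl

end Register

end

end QLearn

namespace QLearn

noncomputable section

/-! ### Toffoli, X and controlled H from H, T and CNOT -/

section Macros

open Function Matrix

set_option linter.unusedSectionVars false

variable {α W : Type} [Fintype α] [DecidableEq α] [Fintype W] [DecidableEq W]

theorem omega8_pow_four : omega8 ^ 4 = -1 := by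
  rw [omega8, ← Complex.exp_nat_mul, ← Complex.exp_pi_mul_I]
  congr 1
  push_cast
  ring

theorem omega8_pow_eight : omega8 ^ 8 = 1 := by
  rw [show 8 = 4 * 2 from rfl, pow_mul, omega8_pow_four]
  norm_num

/-- This is 2 cos(π/4) = ω + ω⁻¹ with ω⁻¹ = -ω³. It reduces identities between gates to polynomial
identities in ω modulo ω⁴ = -1. -/
theorem sqrt_two_eq : (Real.sqrt 2 : ℂ) = omega8 - omega8 ^ 3 := by
  have h : omega8 = (Real.sqrt 2 / 2 : ℝ) + (Real.sqrt 2 / 2 : ℝ) * Complex.I := by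
    rw [omega8, mul_comm, Complex.exp_mul_I, ← Real.cos_pi_div_four]
    conv_rhs => rw [show Real.cos (Real.pi / 4) * Complex.I = Real.sin (Real.pi / 4) * Complex.I by
      rw [Real.sin_pi_div_four, Real.cos_pi_div_four]]
    push_cast
    rfl
  have h2 := sqrt_two_mul_self
  have hI := Complex.I_mul_I
  rw [h]
  push_cast
  generalize (Real.sqrt 2 : ℂ) = s at *
  generalize Complex.I = I at *
  linear_combination s / 8 * (1 + 3 * I + 3 * I ^ 2 + I ^ 3) * h2 + s / 4 * (3 + I) * hI

theorem act_replicate_tee (k : ℕ) (w : W) (v : (W → Bool) → ℂ) (x : W → Bool) :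
    act (List.replicate k (.tee w)) v x = omega8 ^ (k * (x w).toNat) * v x := by
  induction k generalizing v with
  | zero => simp [act_nil]
  | succ k ih =>
    rw [List.replicate_succ, act_cons, ih, UGate.tee_mulVec, ← mul_assoc, ← pow_add, Nat.succ_mul]

theorem matOf_map (f : α ↪ W) (gs : List (UGate α)) :
    matOf (gs.map (UGate.map f)) = liftOp f (matOf gs) := by
  induction gs with
  | nil => exact (liftOp_one f).symm
  | cons g gs ih => rw [List.map_cons, matOf, ih, UGate.mat_map, ← liftOp_mul]; rfl

theorem act_map_apply (f : α ↪ W) (gs : List (UGate α)) (v : (W → Bool) → ℂ) (x : W → Bool) :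
    act (gs.map (UGate.map f)) v x = ∑ u, matOf gs (x ∘ f) u * v (extend f u x) := by
  rw [← matOf_mulVec, matOf_map, liftOp_mulVec]

/-- The phase and the permutation of the coordinates for gates other than `H`. -/
def monomial : List (UGate W) → (W → Bool) → ℕ × (W → Bool)
  | [], x => (0, x)
  | .had _ :: gs, x => monomial gs x
  | .tee w :: gs, x => ((monomial gs x).1 + ((monomial gs x).2 w).toNat, (monomial gs x).2)
  | .cnot c t _ :: gs, x => ((monomial gs x).1,
      update (monomial gs x).2 t (xor ((monomial gs x).2 t) ((monomial gs x).2 c)))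

def UGate.isHad : UGate W → Bool
  | .had _ => true
  | _ => false

theorem act_monomial {gs : List (UGate W)} (hgs : ∀ g ∈ gs, g.isHad = false)
    (v : (W → Bool) → ℂ) (x : W → Bool) :
    act gs v x = omega8 ^ (monomial gs x).1 * v (monomial gs x).2 := by
  induction gs generalizing v with
  | nil => simp [act_nil, monomial]
  | cons g gs ih =>
    simp only [List.mem_cons, forall_eq_or_imp] at hgs
    rw [act_cons, ih hgs.2]
    rcases g with w | w | ⟨c, t, h⟩
    · exact (Bool.noConfusion hgs.1)
    · rw [UGate.tee_mulVec, ← mul_assoc, ← pow_add]; rfl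
    · rw [UGate.cnot_mulVec]; rfl

/-- The gate `CCZ` on three wires. -/
def cczLocal : List (UGate (Fin 3)) :=
  [.tee 0, .tee 1, .tee 2, .cnot 0 1 (by decide)] ++ List.replicate 7 (.tee 1) ++
    [.cnot 1 2 (by decide), .tee 2, .cnot 0 1 (by decide), .cnot 1 2 (by decide)] ++
    List.replicate 7 (.tee 2) ++ [.cnot 0 2 (by decide), .cnot 1 2 (by decide)] ++
    List.replicate 7 (.tee 2) ++ [.cnot 1 2 (by decide)]

/-- The phase polynomial behind the circuit is x + y + z - (x⊕y) - (y⊕z) - (x⊕z) + (x⊕y⊕z) = 4xyz.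
The CNOTs produce the parities one after another, and a minus sign is T⁷ = T⁻¹. Eight basis states
are checked. -/
theorem monomial_cczLocal : ∀ x : Fin 3 → Bool, (monomial cczLocal x).2 = x ∧
    (monomial cczLocal x).1 % 8 = 4 * (x 0 && x 1 && x 2).toNat := by
  decide +kernel

theorem act_cczLocal (v : (Fin 3 → Bool) → ℂ) (x : Fin 3 → Bool) :
    act cczLocal v x = (-1) ^ (x 0 && x 1 && x 2).toNat * v x := by
  rw [act_monomial (by decide), (monomial_cczLocal x).1, ← Nat.div_add_mod (monomial _ x).1 8,
    (monomial_cczLocal x).2, pow_add, pow_mul, omega8_pow_eight, one_pow, one_mul, pow_mul,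
    omega8_pow_four]

/-- Three wires. -/
def wires₃ (a b t : W) (h : a ≠ b ∧ a ≠ t ∧ b ≠ t) : Fin 3 ↪ W :=
  ⟨![a, b, t], by
    intro i j
    obtain ⟨h₁, h₂, h₃⟩ := h
    fin_cases i <;> fin_cases j <;> simp [h₁, h₂, h₃, h₁.symm, h₂.symm, h₃.symm]⟩

theorem act_ccz (a b t : W) (h : a ≠ b ∧ a ≠ t ∧ b ≠ t) (v : (W → Bool) → ℂ) (x : W → Bool) :
    act (cczLocal.map (UGate.map (wires₃ a b t h))) v x =
      (if x a && x b && x t then -1 else 1) * v x := by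
  have hM : ∀ x u, matOf cczLocal x u =
      (-1) ^ (x 0 && x 1 && x 2).toNat * if x = u then 1 else 0 := by
    intro x u
    have := act_cczLocal (Pi.single u 1) x
    rw [← matOf_mulVec, mulVec_single_one] at this
    simpa [Pi.single_apply] using this
  rw [act_map_apply]
  simp only [hM]
  rw [Finset.sum_eq_single (x ∘ wires₃ a b t h)]
  · rw [if_pos rfl, mul_one, extend_self]
    congr 1
    change (-1 : ℂ) ^ (x a && x b && x t).toNat = _
    cases x a && x b && x t <;> simp
  · intro u _ hu
    rw [if_neg (Ne.symm hu)]
    simp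
  · simp

/-- Conjugating a phase by `H` gives a flip. -/
theorem act_had_conj {gs : List (UGate W)} {p : (W → Bool) → Bool} {t : W}
    (hp : ∀ x b, p (update x t b) = p x)
    (h : ∀ v x, act gs v x = (if p x && x t then -1 else 1) * v x)
    (v : (W → Bool) → ℂ) (x : W → Bool) :
    act (.had t :: (gs ++ [.had t])) v x = v (update x t (xor (x t) (p x))) := by
  have h2 := sqrt_two_mul_self
  have h0 : (Real.sqrt 2 : ℂ) ≠ 0 := by
    intro h0; rw [h0] at h2; norm_num at h2
  rw [act_cons, act_append, act_cons, act_nil, UGate.had_mulVec, h, h, UGate.had_mulVec,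
    UGate.had_mulVec]
  simp only [hp, update_idem, update_self]
  rcases Bool.eq_false_or_eq_true (x t) with h₁ | h₁ <;>
  rcases Bool.eq_false_or_eq_true (p x) with h₃ | h₃ <;>
  · simp only [h₁, h₃]
    field_simp
    rw [pow_two, h2]
    simp
    ring

/-- The Toffoli gate. -/
def tofGates (a b t : W) (h : a ≠ b ∧ a ≠ t ∧ b ≠ t) : List (UGate W) :=
  .had t :: (cczLocal.map (UGate.map (wires₃ a b t h)) ++ [.had t])

theorem act_tofGates (a b t : W) (h : a ≠ b ∧ a ≠ t ∧ b ≠ t) (v : (W → Bool) → ℂ)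
    (x : W → Bool) :
    act (tofGates a b t h) v x = v (update x t (xor (x t) (x a && x b))) :=
  act_had_conj (p := fun x => x a && x b)
    (fun x c => by simp only [update_of_ne h.2.1, update_of_ne h.2.2])
    (fun v x => act_ccz a b t h v x) v x

/-- The gate `X`. -/
def flipGates (t : W) : List (UGate W) := .had t :: (List.replicate 4 (.tee t) ++ [.had t])

theorem act_flipGates (t : W) (v : (W → Bool) → ℂ) (x : W → Bool) :
    act (flipGates t) v x = v (update x t (xor (x t) true)) :=
  act_had_conj (p := fun _ => true) (fun _ _ => rfl)
    (fun v x => by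
      rw [act_replicate_tee, pow_mul, omega8_pow_four]
      cases x t <;> simp) v x

/-- The controlled Hadamard gate. -/
def chGates (f z : W) (h : f ≠ z) : List (UGate W) :=
  List.replicate 6 (.tee z) ++ (.had z :: (List.replicate 7 (.tee z) ++
    (.cnot f z h :: .tee z :: .had z :: List.replicate 2 (.tee z))))

/-- The list is T⁻²-H-T⁻¹ on `z`, then a CNOT, then the inverse T-H-T². With control 0 everything
cancels. With control 1 the gate X is conjugated: T takes it to (X + Y)/√2, H takes this to (Z -
Y)/√2, and T² takes this to (Z + X)/√2, which is the Hadamard matrix. -/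
theorem act_chGates (f z : W) (h : f ≠ z) (v : (W → Bool) → ℂ) (x : W → Bool) :
    act (chGates f z h) v x = if x f then ((UGate.had z).mat *ᵥ v) x else v x := by
  have h2 := sqrt_two_mul_self
  have h0 : (Real.sqrt 2 : ℂ) ≠ 0 := by
    intro h0; rw [h0] at h2; norm_num at h2
  have h4 := omega8_pow_four
  have hs := sqrt_two_eq
  rw [chGates, act_append, act_cons, act_append, act_cons, act_cons, act_cons, act_replicate_tee,
    UGate.had_mulVec]
  simp only [UGate.tee_mulVec, UGate.cnot_mulVec, act_replicate_tee, UGate.had_mulVec,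
    update_self, update_idem, update_of_ne h]
  rcases Bool.eq_false_or_eq_true (x z) with h₁ | h₁ <;>
  rcases Bool.eq_false_or_eq_true (x f) with h₃ | h₃
  all_goals
    rw [h₁, h₃]
    simp
    have hv : update x z (x z) = x := update_eq_self z x
    rw [h₁] at hv
    simp only [hv]
    field_simp
  -- In each of the four cases a polynomial identity in ω and √2 is left, which lies in the ideal of
  -- the relations ω⁴ = -1, √2 = ω - ω³ and (√2)² = 2.
  · generalize update x z false = y
    linear_combination (omega8 * (omega8 ^ 4 - 1) * (v y - v x) -
      omega8 ^ 3 * (omega8 ^ 8 - omega8 ^ 4 + 1) * v x) * h4 - (v y - v x) * hs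
  · generalize update x z false = y
    linear_combination ((omega8 ^ 4 - 1) * (omega8 ^ 8 + 2) * v x -
      omega8 ^ 2 * (omega8 ^ 4 - 1) * v y) * h4 - v x * h2
  · generalize update x z true = y
    linear_combination (omega8 ^ 3 * (v x + v y) -
      omega8 * (omega8 ^ 8 - omega8 ^ 4 + 1) * v y) * h4 - (v x + v y) * hs
  · generalize update x z true = y
    linear_combination (omega8 ^ 4 - 1) * (v x - omega8 ^ 6 * v y) * h4 - v x * h2

/-- Gates that permute the basis vectors up to phases. -/
inductive XGate (W : Type) : Type
  | tee (w : W)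
  | cnot (c t : W) (h : c ≠ t)
  | flip (w : W)
  | tof (a b t : W) (h : a ≠ b ∧ a ≠ t ∧ b ≠ t)

def XGate.expand : XGate W → List (UGate W)
  | .tee w => [.tee w]
  | .cnot c t h => [.cnot c t h]
  | .flip w => flipGates w
  | .tof a b t h => tofGates a b t h

def XGate.phase : XGate W → (W → Bool) → ℕ
  | .tee w, x => (x w).toNat
  | _, _ => 0

def XGate.perm : XGate W → (W → Bool) → W → Bool
  | .tee _, x => x
  | .cnot c t _, x => update x t (xor (x t) (x c))
  | .flip t, x => update x t (xor (x t) true)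
  | .tof a b t _, x => update x t (xor (x t) (x a && x b))

theorem XGate.perm_perm (g : XGate W) (x : W → Bool) : g.perm (g.perm x) = x := by
  rcases g with w | ⟨c, t, h⟩ | w | ⟨a, b, t, h₁, h₂, h₃⟩
  · rfl
  · exact update_xor_involutive h x
  · simp [XGate.perm]
  · simp [XGate.perm, update_of_ne h₂, update_of_ne h₃]

theorem act_expand (g : XGate W) (v : (W → Bool) → ℂ) (x : W → Bool) :
    act g.expand v x = omega8 ^ g.phase x * v (g.perm x) := by
  rcases g with w | ⟨c, t, h⟩ | w | ⟨a, b, t, h⟩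
  · exact UGate.tee_mulVec w v x
  · exact (UGate.cnot_mulVec h v x).trans (by simp [XGate.phase, XGate.perm])
  · exact (act_flipGates w v x).trans (by simp [XGate.phase, XGate.perm])
  · exact (act_tofGates a b t h v x).trans (by simp [XGate.phase, XGate.perm])

/-- An amplitude at y is pulled back along `perm`, whereas a basis vector is pushed forward; the two
agree because `perm` is an involution. -/
theorem act_expand_single (g : XGate W) (x : W → Bool) :
    act g.expand (Pi.single x 1) = omega8 ^ g.phase x • Pi.single (g.perm x) 1 := by
  funext y
  rw [act_expand, Pi.smul_apply, Pi.single_apply, Pi.single_apply, smul_eq_mul]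
  by_cases h : g.perm y = x
  · have hy : y = g.perm x := by rw [← h, g.perm_perm]
    rw [if_pos h, if_pos hy, mul_one, mul_one]
    congr 1
    rw [hy]
    rcases g with w | ⟨c, t, h⟩ | w | ⟨a, b, t, h⟩ <;> rfl
  · have hy : y ≠ g.perm x := by
      rintro rfl
      exact h (g.perm_perm x)
    rw [if_neg h, if_neg hy, mul_zero, mul_zero]

/-- The effect of a list of gates on a basis vector. -/
def steer : List (XGate W) → (W → Bool) → ℕ × (W → Bool)
  | [], x => (0, x)
  | g :: gs, x => (g.phase x + (steer gs (g.perm x)).1, (steer gs (g.perm x)).2)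

theorem act_flatMap_expand_single (gs : List (XGate W)) (x : W → Bool) :
    act (gs.flatMap XGate.expand) (Pi.single x 1) =
      omega8 ^ (steer gs x).1 • Pi.single (steer gs x).2 1 := by
  induction gs generalizing x with
  | nil => simp [act_nil, steer]
  | cons g gs ih =>
    rw [List.flatMap_cons, act_append, act_expand_single, act_smul, ih, smul_smul, ← pow_add]
    rfl

theorem act_had_single (w : W) (x : W → Bool) :
    act [.had w] (Pi.single x 1) =
      (1 / (Real.sqrt 2 : ℂ)) • Pi.single (update x w false) 1 +
      ((if x w then -1 else 1) / (Real.sqrt 2 : ℂ)) • Pi.single (update x w true) 1 := by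
  funext y
  rw [act_cons, act_nil, UGate.had_mulVec]
  simp only [Pi.single_apply, Pi.add_apply, Pi.smul_apply, smul_eq_mul]
  have key : ∀ b c, (update y w b = x ∧ y w = c) ↔ (x w = b ∧ y = update x w c) := by
    intro b c
    constructor
    · rintro ⟨rfl, rfl⟩
      simp
    · rintro ⟨rfl, rfl⟩
      simp
  have h₁ := key
  rcases Bool.eq_false_or_eq_true (x w) with h | h <;>
  rcases Bool.eq_false_or_eq_true (y w) with h' | h' <;>
  · simp only [h, h'] at h₁
    have h₂ := h₁ false false
    have h₃ := h₁ false true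
    have h₄ := h₁ true false
    have h₅ := h₁ true true
    simp only [reduceCtorEq, true_and, and_true, false_and, and_false, iff_false,
      false_iff] at h₂ h₃ h₄ h₅
    simp [*]
    try (split_ifs <;> ring)

end Macros

end

end QLearn

namespace QLearn

noncomputable section

/-! ### Gates controlled by the mark of a cell -/

section Cells

open Function Matrix

set_option linter.unusedSectionVars false

/-- The wire of a cell, and the work wires: three bits, four scratch wires (products of bits, the
test for a mark, a product with the wire, the parity of the controls) and the wire of the test. -/
abbrev CellWire : Type := Option (Fin 8)

/-- Adds to wire `4` whether the bits on the wires `0, 1, 2` are `b₀ b₁ b₂`. -/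
def matchBits (b₀ b₁ b₂ : Bool) : List (XGate CellWire) :=
  let flips : List (XGate CellWire) := (bif b₀ then [] else [.flip (some 0)]) ++
    (bif b₁ then [] else [.flip (some 1)]) ++ (bif b₂ then [] else [.flip (some 2)])
  flips ++ [.tof (some 0) (some 1) (some 3) (by decide), .tof (some 3) (some 2) (some 4) (by decide),
    .tof (some 0) (some 1) (some 3) (by decide)] ++ flips

/-- Multiplies with a phase if the wires `f` and `z` are both `1`. -/
def phaseGates : List (XGate CellWire) :=
  [.tof (some 4) none (some 5) (by decide), .tee (some 5), .tof (some 4) none (some 5) (by decide)]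

/-- The first block repeats the test for the mark of H and so erases it after the controlled H; the
rest computes the test for the mark of T, applies the phase, and erases the test. -/
def oneTail : List (XGate CellWire) :=
  matchBits false false true ++ matchBits false true false ++ phaseGates ++
    matchBits false true false

/-- The passes over a layer. -/
inductive Pass : Type
  | one
  | ctl
  | tgt

def ctlGates : List (XGate CellWire) :=
  matchBits false true true ++ [.tof (some 4) none (some 6) (by decide)] ++
    matchBits false true true

def tgtGates : List (XGate CellWire) :=
  matchBits true false false ++ [.tof (some 4) (some 6) none (by decide)] ++
    matchBits true false false

/-- The gates for a cell, controlled by the bits on the wires `0, 1, 2`. -/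
def Pass.gates : Pass → List (UGate CellWire)
  | .one => (matchBits false false true).flatMap XGate.expand ++
      (chGates (some 4) none (by decide) ++ oneTail.flatMap XGate.expand)
  | .ctl => ctlGates.flatMap XGate.expand
  | .tgt => tgtGates.flatMap XGate.expand

/-- The gates for a given mark, on the wire of the cell and the parity wire. -/
def Pass.marked : Pass → Mark → List (UGate Bool)
  | .one, .had => [.had false]
  | .one, .tee => [.tee false]
  | .ctl, .control => [.cnot false true (by decide)]
  | .tgt, .target => [.cnot true false (by decide)]
  | _, _ => []

/-- The wire of a cell and the parity wire. -/
def cellParity : Bool ↪ CellWire := ⟨fun b => bif b then some 6 else none, by decide⟩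

def cellState (b₀ b₁ b₂ z p c : Bool) : CellWire → Bool
  | none => z
  | some k => ![b₀, b₁, b₂, false, false, false, p, c] k

theorem eq_cellState {x : CellWire → Bool} (h₃ : x (some 3) = false) (h₄ : x (some 4) = false)
    (h₅ : x (some 5) = false) : x = cellState (x (some 0)) (x (some 1)) (x (some 2)) (x none)
      (x (some 6)) (x (some 7)) := by
  funext w
  rcases w with _ | k
  · rfl
  · fin_cases k <;> simp [cellState, *]

theorem steer_ctlGates : ∀ b₀ b₁ b₂ z p c : Bool,
    steer ctlGates (cellState b₀ b₁ b₂ z p c) = (0, cellState b₀ b₁ b₂ z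
      (xor p (!b₀ && b₁ && b₂ && z)) c) := by
  decide +kernel

theorem steer_tgtGates : ∀ b₀ b₁ b₂ z p c : Bool,
    steer tgtGates (cellState b₀ b₁ b₂ z p c) = (0, cellState b₀ b₁ b₂
      (xor z (b₀ && !b₁ && !b₂ && p)) p c) := by
  decide +kernel

theorem steer_matchBits : ∀ b₀ b₁ b₂ z p c : Bool,
    steer (matchBits false false true) (cellState b₀ b₁ b₂ z p c) =
      (0, update (cellState b₀ b₁ b₂ z p c) (some 4) (!b₀ && !b₁ && b₂)) := by
  decide +kernel

theorem steer_oneTail : ∀ b₀ b₁ b₂ z p c : Bool,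
    steer oneTail (update (cellState b₀ b₁ b₂ z p c) (some 4) (!b₀ && !b₁ && b₂)) =
      ((!b₀ && b₁ && !b₂ && z).toNat, cellState b₀ b₁ b₂ z p c) := by
  decide +kernel

theorem act_ite_had_single (f z : CellWire) (h : f ≠ z) (x : CellWire → Bool) :
    act (chGates f z h) (Pi.single x 1) =
      if x f then act [.had z] (Pi.single x 1) else Pi.single x 1 := by
  have key : ∀ y : CellWire → Bool, (Pi.single x 1 : (CellWire → Bool) → ℂ) y ≠ 0 → y f = x f := by
    intro y hy
    rw [Pi.single_apply, ne_eq, ite_eq_right_iff, Classical.not_imp] at hy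
    rw [hy.1]
  have key' : ∀ y : CellWire → Bool, act [.had z] (Pi.single x 1) y ≠ 0 → y f = x f :=
    Supp.act (S := fun y => y f = x f) key fun y y' hy hy' => by
      rw [hy f (by simpa [UGate.target] using h), hy']
  funext y
  rw [act_chGates]
  by_cases hy : y f = x f
  · rw [hy]
    split_ifs <;> rfl
  · have h₁ : (Pi.single x 1 : (CellWire → Bool) → ℂ) y = 0 := by
      by_contra h; exact hy (key y h)
    have h₂ : act [.had z] (Pi.single x 1) y = 0 := by
      by_contra h; exact hy (key' y h)
    have h₃ : ((UGate.had z).mat *ᵥ Pi.single x 1) y = 0 := h₂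
    rw [h₁, h₃]
    split_ifs <;> first | exact h₂.symm | exact h₁.symm

/-- All gates except the controlled H map basis vectors to basis vectors up to a phase, so their
effect is a finite check over six bits by `steer`. In the pass for one-qubit gates the list is cut
at the controlled H, whose two output terms are followed separately. The hypotheses say that the
scratch wires start at 0; they are restored. -/
theorem act_cell (k : Pass) (x : CellWire → Bool)
    (h₃ : x (some 3) = false) (h₄ : x (some 4) = false) (h₅ : x (some 5) = false) :
    act k.gates (Pi.single x 1) = act ((k.marked (Mark.ofBits (x (some 0)) (x (some 1))
      (x (some 2)))).map (UGate.map cellParity)) (Pi.single x 1) := by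
  have hx := eq_cellState h₃ h₄ h₅
  generalize x (some 0) = b₀ at *
  generalize x (some 1) = b₁ at *
  generalize x (some 2) = b₂ at *
  generalize x none = z at *
  generalize x (some 6) = p at *
  generalize x (some 7) = c at *
  subst hx
  have hc : ∀ (c t : CellWire) (h : c ≠ t) (y : CellWire → Bool),
      act [.cnot c t h] (Pi.single y 1) = Pi.single (update y t (xor (y t) (y c))) 1 := by
    intro c t h y
    exact (act_expand_single (.cnot c t h) y).trans (by simp [XGate.phase, XGate.perm])
  have ht : ∀ (t : CellWire) (y : CellWire → Bool),
      act [.tee t] (Pi.single y 1) = omega8 ^ (y t).toNat • Pi.single y 1 := by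
    intro t y
    exact act_expand_single (.tee t) y
  have hn : ∀ v : (CellWire → Bool) → ℂ, act [] v = v := fun v => rfl
  rcases k with _ | _ | _
  · have hT := steer_oneTail b₀ b₁ b₂
    rw [Pass.gates, act_append, act_append, act_flatMap_expand_single, steer_matchBits,
      pow_zero, one_smul, act_ite_had_single]
    simp only [update_self]
    by_cases hh : (!b₀ && !b₁ && b₂) = true
    · have hb : b₀ = false ∧ b₁ = false ∧ b₂ = true := by
        simpa [and_assoc] using hh
      obtain ⟨rfl, rfl, rfl⟩ := hb
      -- Concrete updates of a cell state are decided over the remaining bits; other hypotheses are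
      -- cleared so that these bits can be reverted.
      have hu : ∀ b, update (update (cellState false false true z p c) (some 4) true) none b =
          update (cellState false false true b p c) (some 4) true := by
        clear h₃ h₄ h₅ hT
        revert z p c
        decide +kernel
      have hu' : ∀ b, update (cellState false false true z p c) none b =
          cellState false false true b p c := by
        clear h₃ h₄ h₅ hT hu
        revert z p c
        decide +kernel
      have hT' : ∀ b, steer oneTail (update (cellState false false true b p c) (some 4) true) =
          (0, cellState false false true b p c) := fun b => by simpa using hT b p c
      rw [if_pos hh, act_had_single, act_add, act_smul, act_smul, act_flatMap_expand_single,
        act_flatMap_expand_single]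
      simp only [hh, hu, hT']
      change _ = act [.had none] _
      rw [act_had_single, hu', hu']
      cases z <;> simp [cellState]
    · rw [if_neg hh, act_flatMap_expand_single, hT]
      clear hT
      cases b₀ <;> cases b₁ <;> cases b₂ <;>
        first
        | exact absurd rfl hh
        | (simp only [Pass.marked, Mark.ofBits, List.map_cons, List.map_nil, UGate.map]
           simp [hn, ht, cellParity, cellState])
  · rw [Pass.gates, act_flatMap_expand_single, steer_ctlGates, pow_zero, one_smul]
    have hu : update (cellState false true true z p c) (some 6) (xor p z) =
        cellState false true true z (xor p z) c := by
      clear h₃ h₄ h₅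
      revert z p c; decide +kernel
    cases b₀ <;> cases b₁ <;> cases b₂ <;>
      simp only [Pass.marked, Mark.ofBits, List.map_cons, List.map_nil, UGate.map] <;>
      simp [hn, hc, cellParity]
    exact congrArg (fun y => (Pi.single y 1 : (CellWire → Bool) → ℂ)) hu.symm
  · rw [Pass.gates, act_flatMap_expand_single, steer_tgtGates, pow_zero, one_smul]
    have hu : update (cellState true false false z p c) none (xor z p) =
        cellState true false false (xor z p) p c := by
      clear h₃ h₄ h₅
      revert z p c; decide +kernel
    cases b₀ <;> cases b₁ <;> cases b₂ <;>
      simp only [Pass.marked, Mark.ofBits, List.map_cons, List.map_nil, UGate.map] <;>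
      simp [hn, hc, cellParity]
    exact congrArg (fun y => (Pi.single y 1 : (CellWire → Bool) → ℂ)) hu.symm

end Cells

end

end QLearn

namespace QLearn

noncomputable section

/-! ### The universal circuit for whole layers -/

section Layers

open Function Matrix

set_option linter.unusedSectionVars false

/-! #### Layers of a circuit diagram with one parity wire -/

section Parity

variable {W : Type} [Fintype W] [DecidableEq W]

/-- The effect on a basis vector of gates without phases. -/
def flow (gs : List (XGate W)) (x : W → Bool) : W → Bool := gs.foldl (fun x g => g.perm x) x

theorem flow_append (gs gs' : List (XGate W)) (x : W → Bool) :
    flow (gs ++ gs') x = flow gs' (flow gs x) := List.foldl_append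

theorem act_flow {gs : List (XGate W)} (h : ∀ g ∈ gs, ∀ x, g.phase x = 0) (x : W → Bool) :
    act (gs.flatMap XGate.expand) (Pi.single x 1) = Pi.single (flow gs x) 1 := by
  induction gs generalizing x with
  | nil => rfl
  | cons g gs ih =>
    simp only [List.mem_cons, forall_eq_or_imp] at h
    rw [List.flatMap_cons, act_append, act_expand_single, h.1, pow_zero, one_smul, ih h.2]
    rfl

variable {q : ℕ} (μ : Fin q → Mark)

def ctlCnots (l : List (Fin q)) : List (XGate (Option (Fin q))) :=
  l.flatMap fun i => if μ i = .control then [.cnot (some i) none (by simp)] else []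

def tgtCnots (l : List (Fin q)) : List (XGate (Option (Fin q))) :=
  l.flatMap fun i => if μ i = .target then [.cnot none (some i) (by simp)] else []

def rowCnots (i : Fin q) (l : List (Fin q)) : List (XGate (Option (Fin q))) :=
  l.flatMap fun j => if h : i ≠ j then
    (if μ i = .control ∧ μ j = .target then [.cnot (some i) (some j) (by simpa using h)] else [])
    else []

def parity (l : List (Fin q)) (x : Option (Fin q) → Bool) : Bool :=
  l.foldr (fun i b => xor (decide (μ i = .control) && x (some i)) b) false

def shift (l : List (Fin q)) (b : Bool) (x : Option (Fin q) → Bool) : Option (Fin q) → Bool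
  | none => x none
  | some j => xor (x (some j)) (decide (j ∈ l ∧ μ j = .target) && b)

theorem parity_congr (l : List (Fin q)) {x y : Option (Fin q) → Bool}
    (h : ∀ i, μ i = .control → x (some i) = y (some i)) : parity μ l x = parity μ l y := by
  induction l with
  | nil => rfl
  | cons i l ih =>
    simp only [parity, List.foldr_cons] at ih ⊢
    rw [ih]
    by_cases hi : μ i = .control
    · simp [hi, h i hi]
    · simp [hi]

theorem flow_ctlCnots (l : List (Fin q)) (x : Option (Fin q) → Bool) :
    flow (ctlCnots μ l) x = update x none (xor (x none) (parity μ l x)) := by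
  induction l generalizing x with
  | nil => simp [flow, ctlCnots, parity]
  | cons i l ih =>
    rw [ctlCnots, List.flatMap_cons, flow_append]
    refine (ih _).trans ?_
    by_cases hi : μ i = .control
    · simp only [hi, if_true]
      simp only [flow, List.foldl_cons, List.foldl_nil, XGate.perm, update_self, update_idem]
      rw [parity_congr μ l (y := x) (fun i _ => update_of_ne (by simp) _ _)]
      simp [parity, hi]
    · simp [hi, flow, parity]

theorem flow_tgtCnots (l : List (Fin q)) (hl : l.Nodup) (x : Option (Fin q) → Bool) :
    flow (tgtCnots μ l) x = shift μ l (x none) x := by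
  induction l generalizing x with
  | nil =>
    funext w
    cases w <;> simp [flow, tgtCnots, shift]
  | cons i l ih =>
    rw [List.nodup_cons] at hl
    rw [tgtCnots, List.flatMap_cons, flow_append]
    refine (ih hl.2 _).trans ?_
    by_cases hi : μ i = .target
    · simp only [hi, if_true]
      simp only [flow, List.foldl_cons, List.foldl_nil, XGate.perm]
      funext w
      rcases w with _ | j
      · simp [shift]
      · by_cases hj : j = i
        · subst hj
          simp [shift, hl.1, hi]
        · simp [shift, hj]
    · funext w
      rcases w with _ | j
      · simp [shift, hi, flow]
      · by_cases hj : j = i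
        · subst hj
          simp [shift, hi, flow]
        · simp [shift, hj, hi, flow]

theorem flow_rowCnots (i : Fin q) (hi : μ i = .control) (l : List (Fin q)) (hl : l.Nodup)
    (x : Option (Fin q) → Bool) :
    flow (rowCnots μ i l) x = shift μ l (x (some i)) x := by
  induction l generalizing x with
  | nil =>
    funext w
    cases w <;> simp [flow, rowCnots, shift]
  | cons k l ih =>
    rw [List.nodup_cons] at hl
    rw [rowCnots, List.flatMap_cons, flow_append]
    refine (ih hl.2 _).trans ?_
    by_cases hk : μ k = .target
    · have hik : i ≠ k := by rintro rfl; rw [hi] at hk; cases hk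
      simp only [hik, hk, hi, ne_eq, not_false_eq_true, and_self, if_true, dite_true]
      simp only [flow, List.foldl_cons, List.foldl_nil, XGate.perm]
      funext w
      rcases w with _ | j
      · simp [shift]
      · by_cases hj : j = k
        · subst hj
          simp [shift, hl.1, hk, hik]
        · simp [shift, hj, hik]
    · funext w
      rcases w with _ | j
      · simp [shift, hk, flow]
      · by_cases hj : j = k
        · subst hj
          simp [shift, hk, flow]
        · simp [shift, hj, hk, flow]

theorem shift_shift (l : List (Fin q)) (b b' : Bool) (x : Option (Fin q) → Bool) :
    shift μ l b (shift μ l b' x) = shift μ l (xor b' b) x := by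
  funext w
  rcases w with _ | j
  · rfl
  · by_cases h : j ∈ l ∧ μ j = .target
    · simp [shift, h]
    · simp [shift, h]

theorem parity_shift (l l' : List (Fin q)) (b : Bool) (x : Option (Fin q) → Bool) :
    parity μ l (shift μ l' b x) = parity μ l x :=
  parity_congr μ l fun i hi => by simp [shift, hi]

theorem flow_allCnots (l : List (Fin q)) (x : Option (Fin q) → Bool) :
    flow (l.flatMap fun i => rowCnots μ i (List.finRange q)) x =
      shift μ (List.finRange q) (parity μ l x) x := by
  induction l generalizing x with
  | nil =>
    funext w
    cases w <;> simp [flow, shift, parity]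
  | cons i l ih =>
    rw [List.flatMap_cons, flow_append]
    refine (ih _).trans ?_
    by_cases hi : μ i = .control
    · rw [flow_rowCnots μ i hi _ (List.nodup_finRange q), parity_shift, shift_shift]
      simp [parity, hi]
    · have : rowCnots μ i (List.finRange q) = [] := by
        simp [rowCnots, hi]
      rw [this]
      simp [flow, parity, hi]

/-- A wire has only one mark, so no target is a control, and the CNOTs of a layer simply add the
parity of all controls to every target. The parity wire collects this bit, hands it to the targets,
and is reset by a second control pass, since the controls have not changed. This takes linearly many
gates where the layer has a product of two counts. -/
theorem flow_parity (x : Option (Fin q) → Bool) (hx : x none = false) :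
    flow (ctlCnots μ (List.finRange q) ++ (tgtCnots μ (List.finRange q) ++
      ctlCnots μ (List.finRange q))) x =
    flow ((List.finRange q).flatMap fun i => rowCnots μ i (List.finRange q)) x := by
  rw [flow_append, flow_append, flow_allCnots, flow_ctlCnots,
    flow_tgtCnots μ _ (List.nodup_finRange q), flow_ctlCnots, parity_shift, update_self, hx,
    Bool.false_xor, parity_congr μ (List.finRange q) (y := x) (fun i _ => update_of_ne (by simp) _ _)]
  funext w
  rcases w with _ | j
  · simp [shift, hx]
  · simp [shift]

theorem act_parity (x : Option (Fin q) → Bool) (hx : x none = false) :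
    act ((ctlCnots μ (List.finRange q) ++ (tgtCnots μ (List.finRange q) ++
      ctlCnots μ (List.finRange q))).flatMap XGate.expand) (Pi.single x 1) =
    act (((List.finRange q).flatMap fun i => rowCnots μ i (List.finRange q)).flatMap XGate.expand)
      (Pi.single x 1) := by
  rw [act_flow, act_flow, flow_parity μ x hx]
  · intro g hg
    simp only [List.mem_flatMap, rowCnots] at hg
    obtain ⟨i, -, j, -, hg⟩ := hg
    split_ifs at hg <;> simp_all [XGate.phase]
  · intro g hg
    simp only [List.mem_append, List.mem_flatMap, ctlCnots, tgtCnots] at hg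
    rcases hg with ⟨i, -, hg⟩ | ⟨i, -, hg⟩ | ⟨i, -, hg⟩ <;> split_ifs at hg <;>
      simp_all [XGate.phase]

end Parity

/-! #### Cells whose marks are on classical wires -/

variable {A : Type} [Fintype A] [DecidableEq A] {n q : ℕ}

/-- The wires of the learner, of the test state, of the described circuit, and the work wires. -/
abbrev Reg (A : Type) (n q : ℕ) : Type := A ⊕ (Fin n ⊕ (Fin q ⊕ Fin 8))

abbrev workWire (k : Fin 8) : Reg A n q := .inr (.inr (.inr k))

def cellEmb (i : Fin q) : CellWire ↪ Reg A n q :=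
  ⟨fun w => w.elim (.inr (.inr (.inl i))) workWire, by
    rintro (_ | j) (_ | k) h <;> simp_all⟩

def parityEmb (i : Fin q) : Bool ↪ Reg A n q := cellParity.trans (cellEmb i)

theorem parityEmb_false (i : Fin q) :
    (parityEmb i : Bool ↪ Reg A n q) false = .inr (.inr (.inl i)) := rfl

theorem parityEmb_true (i : Fin q) : (parityEmb i : Bool ↪ Reg A n q) true = workWire 6 := rfl

def circuitEmb : Fin q ↪ Reg A n q := ⟨fun i => .inr (.inr (.inl i)), by intro i j h; simpa using h⟩

theorem circuitEmb_apply (i : Fin q) :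
    (circuitEmb i : Reg A n q) = .inr (.inr (.inl i)) := rfl

def loadGates (c : A × A × A) : List (UGate (Reg A n q)) :=
  [.cnot (.inl c.1) (workWire 0) (by simp), .cnot (.inl c.2.1) (workWire 1) (by simp),
    .cnot (.inl c.2.2) (workWire 2) (by simp)]

def loadPerm (c : A × A × A) (x : Reg A n q → Bool) : Reg A n q → Bool :=
  update (update (update x (workWire 0) (xor (x (workWire 0)) (x (.inl c.1))))
    (workWire 1) (xor (x (workWire 1)) (x (.inl c.2.1))))
    (workWire 2) (xor (x (workWire 2)) (x (.inl c.2.2)))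

theorem act_loadGates (c : A × A × A) (v : (Reg A n q → Bool) → ℂ) :
    act (loadGates c) v = fun x => v (loadPerm c x) := by
  funext x
  simp only [loadGates, act_cons, act_nil, UGate.cnot_mulVec]
  congr 1
  funext w
  rcases w with w | w | w | k
  · simp [loadPerm]
  · simp [loadPerm]
  · simp [loadPerm]
  · fin_cases k <;> simp [loadPerm]

theorem loadPerm_loadPerm (c : A × A × A) (x : Reg A n q → Bool) :
    loadPerm c (loadPerm c x) = x := by
  funext w
  rcases w with w | w | w | k
  · simp [loadPerm]
  · simp [loadPerm]
  · simp [loadPerm]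
  · fin_cases k <;> simp [loadPerm]

theorem act_map_comp {α W : Type} [Fintype α] [DecidableEq α] [Fintype W] [DecidableEq W]
    (f : α ↪ W) (gs : List (UGate α)) (v : (W → Bool) → ℂ) (π : (W → Bool) → W → Bool)
    (h₁ : ∀ x, π x ∘ f = x ∘ f) (h₂ : ∀ u x, π (extend f u x) = extend f u (π x)) :
    act (gs.map (UGate.map f)) (fun x => v (π x)) =
      fun x => act (gs.map (UGate.map f)) v (π x) := by
  funext x
  rw [act_map_apply, act_map_apply]
  simp [h₁, h₂]

theorem UGate.map_map {α β γ : Type} (f : α ↪ β) (g : β ↪ γ) (u : UGate α) :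
    (u.map f).map g = u.map (f.trans g) := by
  rcases u with _ | _ | _ <;> rfl

def cellGates (k : Pass) (i : Fin q) (c : A × A × A) : List (UGate (Reg A n q)) :=
  loadGates c ++ k.gates.map (UGate.map (cellEmb i)) ++ loadGates c

/-- The mark on the wires of a cell. -/
def cellMark (a : A → Bool) (c : A × A × A) : Mark := Mark.ofBits (a c.1) (a c.2.1) (a c.2.2)

/-- The basis states with `a` on the wires of the learner, and zeros on the first work wires. -/
def Clean (a : A → Bool) (x : Reg A n q → Bool) : Prop :=
  (∀ w, x (.inl w) = a w) ∧ ∀ k : Fin 8, k.val < 6 → x (workWire k) = false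

/-- After loading, the work wires 0, 1, 2 carry the bits of the mark, so `act_cell` applies. The
marked gates touch only the wire of the cell and the parity wire, which loading neither reads nor
changes; they commute with it, and the two loadings cancel. Nothing is assumed about the three wires
of the cell, which may coincide. -/
theorem act_cellGates (k : Pass) (i : Fin q) (c : A × A × A) {a : A → Bool}
    {v : (Reg A n q → Bool) → ℂ} (hv : Supp (Clean a) v) :
    act (cellGates k i c) v =
      act ((k.marked (cellMark a c)).map (UGate.map (parityEmb i))) v := by
  have h₁ : ∀ x : Reg A n q → Bool, loadPerm c x ∘ parityEmb i = x ∘ parityEmb i := by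
    intro x
    funext b
    cases b <;> simp [loadPerm, parityEmb_false, parityEmb_true]
  have h₂ : ∀ u (x : Reg A n q → Bool),
      loadPerm c (extend (parityEmb i) u x) = extend (parityEmb i) u (loadPerm c x) := by
    intro u x
    funext w
    by_cases hw : ∃ b, parityEmb i b = w
    · obtain ⟨b, rfl⟩ := hw
      rw [(parityEmb i).injective.extend_apply]
      refine (congrFun (h₁ _) b).trans ?_
      simp
    · rw [extend_apply' _ _ _ hw]
      have hA : ∀ w : A, extend (parityEmb i) u x (.inl w) = x (.inl w) := fun w => by
        rw [extend_apply']
        rintro ⟨b, hb⟩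
        cases b <;> simp [parityEmb_false, parityEmb_true] at hb
      have hw' : ∀ l : Fin 8, l ≠ 6 → extend (parityEmb i) u x (workWire l) = x (workWire l) :=
        fun l hl => by
        rw [extend_apply']
        rintro ⟨b, hb⟩
        cases b <;> simp [parityEmb_false, parityEmb_true] at hb
        exact hl hb.symm
      have hww : extend (parityEmb i) u x w = x w := extend_apply' _ _ _ hw
      simp only [loadPerm, hA, hw' 0 (by decide), hw' 1 (by decide), hw' 2 (by decide),
        update_apply, hww]
  rw [cellGates, act_append, act_append, act_loadGates c v]
  rw [act_congr_map (cellEmb i) (gs' := (k.marked (cellMark a c)).map (UGate.map cellParity))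
    (S := fun y => y (some 0) = a c.1 ∧ y (some 1) = a c.2.1 ∧ y (some 2) = a c.2.2 ∧
      y (some 3) = false ∧ y (some 4) = false ∧ y (some 5) = false)]
  · rw [List.map_map]
    have : (UGate.map (cellEmb (A := A) (n := n) i) ∘ UGate.map cellParity) =
        UGate.map (parityEmb i) := funext fun u => UGate.map_map _ _ u
    rw [this, act_map_comp (parityEmb i) _ v (loadPerm c) h₁ h₂, act_loadGates]
    simp only [loadPerm_loadPerm]
  · rintro x ⟨hx₀, hx₁, hx₂, hx₃, hx₄, hx₅⟩
    rw [act_cell k x hx₃ hx₄ hx₅, hx₀, hx₁, hx₂]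
    rfl
  · intro x hx
    obtain ⟨hx₁, hx₂⟩ := hv _ hx
    have hA : ∀ w, x (.inl w) = a w := fun w => by simpa [loadPerm] using hx₁ w
    have e₀ := hx₂ 0 (by decide)
    have e₁ := hx₂ 1 (by decide)
    have e₂ := hx₂ 2 (by decide)
    have e₃ := hx₂ 3 (by decide)
    have e₄ := hx₂ 4 (by decide)
    have e₅ := hx₂ 5 (by decide)
    simp [loadPerm, hA] at e₀ e₁ e₂ e₃ e₄ e₅
    exact ⟨e₀, e₁, e₂, e₃, e₄, e₅⟩

theorem supp_marked (k : Pass) (i : Fin q) (μ : Mark) {a : A → Bool}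
    {v : (Reg A n q → Bool) → ℂ} (hv : Supp (Clean a) v) :
    Supp (Clean a) (act ((k.marked μ).map (UGate.map (parityEmb i))) v) := by
  refine hv.act fun x y hxy hy => ?_
  have ht : ∀ w : Reg A n q, (∀ b, parityEmb i b ≠ w) → x w = y w := by
    intro w hw
    refine hxy w fun g hg => ?_
    obtain ⟨g', -, rfl⟩ := List.mem_map.1 hg
    have : (g'.map (parityEmb (A := A) (n := n) i)).target = parityEmb i g'.target := by
      rcases g' with _ | _ | _ <;> rfl
    rw [this]
    exact (hw _).symm
  refine ⟨fun w => (ht _ fun b => ?_).trans (hy.1 w), fun l hl => (ht _ fun b => ?_).trans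
    (hy.2 l hl)⟩
  · cases b <;> simp [parityEmb_false, parityEmb_true]
  · cases b <;> simp [parityEmb_false, parityEmb_true]
    rintro rfl
    revert hl
    decide

def passGates (k : Pass) (c : Fin q → A × A × A) : List (UGate (Reg A n q)) :=
  (List.finRange q).flatMap fun i => cellGates k i (c i)

def markedPass (A : Type) [Fintype A] [DecidableEq A] (n : ℕ) {q : ℕ} (k : Pass)
    (μ : Fin q → Mark) : List (UGate (Reg A n q)) :=
  (List.finRange q).flatMap fun i => (k.marked (μ i)).map (UGate.map (parityEmb i))

theorem act_passGates (k : Pass) (c : Fin q → A × A × A) {a : A → Bool}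
    {v : (Reg A n q → Bool) → ℂ} (hv : Supp (Clean a) v) :
    act (passGates k c) v = act (markedPass A n k fun i => cellMark a (c i)) v ∧
      Supp (Clean a) (act (markedPass A n k fun i => cellMark a (c i)) v) := by
  unfold passGates markedPass
  generalize List.finRange q = l
  induction l generalizing v with
  | nil => exact ⟨rfl, hv⟩
  | cons i l ih =>
    simp only [List.flatMap_cons, act_append]
    rw [act_cellGates k i (c i) hv]
    exact ih (supp_marked k i _ hv)

def diagramLayer (c : Fin q → A × A × A) : List (UGate (Reg A n q)) :=
  passGates .one c ++ (passGates .ctl c ++ (passGates .tgt c ++ passGates .ctl c))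

/-- The wires of the described circuit, and the parity wire. -/
def circuitParityEmb : Option (Fin q) ↪ Reg A n q :=
  ⟨fun w => w.elim (workWire 6) fun i => .inr (.inr (.inl i)), by
    rintro (_ | j) (_ | k) h <;> simp_all⟩

theorem map_ctlCnots (μ : Fin q → Mark) :
    ((ctlCnots μ (List.finRange q)).flatMap XGate.expand).map (UGate.map circuitParityEmb) =
      markedPass A n .ctl μ := by
  simp only [ctlCnots, markedPass, List.flatMap_assoc, List.map_flatMap]
  congr 1
  funext i
  cases μ i <;> (simp [Pass.marked, XGate.expand, UGate.map]; try exact ⟨rfl, rfl⟩)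

theorem map_tgtCnots (μ : Fin q → Mark) :
    ((tgtCnots μ (List.finRange q)).flatMap XGate.expand).map (UGate.map circuitParityEmb) =
      markedPass A n .tgt μ := by
  simp only [tgtCnots, markedPass, List.flatMap_assoc, List.map_flatMap]
  congr 1
  funext i
  cases μ i <;> (simp [Pass.marked, XGate.expand, UGate.map]; try exact ⟨rfl, rfl⟩)

theorem layerGates_map (μ : Fin q → Mark) :
    (layerGates μ).map (UGate.map (circuitEmb (A := A) (n := n))) = markedPass A n .one μ ++
      (((List.finRange q).flatMap fun i => rowCnots μ i (List.finRange q)).flatMap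
        XGate.expand).map (UGate.map circuitParityEmb) := by
  rw [layerGates, List.map_append]
  congr 1
  · simp only [markedPass, List.map_flatMap]
    congr 1
    funext i
    cases μ i <;> simp [Pass.marked, UGate.map] <;> rfl
  · simp only [rowCnots, List.flatMap_assoc, List.map_flatMap]
    congr 1
    funext i
    congr 1
    funext j
    split_ifs <;> (simp [XGate.expand, UGate.map]; try exact ⟨rfl, rfl⟩)

/-- The basis states with `a` on the wires of the learner, and zeros on the work wires except for
the wire of the test. -/
def Ready (a : A → Bool) (x : Reg A n q → Bool) : Prop :=
  (∀ w, x (.inl w) = a w) ∧ ∀ k : Fin 8, k.val < 7 → x (workWire k) = false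

/-- `Clean` leaves the parity wire free because it is in use between the passes, while `Ready`
demands that it be 0 at the start of a layer, as the parity trick requires. The one-qubit gates do
not affect it. -/
theorem act_diagramLayer (c : Fin q → A × A × A) {a : A → Bool}
    {v : (Reg A n q → Bool) → ℂ} (hv : Supp (Ready a) v) :
    act (diagramLayer c) v =
      act ((layerGates fun i => cellMark a (c i)).map (UGate.map circuitEmb)) v := by
  set μ : Fin q → Mark := fun i => cellMark a (c i)
  have hc : Supp (Clean a) v := fun x hx => ⟨(hv x hx).1, fun k hk => (hv x hx).2 k (by omega)⟩
  obtain ⟨e₁, h₁⟩ := act_passGates .one c hc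
  obtain ⟨e₂, h₂⟩ := act_passGates .ctl c h₁
  obtain ⟨e₃, h₃⟩ := act_passGates .tgt c h₂
  obtain ⟨e₄, -⟩ := act_passGates .ctl c h₃
  rw [diagramLayer, act_append, act_append, act_append, e₁, e₂, e₃, e₄, layerGates_map, act_append,
    ← map_ctlCnots, ← map_tgtCnots, ← act_append, ← act_append, ← List.map_append,
    ← List.map_append, ← List.flatMap_append, ← List.flatMap_append]
  rw [act_congr_map circuitParityEmb (gs' := ((List.finRange q).flatMap fun i => rowCnots μ i
    (List.finRange q)).flatMap XGate.expand) (S := fun x => x none = false)]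
  · intro x hx
    exact act_parity μ x hx
  · have : Supp (Ready a) (act (markedPass A n .one μ) v) := by
      refine hv.act fun x y hxy hy => ?_
      have ht : ∀ w : Reg A n q, (∀ i, circuitEmb i ≠ w) → x w = y w := by
        intro w hw
        refine hxy w fun g hg => ?_
        simp only [markedPass, List.mem_flatMap, List.mem_map] at hg
        obtain ⟨i, -, g', hg', rfl⟩ := hg
        have : (g'.map (parityEmb (A := A) (n := n) i)).target = circuitEmb i := by
          revert hg'
          cases μ i <;> simp [Pass.marked] <;> rintro rfl <;> rfl
        rw [this]
        exact (hw _).symm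
      exact ⟨fun w => (ht _ fun i => by simp [circuitEmb_apply]).trans (hy.1 w),
        fun k hk => (ht _ fun i => by simp [circuitEmb_apply]).trans (hy.2 k hk)⟩
    exact fun x hx => (this x hx).2 6 (by decide)

theorem supp_circuit (gs : List (UGate (Fin q))) {a : A → Bool} {v : (Reg A n q → Bool) → ℂ}
    (hv : Supp (Ready a) v) : Supp (Ready a) (act (gs.map (UGate.map circuitEmb)) v) := by
  refine hv.act fun x y hxy hy => ?_
  have ht : ∀ w : Reg A n q, (∀ i, circuitEmb i ≠ w) → x w = y w := by
    intro w hw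
    refine hxy w fun g hg => ?_
    obtain ⟨g', -, rfl⟩ := List.mem_map.1 hg
    have : (g'.map (circuitEmb (A := A) (n := n))).target = circuitEmb g'.target := by
      rcases g' with _ | _ | _ <;> rfl
    rw [this]
    exact (hw _).symm
  exact ⟨fun w => (ht _ fun i => by simp [circuitEmb_apply]).trans (hy.1 w),
    fun k hk => (ht _ fun i => by simp [circuitEmb_apply]).trans (hy.2 k hk)⟩

theorem act_diagramLayers (ls : List (Fin q → A × A × A)) {a : A → Bool}
    {v : (Reg A n q → Bool) → ℂ} (hv : Supp (Ready a) v) :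
    act (ls.flatMap diagramLayer) v =
      act ((ls.flatMap fun c => layerGates fun i => cellMark a (c i)).map
        (UGate.map circuitEmb)) v := by
  induction ls generalizing v with
  | nil => rfl
  | cons c ls ih =>
    rw [List.flatMap_cons, act_append, act_diagramLayer c hv, ih (supp_circuit _ hv),
      List.flatMap_cons, List.map_append, act_append]

end Layers

end

end QLearn

namespace QLearn

noncomputable section

/-! ### Agreement with the described circuit, and the swap test -/

section SwapTest

open Function Matrix

set_option linter.unusedSectionVars false

/-! #### The gates of the described circuit -/

theorem getElem_cellsOf {α : Type} (ws : List α) (p : ℕ) (h : p < (cellsOf ws).length)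
    (h' : 3 * p + 2 < ws.length) :
    (cellsOf ws)[p] = (ws[3 * p], ws[3 * p + 1], ws[3 * p + 2]) := by
  induction ws using cellsOf.induct generalizing p with
  | case1 a b c l ih =>
    rcases p with _ | p
    · simp [cellsOf]
    · simp only [cellsOf, List.getElem_cons_succ]
      rw [ih p (by simpa [cellsOf] using h) (by simp at h'; omega)]
      rfl
  | case2 l h'' =>
    rcases l with _ | ⟨a, _ | ⟨b, _ | ⟨c, l⟩⟩⟩
    · simp at h'
    · simp at h'
    · simp at h'
    · exact (h'' a b c l rfl).elim

theorem getElem_layersOf {α : Type} (q k : ℕ) (l : List α) (j : ℕ)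
    (h : j < (layersOf q k l).length) : (layersOf q k l)[j] = (l.drop (j * q)).take q := by
  induction k generalizing l j with
  | zero => simp [layersOf] at h
  | succ k ih =>
    rcases j with _ | j
    · simp [layersOf]
    · simp only [layersOf, List.getElem_cons_succ]
      rw [ih _ j (by simpa [layersOf] using h), List.drop_drop]
      congr 2
      ring

/-- The layers of the circuit diagram that is written on the wires `ws`. -/
def layerCells {α : Type} (q : ℕ) (ws : List α) : List (Fin q → α × α × α) :=
  List.ofFn fun (l : Fin (diagram q ws).length) i =>
    ((diagram q ws)[l.val])[i.val]'(by
      rw [length_of_mem_diagram _ (List.getElem_mem l.2)]; exact i.2)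

theorem getElem_layerCells {α : Type} (q : ℕ) (ws : List α) (j : ℕ)
    (h : j < (layerCells q ws).length) (h' : j < (diagram q ws).length) (i : Fin q) :
    (layerCells q ws)[j] i = ((diagram q ws)[j])[i.val]'(by
      rw [length_of_mem_diagram _ (List.getElem_mem h')]; exact i.2) :=
  congrFun (List.getElem_ofFn h) i

/-- The diagram is cut out of the list of wires, not of their values, so that the gates of the
distinguisher do not depend on the string `a`; reading the values afterwards gives the same circuit.
-/
theorem describedGates_map {α : Type} (q : ℕ) (ws : List α) (a : α → Bool) :
    describedGates q (ws.map a) =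
      (layerCells q ws).flatMap fun c => layerGates fun i => cellMark a (c i) := by
  have key : (List.range ((ws.map a).length / (3 * q))).map
      (fun l (i : Fin q) => markAt (ws.map a) (l * q + i)) =
      (layerCells q ws).map fun c i => cellMark a (c i) := by
    refine List.ext_getElem ?_ ?_
    · simp [layerCells, diagram, length_layersOf]
    · intro j h₁ h₂
      funext i
      have hj : j < ws.length / (3 * q) := by simpa using h₁
      -- Only complete layers occur, so every position that is read lies within the string and the
      -- default value of `getD` is never used.
      have hq : j * (3 * q) + 3 * q ≤ ws.length := by
        have := Nat.mul_le_of_le_div _ _ _ hj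
        rwa [Nat.succ_mul] at this
      have hi := i.2
      have hp : 3 * (j * q + i) + 2 < ws.length := by
        have : 3 * (j * q + i) + 3 ≤ j * (3 * q) + 3 * q := by
          have : j * (3 * q) = 3 * (j * q) := by ring
          omega
        omega
      have hc : j * q + i < (cellsOf ws).length := by
        rw [length_cellsOf]; omega
      have hd : j < (diagram q ws).length := by
        rw [diagram, length_layersOf]; exact hj
      have e : (diagram q ws)[j] = ((cellsOf ws).drop (j * q)).take q := getElem_layersOf _ _ _ _ _
      have e' : ((diagram q ws)[j])[i.val]'(by
          rw [length_of_mem_diagram _ (List.getElem_mem hd)]; exact hi) =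
          (cellsOf ws)[j * q + i] := by
        rw [List.getElem_of_eq e]
        simp
      simp only [List.getElem_map, List.getElem_range, getElem_layerCells _ _ _ _ hd, e']
      rw [getElem_cellsOf ws _ hc hp, markAt, cellMark]
      congr 1 <;> simp only [List.getD_eq_getElem?_getD] <;>
        rw [List.getElem?_eq_getElem (by simp; omega)] <;> simp
  have h : ∀ (l : List (Fin q → Mark)), l.flatMap layerGates = (l.map layerGates).flatten :=
    fun l => List.flatMap_def
  calc describedGates q (ws.map a) = ((List.range ((ws.map a).length / (3 * q))).map
      (fun l (i : Fin q) => markAt (ws.map a) (l * q + i))).flatMap layerGates := by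
        rw [List.flatMap_map]; rfl
    _ = _ := by rw [key, List.flatMap_map]

/-! #### The swap test -/

variable {A : Type} [Fintype A] [DecidableEq A] {n b : ℕ}

theorem tofGates_map {α β : Type} [Fintype α] [DecidableEq α] [Fintype β] [DecidableEq β]
    (f : α ↪ β) (a b t : α) (h : a ≠ b ∧ a ≠ t ∧ b ≠ t) :
    (tofGates a b t h).map (UGate.map f) = tofGates (f a) (f b) (f t)
      ⟨f.injective.ne h.1, f.injective.ne h.2.1, f.injective.ne h.2.2⟩ := by
  simp only [tofGates, List.map_cons, List.map_append, List.map_map, List.map_nil]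
  congr 3
  funext g
  refine (UGate.map_map _ _ g).trans (congrArg (fun e => g.map e) ?_)
  ext i
  fin_cases i <;> rfl

/-- The controlled swap of wires `1` and `2`. -/
def swapLocal : List (UGate (Fin 3)) :=
  .cnot 2 1 (by decide) :: (tofGates 0 1 2 (by decide) ++ [.cnot 2 1 (by decide)])

abbrev testWire (j : Fin n) : Reg A n (n + b) := .inr (.inl j)

abbrev circuitWire (i : Fin (n + b)) : Reg A n (n + b) := .inr (.inr (.inl i))

def testEmb (j : Fin n) : Fin 3 ↪ Reg A n (n + b) :=
  wires₃ (workWire 7) (testWire j) (circuitWire (Fin.castAdd b j)) (by simp)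

def swapGates : List (UGate (Reg A n (n + b))) :=
  (List.finRange n).flatMap fun j => swapLocal.map (UGate.map (testEmb j))

/-- Exchanges the wires of the test state in `l` with those of the described circuit, if the wire of
the test is on. -/
def exchange (l : List (Fin n)) (x : Reg A n (n + b) → Bool) : Reg A n (n + b) → Bool
  | .inl w => x (.inl w)
  | .inr (.inl j) => if x (workWire 7) ∧ j ∈ l then x (circuitWire (Fin.castAdd b j)) else
      x (testWire j)
  | .inr (.inr (.inl i)) => Fin.addCases
      (fun j => if x (workWire 7) ∧ j ∈ l then x (testWire j) else
        x (circuitWire (Fin.castAdd b j)))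
      (fun k => x (circuitWire (Fin.natAdd n k))) i
  | .inr (.inr (.inr k)) => x (workWire k)

/-- A controlled swap is a Toffoli gate between two CNOTs in the opposite direction. -/
theorem act_swapLocal (j : Fin n) (v : (Reg A n (n + b) → Bool) → ℂ)
    (x : Reg A n (n + b) → Bool) :
    act (swapLocal.map (UGate.map (testEmb j))) v x =
      v (update (update x (testWire j) (if x (workWire 7) then x (circuitWire (Fin.castAdd b j))
        else x (testWire j))) (circuitWire (Fin.castAdd b j)) (if x (workWire 7) then
          x (testWire j) else x (circuitWire (Fin.castAdd b j)))) := by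
  rw [swapLocal, List.map_cons, List.map_append, tofGates_map, act_cons, act_append,
    List.map_cons, List.map_nil, act_cons, act_nil, UGate.map]
  rw [UGate.cnot_mulVec, act_tofGates, UGate.cnot_mulVec]
  congr 1
  have e₀ : (testEmb j : Fin 3 ↪ Reg A n (n + b)) 0 = workWire 7 := rfl
  have e₁ : (testEmb j : Fin 3 ↪ Reg A n (n + b)) 1 = testWire j := rfl
  have e₂ : (testEmb j : Fin 3 ↪ Reg A n (n + b)) 2 = circuitWire (Fin.castAdd b j) := rfl
  simp only [e₀, e₁, e₂]
  have h₁ : (testWire j : Reg A n (n + b)) ≠ circuitWire (Fin.castAdd b j) := by simp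
  have h₂ : (testWire j : Reg A n (n + b)) ≠ workWire 7 := by simp
  funext w
  by_cases hw : w = testWire j
  · subst hw
    simp only [update_apply, h₁, h₁.symm, h₂.symm, if_true, if_false]
    cases x (testWire j) <;> cases x (circuitWire (Fin.castAdd b j)) <;> cases x (workWire 7) <;> rfl
  · by_cases hw' : w = circuitWire (Fin.castAdd b j)
    · subst hw'
      simp only [update_apply, h₁, h₁.symm, h₂.symm, if_true, if_false]
      cases x (testWire j) <;> cases x (circuitWire (Fin.castAdd b j)) <;>
        cases x (workWire 7) <;> rfl
    · simp only [update_apply, hw, hw', if_false]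

theorem act_swapGates (l : List (Fin n)) (hl : l.Nodup) (v : (Reg A n (n + b) → Bool) → ℂ)
    (x : Reg A n (n + b) → Bool) :
    act (l.flatMap fun j => swapLocal.map (UGate.map (testEmb j))) v x = v (exchange l x) := by
  induction l generalizing v with
  | nil =>
    rw [List.flatMap_nil, act_nil]
    congr 1
    funext w
    rcases w with w | w | i | k
    · rfl
    · simp [exchange]
    · refine Fin.addCases (fun j => ?_) (fun k => ?_) i <;> simp [exchange]
    · rfl
  | cons j l ih =>
    rw [List.nodup_cons] at hl
    rw [List.flatMap_cons, act_append, ih hl.2, act_swapLocal]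
    congr 1
    funext w
    rcases w with w | i | i | k
    · simp [exchange]
    · by_cases hi : i = j
      · subst hi
        simp [exchange, hl.1]
      · simp [exchange, hi]
    · refine Fin.addCases (fun i => ?_) (fun k => ?_) i
      · by_cases hi : i = j
        · subst hi
          simp [exchange, hl.1]
        · simp [exchange, hi]
      · have : Fin.natAdd n k ≠ Fin.castAdd b j := by
          intro h
          have := congrArg Fin.val h
          have := j.2
          simp at *
          omega
        simp [exchange, this]
    · simp [exchange]

/-- The gates of the swap test. -/
def testGates : List (UGate (Reg A n (n + b))) :=
  .had (workWire 7) :: (swapGates ++ [.had (workWire 7)])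

/-- Between the two Hadamard gates the test wire is in an equal superposition, and the swap is
applied only where it is 1. The component with test wire 1 at the end is half the antisymmetric
combination. -/
theorem act_testGates {v : (Reg A n (n + b) → Bool) → ℂ}
    (hv : Supp (fun x => x (workWire 7) = false) v) (x : Reg A n (n + b) → Bool)
    (hx : x (workWire 7) = true) :
    act testGates v x = (v (update x (workWire 7) false) -
      v (update (exchange (List.finRange n) x) (workWire 7) false)) / 2 := by
  have h2 := sqrt_two_mul_self
  have h0 : (Real.sqrt 2 : ℂ) ≠ 0 := by
    intro h0; rw [h0] at h2; norm_num at h2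
  have hz : ∀ y, v (update y (workWire 7) true) = 0 := by
    intro y
    by_contra h
    simpa using hv _ h
  have e : exchange (List.finRange n) (update x (workWire 7) false) =
      update x (workWire 7) false := by
    funext w
    rcases w with w | w | i | k
    · rfl
    · simp [exchange]
    · refine Fin.addCases (fun j => ?_) (fun k => ?_) i <;> simp [exchange]
    · rfl
  have e' : update x (workWire 7) true = x := by rw [← hx, update_eq_self]
  rw [testGates, act_cons, act_append, act_cons, act_nil, UGate.had_mulVec, swapGates,
    act_swapGates _ (List.nodup_finRange n), act_swapGates _ (List.nodup_finRange n), e, e', hx,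
    UGate.had_mulVec, UGate.had_mulVec, hz, hz]
  simp only [update_idem, mul_zero, add_zero, if_true]
  field_simp
  rw [pow_two, h2]
  ring

end SwapTest

end

end QLearn

namespace QLearn

noncomputable section

/-! ### The failure probability of the swap test -/

section Probability

open Function Matrix

set_option linter.unusedSectionVars false

/-- Expanding the square of the antisymmetric combination gives two equal norm terms and a cross
term; the latter is the square of the inner product over the compared index, with the index z of the
traced-out wires carried along. -/
theorem sum_norm_swap {T Z : Type} [Fintype T] [Fintype Z] (f : T → Z → ℂ) (ψ : T → ℂ) :
    ∑ t, ∑ u, ∑ z, ‖(f u z * ψ t - f t z * ψ u) / 2‖ ^ 2 =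
      ((∑ t, ‖ψ t‖ ^ 2) * (∑ u, ∑ z, ‖f u z‖ ^ 2) -
        ∑ z, ‖∑ t, star (ψ t) * f t z‖ ^ 2) / 2 := by
  have h₁ : ∀ t u z, ‖(f u z * ψ t - f t z * ψ u) / 2‖ ^ 2 =
      (‖ψ t‖ ^ 2 * ‖f u z‖ ^ 2 + ‖ψ u‖ ^ 2 * ‖f t z‖ ^ 2) / 4 -
        (star (ψ u) * f u z * star (star (ψ t) * f t z)).re / 2 := by
    intro t u z
    rw [norm_div, div_pow, Complex.norm_ofNat, ← Complex.normSq_eq_norm_sq, ← Complex.normSq_eq_norm_sq,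
      ← Complex.normSq_eq_norm_sq, ← Complex.normSq_eq_norm_sq, ← Complex.normSq_eq_norm_sq]
    simp only [Complex.normSq_apply, Complex.mul_re, Complex.mul_im, Complex.sub_re,
      Complex.sub_im, Complex.star_def, Complex.conj_re, Complex.conj_im]
    ring
  have h₂ : ∀ z, ‖∑ t, star (ψ t) * f t z‖ ^ 2 =
      ∑ t, ∑ u, (star (ψ u) * f u z * star (star (ψ t) * f t z)).re := by
    intro z
    have : ((‖∑ t, star (ψ t) * f t z‖ ^ 2 : ℝ) : ℂ) =
        ∑ t, ∑ u, star (ψ u) * f u z * star (star (ψ t) * f t z) := by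
      rw [Complex.ofReal_pow, ← Complex.mul_conj', ← Complex.star_def, star_sum,
        Finset.sum_mul_sum, Finset.sum_comm]
    rw [← Complex.ofReal_re (‖_‖ ^ 2), this]
    simp only [Complex.re_sum]
  simp only [h₁, h₂, Finset.sum_sub_distrib, ← Finset.sum_div, Finset.sum_add_distrib]
  have h₃ : ∑ t, ∑ u, ∑ z, ‖ψ t‖ ^ 2 * ‖f u z‖ ^ 2 =
      (∑ t, ‖ψ t‖ ^ 2) * (∑ u, ∑ z, ‖f u z‖ ^ 2) := by
    simp only [← Finset.mul_sum, ← Finset.sum_mul]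
  have h₄ : ∑ t, ∑ u, ∑ z, ‖ψ u‖ ^ 2 * ‖f t z‖ ^ 2 =
      (∑ t, ‖ψ t‖ ^ 2) * (∑ u, ∑ z, ‖f u z‖ ^ 2) := by
    rw [← h₃, Finset.sum_comm]
  have h₅ : ∑ t, ∑ u, ∑ z, (star (ψ u) * f u z * star (star (ψ t) * f t z)).re =
      ∑ z, ∑ t, ∑ u, (star (ψ u) * f u z * star (star (ψ t) * f t z)).re := by
    rw [Finset.sum_comm (s := Finset.univ (α := Z))]
    exact Finset.sum_congr rfl fun t _ => Finset.sum_comm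
  rw [h₃, h₄, h₅]
  ring

variable {A : Type} [Fintype A] [DecidableEq A] {n b : ℕ}

/-- The basis state with the given values on the parts of the register. -/
abbrev joinBits (a : A → Bool) (t : Fin n → Bool) (s : Fin (n + b) → Bool) (k : Fin 8 → Bool) :
    Reg A n (n + b) → Bool := Sum.elim a (Sum.elim t (Sum.elim s k))

theorem sum_reg (F : (Reg A n (n + b) → Bool) → ℝ) :
    ∑ x, F x = ∑ a, ∑ t, ∑ s, ∑ k, F (joinBits a t s k) := by
  rw [← (Equiv.sumArrowEquivProdArrow A (Fin n ⊕ (Fin (n + b) ⊕ Fin 8)) Bool).symm.sum_comp,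
    Fintype.sum_prod_type]
  refine Finset.sum_congr rfl fun a _ => ?_
  rw [← (Equiv.sumArrowEquivProdArrow (Fin n) (Fin (n + b) ⊕ Fin 8) Bool).symm.sum_comp,
    Fintype.sum_prod_type]
  refine Finset.sum_congr rfl fun t _ => ?_
  rw [← (Equiv.sumArrowEquivProdArrow (Fin (n + b)) (Fin 8) Bool).symm.sum_comp,
    Fintype.sum_prod_type]
  rfl

/-- The gates after those of the learner. -/
def postGates (outs : List A) : List (UGate (Reg A n (n + b))) :=
  (layerCells (n + b) outs).flatMap diagramLayer ++ testGates

/-- The initial vector of the wires not used by the learner. -/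
def testVector (ψ : (Fin n → Bool) → ℂ) (x : Reg A n (n + b) → Bool) : ℂ :=
  if (∀ i, x (circuitWire i) = false) ∧ ∀ k, x (workWire k) = false then
    ψ fun j => x (testWire j) else 0

/-- The overlap of `ψ` with the vector `χ` on more wires. -/
def overlap (ψ : (Fin n → Bool) → ℂ) (χ : (Fin (n + b) → Bool) → ℂ) : ℝ :=
  ∑ z, ‖∑ t, star (ψ t) * χ (Fin.append t z)‖ ^ 2

/-- Once the wires of the learner are fixed to `a`, the universal circuit acts as the circuit
described by this string on |0...0⟩. The vector `w` is the state before the swap test. -/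
theorem act_postGates (outs : List A) (ψ : (Fin n → Bool) → ℂ) (a : A → Bool)
    (x : Reg A n (n + b) → Bool) (hx : x (workWire 7) = true)
    {w : (Reg A n (n + b) → Bool) → ℂ}
    (h : w = fun x => gatesOnZero (describedGates (n + b) (outs.map a)) (x ∘ circuitEmb) *
        (if (fun w => x (.inl w)) = a ∧ ∀ k, x (workWire k) = false then
          ψ fun j => x (testWire j) else 0)) :
    act (postGates outs) (fun x => if (fun w => x (.inl w)) = a then testVector ψ x else 0) x =
      (w (update x (workWire 7) false) -
        w (update (exchange (List.finRange n) x) (workWire 7) false)) / 2 := by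
  have hs : Supp (Ready a)
      (fun x => if (fun w => x (.inl w)) = a then testVector (b := b) ψ x else 0) := by
    intro x hx
    simp only [testVector, ne_eq, ite_eq_right_iff, Classical.not_imp] at hx
    exact ⟨fun w => congrFun hx.1 w, fun k _ => hx.2.1.2 k⟩
  have hw : act ((layerCells (n + b) outs).flatMap diagramLayer)
      (fun x => if (fun w => x (.inl w)) = a then testVector ψ x else 0) = w := by
    rw [h, act_diagramLayers _ hs, ← describedGates_map]
    have : (fun x : Reg A n (n + b) → Bool =>
        if (fun w => x (.inl w)) = a then testVector ψ x else 0) =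
        fun x => (Pi.single (fun _ => false) 1 : (Fin (n + b) → Bool) → ℂ) (x ∘ circuitEmb) *
          (if (fun w => x (.inl w)) = a ∧ ∀ k, x (workWire k) = false then
            ψ fun j => x (testWire j) else 0) := by
      funext x
      have hz : x ∘ circuitEmb = (fun _ => false) ↔ ∀ i, x (circuitWire i) = false :=
        ⟨fun h i => congrFun h i, fun h => funext h⟩
      simp only [testVector, Pi.single_apply, hz]
      split_ifs <;> simp_all
    rw [this, act_map]
    · rfl
    · intro u x
      have h₁ : ∀ w : A, extend circuitEmb u x (.inl w) = x (.inl w) := fun w => by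
        rw [extend_apply']
        rintro ⟨i, hi⟩
        simp [circuitEmb_apply] at hi
      have h₂ : ∀ k, extend circuitEmb u x (workWire k) = x (workWire k) := fun k => by
        rw [extend_apply']
        rintro ⟨i, hi⟩
        simp [circuitEmb_apply] at hi
      have h₃ : ∀ k, extend circuitEmb u x (testWire k) = x (testWire k) := fun k => by
        rw [extend_apply']
        rintro ⟨i, hi⟩
        simp [circuitEmb_apply] at hi
      simp only [h₁, h₂, h₃]
  rw [postGates, act_append, hw, act_testGates _ x hx]
  intro y hy
  rw [h] at hy
  have := right_ne_zero_of_mul hy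
  simp only [ne_eq, ite_eq_right_iff, Classical.not_imp] at this
  exact this.1.2 7

/-- The basis states of the work wires in which only the wire of the test is on. -/
def testOn (k : Fin 8) : Bool := decide (k = 7)

/-- All work wires except that of the test return to 0, so among the patterns with test wire 1 only
`testOn` carries amplitude. Exchanging the compared registers exchanges `t` and `u` and leaves the
traced-out part `z`. -/
theorem act_postGates_join (outs : List A) (ψ : (Fin n → Bool) → ℂ) (a : A → Bool)
    (t : Fin n → Bool) (u : Fin n → Bool) (z : Fin b → Bool) (k : Fin 8 → Bool)
    (hk : k 7 = true) {χ : (Fin (n + b) → Bool) → ℂ}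
    (hχ : χ = gatesOnZero (describedGates (n + b) (outs.map a))) :
    act (postGates outs) (fun x => if (fun w => x (.inl w)) = a then testVector ψ x else 0)
      (joinBits a t (Fin.append u z) k) =
      if k = testOn then (χ (Fin.append u z) * ψ t - χ (Fin.append t z) * ψ u) / 2 else 0 := by
  rw [act_postGates _ _ _ _ (by simpa using hk) rfl, ← hχ]
  have e₁ : update (joinBits a t (Fin.append u z) k) (workWire 7) false =
      joinBits a t (Fin.append u z) (update k 7 false) := by
    funext w
    rcases w with w | w | w | w
    · exact update_of_ne (by simp) _ _
    · exact update_of_ne (by simp) _ _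
    · exact update_of_ne (by simp) _ _
    · rw [update_apply]
      simp only [joinBits, Sum.elim_inr, update_apply, Sum.inr.injEq]
  have e₂ : update (exchange (List.finRange n) (joinBits a t (Fin.append u z) k)) (workWire 7)
      false = joinBits a u (Fin.append t z) (update k 7 false) := by
    funext w
    rcases w with w | w | w | w
    · exact update_of_ne (by simp) _ _
    · refine (update_of_ne (by simp) _ _).trans ?_
      change (if k 7 = true ∧ w ∈ List.finRange n then Fin.append u z (Fin.castAdd b w) else t w) =
        u w
      rw [if_pos ⟨hk, List.mem_finRange w⟩, Fin.append_left]
    · refine (update_of_ne (by simp) _ _).trans ?_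
      change Fin.addCases (fun j => if k 7 = true ∧ j ∈ List.finRange n then t j else
        Fin.append u z (Fin.castAdd b j)) (fun l => Fin.append u z (Fin.natAdd n l)) w =
          Fin.append t z w
      refine Fin.addCases (fun j => ?_) (fun j => ?_) w
      · rw [Fin.addCases_left, if_pos ⟨hk, List.mem_finRange j⟩, Fin.append_left]
      · rw [Fin.addCases_right, Fin.append_right, Fin.append_right]
    · rw [update_apply]
      simp only [exchange, joinBits, Sum.elim_inr, update_apply, Sum.inr.injEq]
  have e₃ : ∀ (t : Fin n → Bool) (s : Fin (n + b) → Bool),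
      joinBits a t s (update k 7 false) ∘ circuitEmb = s := fun t s => rfl
  have e₄ : (∀ l, (update k 7 false) l = false) ↔ k = testOn := by
    constructor
    · intro h
      funext l
      by_cases hl : l = 7
      · subst hl; simpa [testOn] using hk
      · simpa [testOn, hl] using h l
    · rintro rfl l
      by_cases hl : l = 7 <;> simp [testOn, hl]
  simp only [e₁, e₂, e₃]
  simp only [joinBits, Sum.elim_inl, Sum.elim_inr, e₄]
  by_cases h : k = testOn
  · rw [if_pos ⟨trivial, h⟩, if_pos ⟨trivial, h⟩, if_pos h]
  · rw [if_neg fun h' => h h'.2, if_neg fun h' => h h'.2, if_neg h]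
    simp

theorem sum_gatesOnZero {q : ℕ} (gs : List (UGate (Fin q))) :
    ∑ x, ‖gatesOnZero gs x‖ ^ 2 = 1 := by
  have := sum_norm_act gs (Pi.single (fun _ => false) 1)
  refine this.trans ?_
  rw [Finset.sum_eq_single (fun _ => false)]
  · simp
  · intro x _ hx
    simp [hx]
  · simp

theorem sum_postGates (outs : List A) (ψ : (Fin n → Bool) → ℂ) (hψ : ∑ t, ‖ψ t‖ ^ 2 = 1)
    (a : A → Bool) :
    ∑ t, ∑ s, ∑ k, (if k 7 = true then ‖act (postGates outs) (fun x : Reg A n (n + b) → Bool =>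
      if (fun w => x (.inl w)) = a then testVector ψ x else 0) (joinBits a t s k)‖ ^ 2 else 0) =
      (1 - overlap ψ (gatesOnZero (describedGates (n + b) (outs.map a)))) / 2 := by
  set χ := gatesOnZero (describedGates (n + b) (outs.map a)) with hχ
  have e : ∀ F : (Fin (n + b) → Bool) → ℝ, ∑ s, F s = ∑ u, ∑ z, F (Fin.append u z) := by
    intro F
    rw [← (Fin.appendEquiv n b).sum_comp, Fintype.sum_prod_type]
    rfl
  have h := sum_norm_swap (fun u (z : Fin b → Bool) => χ (Fin.append u z)) ψ
  rw [hψ, one_mul, ← e fun s => ‖χ s‖ ^ 2, sum_gatesOnZero] at h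
  rw [overlap, ← h]
  refine Finset.sum_congr rfl fun t _ => ?_
  rw [e]
  refine Finset.sum_congr rfl fun u _ => Finset.sum_congr rfl fun z _ => ?_
  rw [Finset.sum_eq_single testOn]
  · rw [if_pos (by rfl), act_postGates_join _ _ _ _ _ _ _ (by rfl) rfl]
    simp [χ]
  · intro k _ hk
    split_ifs with h7
    · rw [act_postGates_join _ _ _ _ _ _ _ h7 rfl]
      simp [hk]
    · rfl
  · simp

end Probability

end

end QLearn

namespace QLearn

noncomputable section

/-! ### The distinguisher and its acceptance probability -/

section Distinguisher

open Function Matrix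

set_option linter.unusedSectionVars false

variable {A : Type} [Fintype A] [DecidableEq A] {n b : ℕ}

/-- The wires of the learner in the register. -/
def learnerEmb : A ↪ Reg A n (n + b) := ⟨Sum.inl, Sum.inl_injective⟩

/-- The diagonal of the final state: the wires of the learner act as classical controls. -/
theorem diag_matOf (gs : List (UGate (Reg A n (n + b)))) (hgs : ∀ g ∈ gs, ∀ w, g.target ≠ .inl w)
    (σ : Op A) (v : (Reg A n (n + b) → Bool) → ℂ) (x : Reg A n (n + b) → Bool) :
    (matOf gs * tens learnerEmb σ (Matrix.of fun x y => v x * star (v y)) * (matOf gs)ᴴ) x x =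
      σ (x ∘ Sum.inl) (x ∘ Sum.inl) *
        ((‖act gs (fun y => if (fun w => y (.inl w)) = x ∘ Sum.inl then v y else 0) x‖ ^ 2 : ℝ) :
          ℂ) := by
  -- No gate has a wire of the learner as its target, so the matrix is block diagonal in the string
  -- on these wires. A diagonal entry therefore sees only the diagonal entry of `σ` for the same
  -- string.
  have h₀ : ∀ y, matOf gs x y ≠ 0 → (fun w => y (.inl w)) = x ∘ Sum.inl := by
    intro y hy
    funext w
    exact (matOf_ne_zero hy fun g hg => (hgs g hg w).symm).symm
  have h₁ : act gs (fun y => if (fun w => y (.inl w)) = x ∘ Sum.inl then v y else 0) x =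
      ∑ y, matOf gs x y * v y := by
    rw [← matOf_mulVec, mulVec, dotProduct]
    refine Finset.sum_congr rfl fun y _ => ?_
    by_cases hy : matOf gs x y = 0
    · simp [hy]
    · rw [if_pos (h₀ y hy)]
  rw [Complex.ofReal_pow, ← Complex.mul_conj', h₁, ← Complex.star_def, star_sum, mul_apply,
    Finset.sum_mul_sum, Finset.sum_comm, Finset.mul_sum]
  refine Finset.sum_congr rfl fun y _ => ?_
  rw [mul_apply, Finset.sum_mul, Finset.mul_sum]
  refine Finset.sum_congr rfl fun z _ => ?_
  rw [conjTranspose_apply]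
  by_cases hy : matOf gs x y = 0
  · simp [hy]
  by_cases hz : matOf gs x z = 0
  · simp [hz]
  have hy' : y ∘ learnerEmb = x ∘ Sum.inl := h₀ y hy
  have hz' : z ∘ learnerEmb = x ∘ Sum.inl := h₀ z hz
  simp only [tens, of_apply, hy', hz', star_mul']
  ring

theorem target_map {α β : Type} (f : α ↪ β) (g : UGate α) : (g.map f).target = f g.target := by
  rcases g with _ | _ | _ <;> rfl

theorem target_postGates (outs : List A) :
    ∀ g ∈ (postGates outs : List (UGate (Reg A n (n + b)))), ∀ w, g.target ≠ .inl w := by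
  intro g hg w
  have hcell : ∀ k i (c : A × A × A), ∀ g ∈ (cellGates k i c : List (UGate (Reg A n (n + b)))),
      g.target ≠ .inl w := by
    intro k i c g hg
    simp only [cellGates, loadGates, List.mem_append, List.mem_cons, List.mem_map,
      List.not_mem_nil, or_false] at hg
    rcases hg with ((rfl | rfl | rfl) | ⟨g, -, rfl⟩) | (rfl | rfl | rfl)
    case inl.inr =>
      rw [target_map]
      rcases g.target with _ | j <;> exact Sum.inr_ne_inl
    all_goals simp [UGate.target]
  have hpass : ∀ k (c : Fin (n + b) → A × A × A),
      ∀ g ∈ (passGates k c : List (UGate (Reg A n (n + b)))), g.target ≠ .inl w := by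
    intro k c g hg
    simp only [passGates, List.mem_flatMap] at hg
    obtain ⟨i, -, hg⟩ := hg
    exact hcell _ _ _ _ hg
  simp only [postGates, List.mem_append, List.mem_flatMap, diagramLayer, testGates, swapGates,
    List.mem_cons, List.mem_map, List.not_mem_nil, or_false] at hg
  rcases hg with ⟨c, -, hg | hg | hg | hg⟩ | rfl | ⟨j, -, g, -, rfl⟩ | rfl
  · exact hpass _ _ _ hg
  · exact hpass _ _ _ hg
  · exact hpass _ _ _ hg
  · exact hpass _ _ _ hg
  · simp [UGate.target]
  · rw [target_map]
    generalize g.target = i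
    fin_cases i <;> exact Sum.inr_ne_inl
  · simp [UGate.target]

/-- The probability that the swap test fails, if the state of the learner is `σ`. -/
theorem sum_diag_postGates (outs : List A) (σ : Op A) (ψ : (Fin n → Bool) → ℂ)
    (hψ : ∑ t, ‖ψ t‖ ^ 2 = 1) :
    (∑ x : Reg A n (n + b) → Bool, if x (workWire 7) = true then
      ((matOf (postGates outs) * tens learnerEmb σ
        (Matrix.of fun x y => testVector ψ x * star (testVector ψ y)) *
        (matOf (postGates outs))ᴴ : Op (Reg A n (n + b))) x x).re else 0) =
      ∑ a, (σ a a).re * ((1 - overlap ψ (gatesOnZero (describedGates (n + b) (outs.map a)))) / 2) := by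
  rw [sum_reg]
  refine Finset.sum_congr rfl fun a _ => ?_
  rw [← sum_postGates outs ψ hψ a]
  simp only [Finset.mul_sum]
  refine Finset.sum_congr rfl fun t _ => Finset.sum_congr rfl fun s _ =>
    Finset.sum_congr rfl fun k _ => ?_
  rw [diag_matOf _ (target_postGates outs)]
  have h₁ : joinBits a t s k ∘ Sum.inl = a := rfl
  have h₂ : joinBits a t s k (workWire 7) = k 7 := rfl
  rw [h₁, h₂, Complex.re_mul_ofReal]
  split_ifs <;> simp

/-! #### The distinguisher -/

variable {m : ℕ}

/-- The ancillas of the distinguisher. -/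
abbrev distAnc (n b anc : ℕ) : ℕ := 4 * (n + b) + workCount + 2 * anc

/-- The wires of the distinguisher. -/
def distEmb (m n b anc : ℕ) : Reg ((Fin m × Fin n) ⊕ Fin anc) n (n + b) ↪
    (Fin (m + 1) × Fin n) ⊕ Fin (distAnc n b anc) :=
  ⟨fun
    | .inl (.inl (c, j)) => .inl (c.succ, j)
    | .inl (.inr k) => .inr ⟨2 * k + 1, by unfold distAnc workCount; omega⟩
    | .inr (.inl j) => .inl (0, j)
    | .inr (.inr (.inl i)) => .inr ⟨4 * i + 2, by unfold distAnc workCount; omega⟩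
    | .inr (.inr (.inr k)) => .inr ⟨8 * k + 4, by unfold distAnc workCount; omega⟩, by
    rintro ((⟨c, j⟩ | k) | j | i | k) ((⟨c', j'⟩ | k') | j' | i' | k') h <;>
      simp at h <;> first | exact (Fin.succ_ne_zero _ h.1.symm).elim | exact (Fin.succ_ne_zero _ h.1).elim | omega | (simp; omega)⟩

/-- The distinguisher that runs the learner `C`, then the circuit that it describes, and compares
the result with another copy of the state. -/
def distinguisher (C : QCircuit (Fin m × Fin n)) (b : ℕ) : QCircuit (Fin (m + 1) × Fin n) where
  anc := distAnc n b C.anc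
  gates := ((C.gates.map (Gate.map learnerEmb)) ++ (postGates C.outputs).map Gate.unitary).map
    (Gate.map (distEmb m n b C.anc))
  outputs := [distEmb m n b C.anc (workWire 7)]

/-- The state of the wires that are not used. -/
def idleState {α β : Type} [Fintype α] [Fintype β] [DecidableEq β] (f : α ↪ β) : Op β :=
  Matrix.of fun x y => if ∀ w, (∀ u, f u ≠ w) → x w = false ∧ y w = false then 1 else 0

theorem idleState_extend {α β : Type} [Fintype α] [Fintype β] [DecidableEq β] (f : α ↪ β)
    (u : α → Bool) (x y : β → Bool) :
    idleState f (extend f u x) y = idleState f x y ∧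
      idleState f x (extend f u y) = idleState f x y := by
  have : ∀ w, (∀ u, f u ≠ w) → ∀ x : β → Bool, extend f u x w = x w := fun w hw x =>
    extend_apply' _ _ _ (by simpa using hw)
  constructor <;>
  · simp only [idleState, of_apply]
    congr 1
    refine propext (forall_congr' fun w => forall_congr' fun hw => ?_)
    rw [this w hw]

/-- Copy 0 sits on the test wires and copies 1, ..., m are the input of the learner. The embedding
leaves some ancillas unused, because indices are chosen for ease of naming; these form the idle
factor. -/
theorem start_distinguisher (C : QCircuit (Fin m × Fin n)) (b : ℕ) (ψ : Ket (Fin n)) :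
    (distinguisher C b).start (copies (m + 1) (ketBra ψ)) =
      tens (distEmb m n b C.anc) (tens learnerEmb (C.start (copies m (ketBra ψ)))
        (Matrix.of fun x y => testVector ψ x * star (testVector ψ y)))
        (idleState (distEmb m n b C.anc)) := by
  refine Matrix.ext fun (x y : (Fin (m + 1) × Fin n) ⊕ Fin (distAnc n b C.anc) → Bool) => ?_
  change (if ∀ k : Fin (distAnc n b C.anc), x (Sum.inr k) = false ∧ y (Sum.inr k) = false then
      copies (m + 1) (ketBra ψ) (fun i => x (Sum.inl i)) (fun i => y (Sum.inl i)) else 0) =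
    C.start (copies m (ketBra ψ)) ((x ∘ distEmb m n b C.anc) ∘ learnerEmb)
        ((y ∘ distEmb m n b C.anc) ∘ learnerEmb) *
      (testVector (b := b) ψ (x ∘ distEmb m n b C.anc) *
        star (testVector (b := b) ψ (y ∘ distEmb m n b C.anc))) *
      idleState (distEmb m n b C.anc) x y
  by_cases hP : ∀ k, x (Sum.inr k) = false ∧ y (Sum.inr k) = false
  · have hx := fun k => (hP k).1
    have hy := fun k => (hP k).2
    have hidle : idleState (distEmb m n b C.anc) x y = 1 := by
      refine if_pos fun w hw => ?_
      rcases w with ⟨c, j⟩ | k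
      · refine Fin.cases (fun h => ?_) (fun c h => ?_) c hw
        · exact (h (.inr (.inl j)) rfl).elim
        · exact (h (.inl (.inl (c, j))) rfl).elim
      · exact hP k
    have htest : ∀ x : (Fin (m + 1) × Fin n) ⊕ Fin (distAnc n b C.anc) → Bool,
        (∀ k, x (Sum.inr k) = false) →
        testVector (b := b) ψ (x ∘ distEmb m n b C.anc) = ψ fun j => x (.inl (0, j)) :=
      fun x hx => if_pos ⟨fun i => hx _, fun k => hx _⟩
    have hlearn : C.start (copies m (ketBra ψ)) ((x ∘ distEmb m n b C.anc) ∘ learnerEmb)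
        ((y ∘ distEmb m n b C.anc) ∘ learnerEmb) =
        ∏ c : Fin m, ψ (fun j => x (.inl (c.succ, j))) * star (ψ fun j => y (.inl (c.succ, j))) :=
      if_pos fun k => ⟨hx _, hy _⟩
    rw [if_pos hP, hidle, htest x hx, htest y hy, hlearn, mul_one, mul_comm]
    simp only [copies, ketBra, of_apply]
    rw [Fin.prod_univ_succ]
  · rw [if_neg hP]
    push Not at hP
    obtain ⟨k, hk⟩ := hP
    symm
    by_cases hr : ∃ u, distEmb m n b C.anc u = .inr k
    · obtain ⟨u, hu⟩ := hr
      have hk' : ¬((x ∘ distEmb m n b C.anc) u = false ∧ (y ∘ distEmb m n b C.anc) u = false) := by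
        rw [Function.comp_apply, Function.comp_apply, hu]
        exact fun h => hk h.1 h.2
      generalize x ∘ distEmb m n b C.anc = x' at *
      generalize y ∘ distEmb m n b C.anc = y' at *
      rcases u with (⟨c, j⟩ | l) | j | i | l
      · cases hu
      · have : C.start (copies m (ketBra ψ)) (x' ∘ learnerEmb) (y' ∘ learnerEmb) = 0 :=
          if_neg fun h => hk' (h l)
        rw [this, zero_mul, zero_mul]
      · cases hu
      all_goals
        rcases not_and_or.1 hk' with h | h
        · have : testVector (b := b) ψ x' = 0 := if_neg fun h' => by
            first | exact h (h'.1 _) | exact h (h'.2 _)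
          rw [this, zero_mul, mul_zero, zero_mul]
        · have : testVector (b := b) ψ y' = 0 := if_neg fun h' => by
            first | exact h (h'.1 _) | exact h (h'.2 _)
          rw [this, star_zero, mul_zero, mul_zero, zero_mul]
    · have : idleState (distEmb m n b C.anc) x y = 0 :=
        if_neg fun h => by
          obtain ⟨h₁, h₂⟩ := h (.inr k) fun u hu => hr ⟨u, hu⟩
          exact hk h₁ h₂
      rw [this, mul_zero]

theorem tens_apply {α β : Type} (f : α ↪ β) (σ : Op α) (τ : Op β) (x y : β → Bool) :
    tens f σ τ x y = σ (x ∘ f) (y ∘ f) * τ x y := rfl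

theorem testVector_extend (ψ : (Fin n → Bool) → ℂ) (w : A → Bool) (x : Reg A n (n + b) → Bool) :
    testVector ψ (extend learnerEmb w x) = testVector ψ x := by
  have : ∀ v, extend learnerEmb w x (.inr v) = x (.inr v) := fun v =>
    extend_apply' _ _ _ fun ⟨a, ha⟩ => Sum.inl_ne_inr ha
  simp only [testVector, this]

/-- The gates act only on the image of the embedding, so the idle factor stays in place. There the
learner runs first, next to an untouched test vector, and the remaining gates are unitary; the sum
over final basis states is then `sum_diag_postGates`. -/
theorem probOf_distinguisher (C : QCircuit (Fin m × Fin n)) (b : ℕ) (ψ : Ket (Fin n))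
    (hψ : ‖ψ‖ = 1) :
    (distinguisher C b).probOf (copies (m + 1) (ketBra ψ)) (fun s => s = [true]) =
      ∑ a, (C.run (copies m (ketBra ψ)) a a).re *
        ((1 - overlap ψ (gatesOnZero (describedGates (n + b) (C.outputs.map a)))) / 2) := by
  have hψ' : ∑ t, ‖ψ t‖ ^ 2 = 1 := by
    rw [← EuclideanSpace.norm_sq_eq, hψ, one_pow]
  rw [← sum_diag_postGates C.outputs _ ψ hψ']
  have hrun : (distinguisher C b).run (copies (m + 1) (ketBra ψ)) =
      tens (distEmb m n b C.anc) (matOf (postGates C.outputs) *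
        tens learnerEmb (C.run (copies m (ketBra ψ)))
          (Matrix.of fun x y => testVector ψ x * star (testVector ψ y)) *
        (matOf (postGates C.outputs))ᴴ) (idleState (distEmb m n b C.anc)) := by
    rw [QCircuit.run, start_distinguisher]
    have := foldl_apply_map (distEmb m n b C.anc) ((C.gates.map (Gate.map learnerEmb)) ++
      (postGates C.outputs).map Gate.unitary) (tens learnerEmb (C.start (copies m (ketBra ψ)))
        (Matrix.of fun x y => testVector ψ x * star (testVector ψ y)))
        (idleState (distEmb m n b C.anc)) (fun w x y => (idleState_extend _ w x y).1)
        (fun w x y => (idleState_extend _ w x y).2)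
    refine this.trans ?_
    rw [List.foldl_append, foldl_apply_unitary, foldl_apply_map]
    · rfl
    · exact fun w x y => by simp only [of_apply, testVector_extend]
    · exact fun w x y => by simp only [of_apply, testVector_extend]
  rw [QCircuit.probOf, hrun]
  symm
  -- Basis states with a 1 on an idle wire have probability 0, so the sum reduces to the zero
  -- extensions of states of the register.
  refine Fintype.sum_of_injective (fun u => extend (distEmb m n b C.anc) u fun _ => false)
    (fun u u' h => ?_) _ _ (fun x hx => ?_) fun u => ?_
  · have := congrArg (fun x => x ∘ distEmb m n b C.anc) h
    simpa only [extend_comp_self] using this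
  · have : idleState (distEmb m n b C.anc) x x = 0 := by
      refine if_neg fun h => hx ⟨x ∘ distEmb m n b C.anc, ?_⟩
      change extend _ _ _ = x
      conv_rhs => rw [← extend_self (distEmb m n b C.anc) x]
      funext w
      by_cases hw : ∃ u, distEmb m n b C.anc u = w
      · obtain ⟨u, rfl⟩ := hw
        rw [(distEmb m n b C.anc).injective.extend_apply,
          (distEmb m n b C.anc).injective.extend_apply]
      · rw [extend_apply' _ _ _ hw, extend_apply' _ _ _ hw]
        exact (h w fun u hu => hw ⟨u, hu⟩).1.symm
    simp only [tens, of_apply]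
    rw [this, mul_zero, Complex.zero_re, ite_self]
  · have h₁ : idleState (distEmb m n b C.anc) (extend (distEmb m n b C.anc) u fun _ => false)
        (extend (distEmb m n b C.anc) u fun _ => false) = 1 := by
      rw [(idleState_extend _ _ _ _).1, (idleState_extend _ _ _ _).2]
      exact if_pos fun _ _ => ⟨rfl, rfl⟩
    have h₂ : (distinguisher C b).outputs.map (extend (distEmb m n b C.anc) u fun _ => false) =
        [u (workWire 7)] := by
      change [extend (distEmb m n b C.anc) u (fun _ => false) (distEmb m n b C.anc _)] = _
      rw [(distEmb m n b C.anc).injective.extend_apply]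
    have h₃ : tens (distEmb m n b C.anc) (matOf (postGates C.outputs) *
        tens learnerEmb (C.run (copies m (ketBra ψ)))
          (Matrix.of fun x y => testVector ψ x * star (testVector ψ y)) *
        (matOf (postGates C.outputs))ᴴ) (idleState (distEmb m n b C.anc))
        (extend (distEmb m n b C.anc) u fun _ => false)
        (extend (distEmb m n b C.anc) u fun _ => false) =
        (matOf (postGates C.outputs) * tens learnerEmb (C.run (copies m (ketBra ψ)))
          (Matrix.of fun x y => testVector ψ x * star (testVector ψ y)) *
          (matOf (postGates C.outputs))ᴴ : Op _) u u := by
      rw [tens_apply, h₁, mul_one, extend_comp_self]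
    have h₄ : (distinguisher C b).outputs.map (extend (distEmb m n b C.anc) u fun _ => false) =
        [true] ↔ u (workWire 7) = true := by
      refine (congrArg (fun l => l = [true]) h₂).to_iff.trans ?_
      simp
    by_cases hu : u (workWire 7) = true
    · exact (if_pos hu).trans (((if_pos (h₄.2 hu)).trans (congrArg Complex.re h₃)).symm)
    · exact (if_neg hu).trans (if_neg fun h => hu (h₄.1 h)).symm

end Distinguisher

end

end QLearn

namespace QLearn

noncomputable section

/-! ### The written description of the distinguisher -/

section Description

open Function

set_option linter.unusedSectionVars false

variable {A α β : Type} {m n b q : ℕ}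

/-- The description of a unitary gate on wires named by `name`. -/
abbrev ugateDesc (name : α → List Sym) (g : UGate α) : List Sym := gateDesc name (.unitary g)

theorem gateDesc_map (name : β → List Sym) (f : α ↪ β) (g : Gate α) :
    gateDesc name (g.map f) = gateDesc (fun w => name (f w)) g := by
  rcases g with (_ | _ | _) | _ | _ <;> rfl

theorem ugateDesc_map (name : β → List Sym) (f : α ↪ β) (g : UGate α) :
    ugateDesc name (g.map f) = ugateDesc (fun w => name (f w)) g :=
  gateDesc_map name f (.unitary g)

/-- The template of a gate on wires with the given templates for names. -/
def tokDesc (name : α → List Tok) : UGate α → List Tok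
  | .had w => .lit .had :: name w
  | .tee w => .lit .tee :: name w
  | .cnot c t _ => .lit .cnot :: (name c ++ name t)

theorem flatMap_render_lit (l w : List Sym) : (w.map Tok.lit).flatMap (Tok.render l) = w := by
  induction w with
  | nil => rfl
  | cons a w ih => rw [List.map_cons, List.flatMap_cons, ih]; rfl

theorem flatMap_tokDesc (name : α → List Tok) (l : List Sym) (g : UGate α) :
    (tokDesc name g).flatMap (Tok.render l) =
      ugateDesc (fun w => (name w).flatMap (Tok.render l)) g := by
  rcases g with _ | _ | _ <;> simp [tokDesc, gateDesc, Tok.render]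

theorem flatMap_ugateDesc_map (name : β → List Sym) (f : α ↪ β) (tok : α → List Tok) (l : List Sym)
    (h : ∀ w, name (f w) = (tok w).flatMap (Tok.render l)) (gs : List (UGate α)) :
    (gs.map (UGate.map f)).flatMap (ugateDesc name) =
      (gs.flatMap (tokDesc tok)).flatMap (Tok.render l) := by
  rw [List.flatMap_map, List.flatMap_assoc]
  congr 1
  funext g
  rw [ugateDesc_map, flatMap_tokDesc]
  simp only [h]

/-- The template of the names of the wires of a cell. -/
def cellTok : CellWire → List Tok
  | none => [.lit .anc, .lit (.bit false), .lit (.bit true), .idx, .lit .sep]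
  | some k => (workName k).map Tok.lit

/-- The template of the names of the wires of the test. -/
def testTok : Fin 3 → List Tok :=
  ![(workName 7).map Tok.lit, [.lit .inp, .lit .sep, .idx, .lit .sep],
    [.lit .anc, .lit (.bit false), .lit (.bit true), .idx, .lit .sep]]

def cellTemplate (k : Pass) : List Tok := k.gates.flatMap (tokDesc cellTok)

/-- The templates of the distinguisher. -/
def distScript : Script where
  cells := ⟨cellTemplate .one, cellTemplate .ctl, cellTemplate .tgt⟩
  hd := .had :: workName 7
  test := swapLocal.flatMap (tokDesc testTok)
  tl := .had :: workName 7 ++ .out :: workName 7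

/-- With the lowest digit first, 4i + 2 is 0, 1 followed by the digits of i, so a template needs
just a hole for the counter. Since i may be 0, it matters that the digit 1 comes before the hole. -/
theorem symNat_four_mul_add_two (i : ℕ) :
    symNat (4 * i + 2) = .bit false :: .bit true :: (symBits i ++ [.sep]) := by
  have : 4 * i + 2 = Nat.bit false (Nat.bit true i) := by simp [Nat.bit]; ring
  rw [symNat, this, Nat.bits_append_bit _ _ (by simp [Nat.bit]), Nat.bits_append_bit _ _ (by simp)]
  rfl

/-- The names of the wires of the distinguisher. -/
def regName (C : QCircuit (Fin m × Fin n)) (b : ℕ)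
    (w : Reg ((Fin m × Fin n) ⊕ Fin C.anc) n (n + b)) : List Sym :=
  symWire (distEmb m n b C.anc w)

variable (C : QCircuit (Fin m × Fin n))

theorem regName_work (k : Fin 8) : regName C b (workWire k) = workName k := rfl

theorem regName_learner (w : (Fin m × Fin n) ⊕ Fin C.anc) : regName C b (.inl w) = newName w := by
  rcases w with ⟨c, j⟩ | k <;> rfl

theorem regName_cell (i : Fin (n + b)) (w : CellWire) :
    regName C b (cellEmb i w) = (cellTok w).flatMap (Tok.render (symBits i)) := by
  rcases w with _ | k
  · exact congrArg (Sym.anc :: ·) (symNat_four_mul_add_two i)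
  · rw [cellTok, flatMap_render_lit]; rfl

theorem regName_test (j : Fin n) (w : Fin 3) :
    regName C b (testEmb j w) = (testTok w).flatMap (Tok.render (symBits j)) := by
  fin_cases w
  · exact (flatMap_render_lit _ _).symm
  · rfl
  · exact congrArg (Sym.anc :: ·) (symNat_four_mul_add_two _)

/-- The names of the wires of a cell. -/
def cellName {a : ℕ} (c : ((Fin m × Fin n) ⊕ Fin a) × ((Fin m × Fin n) ⊕ Fin a) ×
    ((Fin m × Fin n) ⊕ Fin a)) : CellName := (newName c.1, newName c.2.1, newName c.2.2)

theorem flatMap_loadGates (c : ((Fin m × Fin n) ⊕ Fin C.anc) × ((Fin m × Fin n) ⊕ Fin C.anc) ×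
    ((Fin m × Fin n) ⊕ Fin C.anc)) :
    (loadGates c).flatMap (ugateDesc (regName C b)) = loadOut (cellName c) := by
  simp [loadGates, loadOut, cellName, gateDesc, regName_learner, regName_work]

theorem flatMap_cellGates (k : Pass) (i : Fin (n + b)) (c : ((Fin m × Fin n) ⊕ Fin C.anc) ×
    ((Fin m × Fin n) ⊕ Fin C.anc) × ((Fin m × Fin n) ⊕ Fin C.anc)) :
    (cellGates k i c).flatMap (ugateDesc (regName C b)) =
      cellOut (cellTemplate k) i (cellName c) := by
  rw [cellGates, List.flatMap_append, List.flatMap_append, flatMap_loadGates,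
    flatMap_ugateDesc_map _ _ cellTok _ (regName_cell C i)]
  rfl

theorem passOut_ofFn (T : List Tok) (s : ℕ) (c : Fin q → CellName) :
    passOut T s (List.ofFn c) = (List.finRange q).flatMap fun i : Fin q => cellOut T (s + i) (c i) := by
  induction q generalizing s with
  | zero => simp [passOut]
  | succ q ih =>
    rw [List.ofFn_succ, passOut, ih, List.finRange_succ, List.flatMap_cons, List.flatMap_map]
    simp [Nat.add_assoc, Nat.add_comm 1]

theorem flatMap_passGates (k : Pass) (c : Fin (n + b) → ((Fin m × Fin n) ⊕ Fin C.anc) ×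
    ((Fin m × Fin n) ⊕ Fin C.anc) × ((Fin m × Fin n) ⊕ Fin C.anc)) :
    (passGates k c).flatMap (ugateDesc (regName C b)) =
      passOut (cellTemplate k) 0 (List.ofFn fun i => cellName (c i)) := by
  rw [passOut_ofFn, passGates, List.flatMap_assoc]
  simp only [flatMap_cellGates, Nat.zero_add]

theorem flatMap_diagramLayer (c : Fin (n + b) → ((Fin m × Fin n) ⊕ Fin C.anc) ×
    ((Fin m × Fin n) ⊕ Fin C.anc) × ((Fin m × Fin n) ⊕ Fin C.anc)) :
    (diagramLayer c).flatMap (ugateDesc (regName C b)) =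
      layerOut distScript.cells (List.ofFn fun i => cellName (c i)) := by
  simp only [diagramLayer, List.flatMap_append, flatMap_passGates, layerOut, distScript,
    List.append_assoc]

theorem map_ofFn_layerCells {α : Type} (q : ℕ) (ws : List α) :
    (layerCells q ws).map List.ofFn = diagram q ws := by
  refine List.ext_getElem (by simp [layerCells]) fun j h h' => ?_
  refine List.ext_getElem ?_ fun i hi hi' => ?_
  · rw [List.getElem_map, List.length_ofFn, length_of_mem_diagram _ (List.getElem_mem h')]
  · simp [layerCells]

theorem flatMap_testGates :
    (testGates.flatMap (ugateDesc (regName C b)) : List Sym) ++ .out :: workName 7 =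
      testOut distScript.hd distScript.test distScript.tl n := by
  have h : (swapGates.flatMap (ugateDesc (regName C b)) : List Sym) =
      (List.range n).flatMap fun i => distScript.test.flatMap (Tok.render (symBits i)) := by
    rw [swapGates, List.flatMap_assoc, ← List.map_coe_finRange_eq_range, List.flatMap_map]
    congr 1
    funext j
    exact flatMap_ugateDesc_map _ _ testTok _ (regName_test C j) _
  rw [testGates, List.flatMap_cons, List.flatMap_append, h, testOut]
  simp [gateDesc, regName_work, distScript]

/-- The gates of the distinguisher were built from lists of the same shape as the templates, so the
two texts agree block by block: learner, layers, swap test, output wire. -/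
theorem desc_distinguisher (b : ℕ) : (distinguisher C b).desc = distOut distScript C b := by
  have h₁ : ((distinguisher C b).gates.flatMap symGate : List Sym) =
      C.gates.flatMap (gateDesc newName) ++
        (postGates C.outputs).flatMap (ugateDesc (regName C b)) := by
    have : ∀ g, symGate (Gate.map (distEmb m n b C.anc) g) = gateDesc (regName C b) g := fun g => by
      rw [symGate_eq, gateDesc_map]; rfl
    change (((C.gates.map (Gate.map learnerEmb)) ++ (postGates C.outputs).map Gate.unitary).map
      (Gate.map (distEmb m n b C.anc))).flatMap symGate = _
    rw [List.flatMap_map, List.flatMap_append, List.flatMap_map, List.flatMap_map]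
    simp only [this, gateDesc_map]
    congr 2
    funext g
    congr 1
    funext w
    exact regName_learner C w
  have h₂ : (diagram (n + b) (C.outputs.map newName)).flatMap (layerOut distScript.cells) =
      ((layerCells (n + b) C.outputs).flatMap diagramLayer).flatMap (ugateDesc (regName C b)) := by
    rw [List.flatMap_assoc, diagram_map, ← map_ofFn_layerCells, List.map_map, List.flatMap_map]
    congr 1
    funext c
    rw [flatMap_diagramLayer, Function.comp_apply, List.map_ofFn]
    rfl
  have h₃ : ((distinguisher C b).outputs.flatMap fun w => Sym.out :: symWire w) =
      .out :: workName 7 := List.append_nil _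
  rw [QCircuit.desc, h₁, h₃, distOut, h₂, ← flatMap_testGates C, postGates, List.flatMap_append]
  simp only [List.append_assoc]
  rfl

theorem size_le_length_desc : C.size ≤ C.desc.length := by
  have h : ∀ gs : List (Gate ((Fin m × Fin n) ⊕ Fin C.anc)),
      gs.length ≤ (gs.flatMap symGate).length := by
    intro gs
    induction gs with
    | nil => simp
    | cons g gs ih =>
      rw [List.flatMap_cons, List.length_append, List.length_cons]
      have : 1 ≤ (symGate g).length := by
        rcases g with (_ | _ | _) | _ | _ <;> simp [symGate]
      omega
  have := h C.gates
  simp only [QCircuit.size, QCircuit.desc, List.length_append, List.length_replicate]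
  omega

theorem tendsto_of_isBigO {t : ℕ → ℝ} (ht_pos : ∀ n, 0 < t n)
    (ht : (fun n : ℕ => (n : ℝ)) =O[atTop] t) : Tendsto t atTop atTop := by
  have h : Tendsto (fun n : ℕ => ‖(n : ℝ)‖) atTop atTop :=
    tendsto_norm_atTop_atTop.comp tendsto_natCast_atTop_atTop
  refine (ht.trans_tendsto_norm_atTop h).congr fun n => ?_
  rw [Real.norm_of_nonneg (ht_pos n).le]

/-- Every ancilla and every gate contributes at least one symbol, so the size is bounded by the
length of the description, hence by the time for writing it; the exponent 1 suffices. -/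
theorem timeUniform_distinguisher {m : ℕ → ℕ} {t : ℕ → ℝ} {C : ∀ n, QCircuit (Fin (m n) × Fin n)}
    {a : ℕ → ℕ} (ht_pos : ∀ n, 0 < t n) (ht : (fun n : ℕ => (n : ℝ)) =O[atTop] t)
    (hC : TimeUniform t C) (ha : WritableInTime t fun n => Computability.unaryEncodeNat (a n)) :
    TimeUniform (m := fun n => m n + 1) (fun n => t n * Real.logb 2 (t n))
      fun n => distinguisher (C n) (a n) := by
  have hw : WritableInTime (fun n => t n * Real.logb 2 (t n))
      fun n => (distinguisher (C n) (a n)).desc := by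
    simp only [desc_distinguisher]
    exact hC.2.distOut distScript ht_pos ht ha
  have htop := tendsto_of_isBigO ht_pos ht
  have hlog : ∀ᶠ n in atTop, 1 ≤ Real.logb 2 (t n) := by
    filter_upwards [htop.eventually_ge_atTop 2] with n hn
    rw [Real.le_logb_iff_rpow_le one_lt_two (ht_pos n), Real.rpow_one]
    exact hn
  have hle : t =O[atTop] fun n => t n * Real.logb 2 (t n) := by
    refine IsBigO.of_bound 1 ?_
    filter_upwards [hlog] with n hn
    rw [one_mul, norm_mul]
    exact le_mul_of_one_le_right (norm_nonneg _) (hn.trans (le_abs_self _))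
  refine ⟨⟨1, ?_⟩, hw⟩
  refine IsBigO.trans ?_ ((hw.length_isBigO (ht.trans hle)).trans ?_)
  · refine IsBigO.of_bound 1 (.of_forall fun n => ?_)
    rw [one_mul, Real.norm_of_nonneg (by positivity), Real.norm_of_nonneg (by positivity)]
    exact_mod_cast size_le_length_desc _
  · refine IsBigO.of_bound 1 ?_
    filter_upwards [hlog] with n hn
    have h : 0 ≤ t n * Real.logb 2 (t n) := mul_nonneg (ht_pos n).le (zero_le_one.trans hn)
    rw [one_mul, pow_one, Real.norm_of_nonneg h, Real.norm_of_nonneg (by positivity)]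
    exact le_add_of_nonneg_left (Nat.cast_nonneg n)

end Description

end

end QLearn

namespace QLearn

noncomputable section

/-! ### Operator-sum form of a run -/

section Kraus

open Function Matrix

set_option linter.unusedSectionVars false

variable {V W : Type} [Fintype V] [DecidableEq V] [Fintype W] [DecidableEq W]

/-- `Φ` has an operator-sum representation and preserves traces. -/
def IsChannel (Φ : Op V → Op W) : Prop :=
  (∃ (κ : Type) (_ : Fintype κ) (K : κ → Matrix (W → Bool) (V → Bool) ℂ),
    ∀ ρ, Φ ρ = ∑ k, K k * ρ * (K k)ᴴ) ∧ ∀ ρ, (Φ ρ).trace = ρ.trace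

theorem IsChannel.comp {U : Type} [Fintype U] [DecidableEq U] {Φ : Op V → Op W} {Θ : Op U → Op V}
    (hΦ : IsChannel Φ) (hΘ : IsChannel Θ) : IsChannel fun ρ => Φ (Θ ρ) := by
  obtain ⟨⟨κ, _, K, hK⟩, hΦt⟩ := hΦ
  obtain ⟨⟨κ', _, K', hK'⟩, hΘt⟩ := hΘ
  refine ⟨⟨κ × κ', inferInstance, fun k => K k.1 * K' k.2, fun ρ => ?_⟩, fun ρ => ?_⟩
  · change Φ (Θ ρ) = _
    rw [hK, hK', Fintype.sum_prod_type]
    refine Finset.sum_congr rfl fun k _ => ?_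
    rw [Matrix.mul_sum, Matrix.sum_mul]
    refine Finset.sum_congr rfl fun k' _ => ?_
    simp only [conjTranspose_mul, Matrix.mul_assoc]
  · rw [hΦt, hΘt]

theorem IsChannel.id : IsChannel fun ρ : Op W => ρ :=
  ⟨⟨Unit, inferInstance, fun _ => 1, fun ρ => by simp⟩, fun _ => rfl⟩

/-- An operator that picks an entry of a vector, or nothing. -/
def pickOp (p : (W → Bool) → Prop) [DecidablePred p] (f : (W → Bool) → V → Bool) :
    Matrix (W → Bool) (V → Bool) ℂ :=
  Matrix.of fun x y => if p x ∧ y = f x then 1 else 0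

theorem pickOp_mul_mul (p : (W → Bool) → Prop) [DecidablePred p] (f : (W → Bool) → V → Bool)
    (ρ : Op V) (x y : W → Bool) :
    (pickOp p f * ρ * (pickOp p f)ᴴ) x y = if p x ∧ p y then ρ (f x) (f y) else 0 := by
  rw [mul_apply, Finset.sum_eq_single (f y), mul_apply, Finset.sum_eq_single (f x)]
  · by_cases hx : p x <;> by_cases hy : p y <;> simp [pickOp, hx, hy]
  · intro z _ hz
    simp [pickOp, hz]
  · simp
  · intro z _ hz
    simp [pickOp, hz]
  · simp

/-- A measurement is the sum over the two projections of the wire; a reset is the sum over b of the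
operators sending the value b of the wire to 0. -/
theorem isChannel_apply (g : Gate W) : IsChannel g.apply := by
  rcases g with g | w | w
  · refine ⟨⟨Unit, inferInstance, fun _ => g.mat, fun ρ => by simp [Gate.apply]⟩, fun ρ => ?_⟩
    rw [Gate.apply, Matrix.trace_mul_cycle, UGate.conjTranspose_mul, Matrix.one_mul]
  · refine ⟨⟨Bool, inferInstance, fun b => pickOp (fun x => x w = b) fun x => x, fun ρ => ?_⟩,
      fun ρ => ?_⟩
    · ext x y
      rw [Matrix.sum_apply]
      simp only [pickOp_mul_mul, Fintype.sum_bool, Gate.apply, of_apply]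
      cases x w <;> cases y w <;> simp
    · simp [Matrix.trace, Gate.apply]
  · refine ⟨⟨Bool, inferInstance, fun b => pickOp (fun x => x w = false) fun x => update x w b,
      fun ρ => ?_⟩, fun ρ => ?_⟩
    · ext x y
      rw [Matrix.sum_apply]
      simp only [pickOp_mul_mul, Fintype.sum_bool, Gate.apply, of_apply]
      split_ifs <;> simp
    · simp only [Matrix.trace, Matrix.diag_apply, Gate.apply, of_apply, and_self, Fintype.sum_bool]
      rw [← Equiv.sum_comp (Equiv.funSplitAt w Bool).symm, ← Equiv.sum_comp
        (Equiv.funSplitAt w Bool).symm (fun x => ρ x x), Fintype.sum_prod_type,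
        Fintype.sum_prod_type, Fintype.sum_bool, Fintype.sum_bool]
      have h : ∀ b c (x : {v // v ≠ w} → Bool), update ((Equiv.funSplitAt w Bool).symm (b, x)) w c =
          (Equiv.funSplitAt w Bool).symm (c, x) := by
        intro b c x
        funext v
        by_cases hv : v = w
        · subst hv; simp [Equiv.funSplitAt, Equiv.piSplitAt]
        · simp [Equiv.funSplitAt, Equiv.piSplitAt, hv]
      have h' : ∀ b (x : {v // v ≠ w} → Bool), (Equiv.funSplitAt w Bool).symm (b, x) w = b := by
        intro b x
        simp [Equiv.funSplitAt, Equiv.piSplitAt]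
      simp only [h, h', Bool.true_eq_false, if_false, if_true, Finset.sum_const_zero, zero_add,
        Finset.sum_add_distrib]

theorem isChannel_foldl (gs : List (Gate W)) :
    IsChannel fun ρ : Op W => gs.foldl (fun σ g => g.apply σ) ρ := by
  induction gs with
  | nil => exact IsChannel.id
  | cons g gs ih => exact ih.comp (isChannel_apply g)

variable {m n : ℕ}

theorem isChannel_start (C : QCircuit V) : IsChannel C.start := by
  refine ⟨⟨Unit, inferInstance, fun _ => pickOp (fun x => ∀ k, x (.inr k) = false) fun x i =>
    x (.inl i), fun ρ => ?_⟩, fun ρ => ?_⟩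
  · ext x y
    rw [Matrix.sum_apply]
    simp only [pickOp_mul_mul, Finset.univ_unique, Finset.sum_singleton, QCircuit.start, of_apply,
      forall_and]
  · simp only [Matrix.trace, Matrix.diag_apply, QCircuit.start, of_apply, and_self]
    symm
    refine Fintype.sum_of_injective (fun u => Sum.elim u fun _ => false) (fun u u' h => ?_) _ _
      (fun x hx => ?_) fun u => ?_
    · funext i
      exact congrFun h (.inl i)
    · refine if_neg fun h => hx ⟨fun i => x (.inl i), ?_⟩
      funext w
      rcases w with i | k
      · rfl
      · exact (h k).symm
    · simp

theorem isChannel_run (C : QCircuit V) : IsChannel C.run :=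
  (isChannel_foldl C.gates).comp (isChannel_start C)

/-- The amplitudes of a product of copies of a state. -/
def powVec (m : ℕ) (ψ : (Fin n → Bool) → ℂ) (x : Fin m → Fin n → Bool) : ℂ := ∏ c, ψ (x c)

/-- The input is the rank-one operator of ψ^{⊗m}, so each Kraus term contributes the squared modulus
of a linear form in ψ^{⊗m}. The operators do not depend on ψ, which permits averaging over phases.
-/
theorem exists_diag_run (C : QCircuit (Fin m × Fin n)) :
    ∃ (κ : Type) (_ : Fintype κ) (K : κ → ((Fin m × Fin n) ⊕ Fin C.anc → Bool) →
      (Fin m → Fin n → Bool) → ℂ), ∀ (ψ : Ket (Fin n)) a,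
      (C.run (copies m (ketBra ψ)) a a).re = ∑ k, ‖∑ x, K k a x * powVec m ψ x‖ ^ 2 := by
  obtain ⟨⟨κ, _, K, hK⟩, -⟩ := isChannel_run C
  refine ⟨κ, inferInstance, fun k a x => K k a (uncurry x), fun ψ a => ?_⟩
  rw [hK, Matrix.sum_apply, Complex.re_sum]
  refine Finset.sum_congr rfl fun k _ => ?_
  have hc : ∀ x y, copies m (ketBra ψ) x y = powVec m ψ (curry x) * star (powVec m ψ (curry y)) := by
    intro x y
    simp only [copies, ketBra, of_apply, powVec, star_prod, ← Finset.prod_mul_distrib]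
    rfl
  have h : (K k * copies m (ketBra ψ) * (K k)ᴴ) a a =
      (∑ x, K k a x * powVec m ψ (curry x)) * star (∑ x, K k a x * powVec m ψ (curry x)) := by
    rw [star_sum, Finset.sum_mul_sum, Finset.sum_comm, mul_apply]
    refine Finset.sum_congr rfl fun y _ => ?_
    rw [mul_apply, Finset.sum_mul]
    refine Finset.sum_congr rfl fun x _ => ?_
    rw [hc, conjTranspose_apply, star_mul']
    ring
  rw [h, ← Equiv.sum_comp (Equiv.curry (Fin m) (Fin n) Bool).symm, Complex.star_def,
    Complex.mul_conj', ← Complex.ofReal_pow, Complex.ofReal_re]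
  rfl

theorem sum_diag_run (C : QCircuit (Fin m × Fin n)) (ψ : Ket (Fin n)) (hψ : ‖ψ‖ = 1) :
    ∑ a, (C.run (copies m (ketBra ψ)) a a).re = 1 := by
  rw [← Complex.re_sum]
  change (C.run (copies m (ketBra ψ))).trace.re = 1
  rw [(isChannel_run C).2, Matrix.trace, ← Equiv.sum_comp (Equiv.curry (Fin m) (Fin n) Bool).symm]
  have h : ∑ x : Fin m → Fin n → Bool, ∏ c, (ketBra ψ) (x c) (x c) = 1 := by
    rw [← Fintype.sum_pow (fun y => (ketBra ψ) y y)]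
    have : ∑ y, (ketBra ψ) y y = 1 := by
      have h₁ : ∀ y, (ketBra ψ) y y = ((‖ψ y‖ ^ 2 : ℝ) : ℂ) := fun y => by
        rw [ketBra, of_apply, Complex.star_def, Complex.mul_conj', Complex.ofReal_pow]
      simp only [h₁]
      rw [← Complex.ofReal_sum, ← EuclideanSpace.norm_sq_eq, hψ]
      simp
    simp [this]
  exact congrArg Complex.re h

end Kraus

end

end QLearn

namespace QLearn

noncomputable section

/-! ### Trace distance and overlap with a pure state -/

section TraceDistance

open Matrix

set_option linter.unusedSectionVars false

variable {W : Type} [Fintype W] [DecidableEq W]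

theorem norm_mul_apply_sq_le (B C : Op W) (x y : W → Bool) :
    ‖(B * C) x y‖ ^ 2 ≤ (∑ z, ‖B x z‖ ^ 2) * ∑ z, ‖C z y‖ ^ 2 := by
  rw [mul_apply]
  refine (pow_le_pow_left₀ (norm_nonneg _) (norm_sum_le _ _) 2).trans ?_
  simp only [norm_mul]
  exact Finset.sum_mul_sq_le_sq_mul_sq _ _ _

theorem sum_norm_sq_col (C : Op W) (y : W → Bool) : ∑ z, ‖C z y‖ ^ 2 = ((Cᴴ * C) y y).re := by
  rw [mul_apply, Complex.re_sum]
  refine Finset.sum_congr rfl fun z _ => ?_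
  rw [conjTranspose_apply, Complex.star_def, Complex.conj_mul', ← Complex.ofReal_pow,
    Complex.ofReal_re]

theorem sum_norm_sq_row (B : Op W) (x : W → Bool) : ∑ z, ‖B x z‖ ^ 2 = ((B * Bᴴ) x x).re := by
  rw [mul_apply, Complex.re_sum]
  refine Finset.sum_congr rfl fun z _ => ?_
  rw [conjTranspose_apply, Complex.star_def, Complex.mul_conj', ← Complex.ofReal_pow,
    Complex.ofReal_re]

/-- In an eigenbasis V of A*A the trace is that of (V*U)(AV). The rows of V*U are unit vectors and
the columns of AV have the singular values of A as norms, so Cauchy-Schwarz bounds each diagonal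
entry. -/
theorem re_trace_mul_le_traceNorm (U A : Op W) (hU : U * Uᴴ = 1) :
    (U * A).trace.re ≤ traceNorm A := by
  set H := isHermitian_conjTranspose_mul_self A with hH
  set V : Op W := H.eigenvectorUnitary.1 with hV
  have hV₁ : Vᴴ * V = 1 := Unitary.coe_star_mul_self H.eigenvectorUnitary
  have hV₂ : V * Vᴴ = 1 := Unitary.coe_mul_star_self H.eigenvectorUnitary
  have hB : (Vᴴ * U) * (Vᴴ * U)ᴴ = 1 := by
    rw [conjTranspose_mul, conjTranspose_conjTranspose, Matrix.mul_assoc, ← Matrix.mul_assoc U, hU,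
      Matrix.one_mul, hV₁]
  have hC : (A * V)ᴴ * (A * V) = diagonal (RCLike.ofReal ∘ H.eigenvalues) := by
    have := H.conjStarAlgAut_star_eigenvectorUnitary
    rw [Unitary.conjStarAlgAut_star_apply] at this
    rw [← this, conjTranspose_mul]
    simp only [Matrix.mul_assoc]
    rfl
  have htr : (U * A).trace = ((Vᴴ * U) * (A * V)).trace := by
    rw [← Matrix.mul_assoc, Matrix.trace_mul_comm (_ * A), ← Matrix.mul_assoc, ← Matrix.mul_assoc,
      hV₂, Matrix.one_mul]
  rw [htr, Matrix.trace, Complex.re_sum, traceNorm]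
  refine Finset.sum_le_sum fun x _ => ?_
  refine (Complex.re_le_norm _).trans (Real.le_sqrt_of_sq_le ?_)
  refine (norm_mul_apply_sq_le _ _ _ _).trans ?_
  rw [sum_norm_sq_row, sum_norm_sq_col, hB, hC]
  simp

variable {n a : ℕ}

theorem trace_preparedState (s : List Bool) : (preparedState n a s).trace = 1 := by
  have h := sum_gatesOnZero (describedGates (n + a) s)
  rw [← Equiv.sum_comp (Fin.appendEquiv n a), Fintype.sum_prod_type] at h
  have h₂ : (preparedState n a s).trace = ((∑ x : Fin n → Bool, ∑ z : Fin a → Bool,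
      ‖gatesOnZero (describedGates (n + a) s) (Fin.append x z)‖ ^ 2 : ℝ) : ℂ) := by
    push_cast
    refine Finset.sum_congr rfl fun x _ => Finset.sum_congr rfl fun z _ => ?_
    rw [Complex.star_def, Complex.mul_conj']
  rw [h₂]
  exact_mod_cast h

theorem trace_ketBra (ψ : Ket W) (hψ : ‖ψ‖ = 1) : (ketBra ψ).trace = 1 := by
  have h : ∑ t, ‖ψ t‖ ^ 2 = 1 := by rw [← EuclideanSpace.norm_sq_eq, hψ, one_pow]
  have h₂ : (ketBra ψ).trace = ((∑ t, ‖ψ t‖ ^ 2 : ℝ) : ℂ) := by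
    push_cast
    refine Finset.sum_congr rfl fun x _ => ?_
    rw [diag_apply, ketBra, of_apply, Complex.star_def, Complex.mul_conj']
  rw [h₂, h, Complex.ofReal_one]

theorem ketBra_mul_self (ψ : Ket W) (hψ : ‖ψ‖ = 1) : ketBra ψ * ketBra ψ = ketBra ψ := by
  have h : ∑ t, star (ψ t) * ψ t = 1 := by
    rw [← trace_ketBra ψ hψ]
    exact Finset.sum_congr rfl fun t _ => mul_comm _ _
  ext x y
  rw [mul_apply]
  simp only [ketBra, of_apply]
  have h₂ : ψ x * star (ψ y) = ψ x * (∑ t, star (ψ t) * ψ t) * star (ψ y) := by rw [h, mul_one]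
  rw [h₂, Finset.mul_sum, Finset.sum_mul]
  exact Finset.sum_congr rfl fun t _ => by ring

theorem conjTranspose_ketBra (ψ : Ket W) : (ketBra ψ)ᴴ = ketBra ψ := by
  ext x y
  simp [ketBra, mul_comm]

theorem trace_ketBra_mul_preparedState (ψ : Ket (Fin n)) (s : List Bool) :
    (ketBra ψ * preparedState n a s).trace =
      (overlap ψ (gatesOnZero (describedGates (n + a) s)) : ℂ) := by
  set χ := gatesOnZero (describedGates (n + a) s) with hχ
  have h : ∀ z : Fin a → Bool, ((‖∑ t, star (ψ t) * χ (Fin.append t z)‖ ^ 2 : ℝ) : ℂ) =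
      ∑ x, ∑ y, ψ x * star (ψ y) * (χ (Fin.append y z) * star (χ (Fin.append x z))) := by
    intro z
    rw [Complex.ofReal_pow, ← Complex.mul_conj', ← Complex.star_def, star_sum, mul_comm,
      Finset.sum_mul_sum]
    refine Finset.sum_congr rfl fun x _ => Finset.sum_congr rfl fun y _ => ?_
    rw [star_mul', star_star]
    ring
  rw [overlap, Complex.ofReal_sum]
  simp only [h]
  rw [Finset.sum_comm]
  refine Finset.sum_congr rfl fun x _ => ?_
  rw [diag_apply, mul_apply, Finset.sum_comm]
  refine Finset.sum_congr rfl fun y _ => ?_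
  rw [← Finset.mul_sum]
  rfl

/-- A state close to a pure state has large overlap with it. -/
theorem one_sub_traceDist_le_overlap (ψ : Ket (Fin n)) (hψ : ‖ψ‖ = 1) (s : List Bool) :
    1 - traceDist (ketBra ψ) (preparedState n a s) ≤
      overlap ψ (gatesOnZero (describedGates (n + a) s)) := by
  -- Reflection at ψ: with σ the prepared state and U = 2|ψ⟩⟨ψ| - 1, the trace of U(|ψ⟩⟨ψ| - σ) is
  -- 2(1 - ⟨ψ|σ|ψ⟩).
  have hU : (2 • ketBra ψ - 1 : Op (Fin n)) * (2 • ketBra ψ - 1 : Op (Fin n))ᴴ = 1 := by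
    have h : (2 • ketBra ψ - 1 : Op (Fin n))ᴴ = 2 • ketBra ψ - 1 := by
      rw [two_nsmul, conjTranspose_sub, conjTranspose_add, conjTranspose_ketBra, conjTranspose_one]
    rw [h, two_nsmul, sub_mul, mul_sub, add_mul, mul_add, ketBra_mul_self ψ hψ]
    simp
  have h := re_trace_mul_le_traceNorm _ (ketBra ψ - preparedState n a s) hU
  rw [sub_mul, mul_sub, Matrix.one_mul, Matrix.trace_sub, Matrix.trace_sub, Matrix.trace_sub,
    trace_preparedState, trace_ketBra ψ hψ, smul_mul, ketBra_mul_self ψ hψ, smul_mul,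
    Matrix.trace_smul, Matrix.trace_smul, trace_ketBra ψ hψ, trace_ketBra_mul_preparedState] at h
  simp at h
  rw [traceDist]
  linarith

theorem overlap_nonneg (ψ : (Fin n → Bool) → ℂ) (χ : (Fin (n + a) → Bool) → ℂ) :
    0 ≤ overlap ψ χ := Finset.sum_nonneg fun _ _ => by positivity

end TraceDistance

end

end QLearn

namespace QLearn

noncomputable section

/-! ### Averages over random phases -/

section PhaseAverage

set_option linter.unusedSectionVars false

variable {T X : Type} [Fintype T] [DecidableEq T] [Fintype X] {N : ℕ} [NeZero N]

/-- The character `β` of the group of phases. -/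
def phaseChar (β θ : T → ZMod N) : ℂ := ZMod.stdAddChar (∑ t, β t * θ t)

theorem phaseChar_add (β γ θ : T → ZMod N) :
    phaseChar (β + γ) θ = phaseChar β θ * phaseChar γ θ := by
  simp only [phaseChar, Pi.add_apply, add_mul, Finset.sum_add_distrib, AddChar.map_add_eq_mul]

theorem star_phaseChar (β θ : T → ZMod N) : star (phaseChar β θ) = phaseChar (-β) θ := by
  simp only [phaseChar, Pi.neg_apply, neg_mul, Finset.sum_neg_distrib]
  exact (AddChar.map_neg_eq_conj _ _).symm

theorem phaseChar_single (t : T) (θ : T → ZMod N) :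
    phaseChar (Pi.single t 1) θ = ZMod.stdAddChar (θ t) := by
  simp [phaseChar, Pi.single_apply]

theorem sum_phaseChar (β : T → ZMod N) :
    ∑ θ, phaseChar β θ = if β = 0 then ((N : ℂ) ^ Fintype.card T) else 0 := by
  have h : ∀ t, ∑ a : ZMod N, ZMod.stdAddChar (β t * a) = if β t = 0 then (N : ℂ) else 0 := by
    intro t
    have := AddChar.sum_mulShift (β t) (ZMod.isPrimitive_stdAddChar N)
    simp only [ZMod.card] at this
    simpa only [mul_comm, Nat.cast_ite, Nat.cast_zero] using this
  have h' : ∀ θ, phaseChar β θ = ∏ t, ZMod.stdAddChar (β t * θ t) := by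
    intro θ
    have : ∀ s : Finset T, (ZMod.stdAddChar (∑ t ∈ s, β t * θ t) : ℂ) =
        ∏ t ∈ s, ZMod.stdAddChar (β t * θ t) := by
      intro s
      induction s using Finset.induction_on with
      | empty => simp
      | insert t s ht ih =>
        rw [Finset.sum_insert ht, Finset.prod_insert ht, AddChar.map_add_eq_mul, ih]
    exact this _
  simp only [h']
  rw [← Fintype.prod_sum (fun t a => ZMod.stdAddChar (β t * a))]
  simp only [h]
  split_ifs with h0
  · simp [h0]
  · obtain ⟨t, ht⟩ := Function.ne_iff.1 h0
    exact Finset.prod_eq_zero (Finset.mem_univ t) (if_neg ht)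

/-- Parseval's identity for sums of characters. -/
theorem sum_norm_sq_phaseChar (w : X → T → ZMod N) (f : X → ℂ) :
    ∑ θ, ‖∑ x, f x * phaseChar (w x) θ‖ ^ 2 =
      (N : ℝ) ^ Fintype.card T * ∑ β, ‖∑ x, if w x = β then f x else 0‖ ^ 2 := by
  have hL : ∀ θ, ((‖∑ x, f x * phaseChar (w x) θ‖ ^ 2 : ℝ) : ℂ) =
      ∑ x, ∑ y, f x * star (f y) * phaseChar (w x - w y) θ := by
    intro θ
    rw [Complex.ofReal_pow, ← Complex.mul_conj', ← Complex.star_def, star_sum, Finset.sum_mul_sum]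
    refine Finset.sum_congr rfl fun x _ => Finset.sum_congr rfl fun y _ => ?_
    rw [star_mul', star_phaseChar, sub_eq_add_neg, phaseChar_add]
    ring
  have hR : ∀ β, ((‖∑ x, if w x = β then f x else 0‖ ^ 2 : ℝ) : ℂ) =
      ∑ x, ∑ y, if w x = β ∧ w y = β then f x * star (f y) else 0 := by
    intro β
    rw [Complex.ofReal_pow, ← Complex.mul_conj', ← Complex.star_def, star_sum, Finset.sum_mul_sum]
    refine Finset.sum_congr rfl fun x _ => Finset.sum_congr rfl fun y _ => ?_
    by_cases hx : w x = β <;> by_cases hy : w y = β <;> simp [hx, hy]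
  refine Complex.ofReal_injective ?_
  rw [Complex.ofReal_sum, Complex.ofReal_mul, Complex.ofReal_sum, Finset.mul_sum]
  simp only [hL, hR]
  have hswap : ∀ (I : Type) [Fintype I] (G : I → X → X → ℂ),
      ∑ i, ∑ x, ∑ y, G i x y = ∑ x, ∑ y, ∑ i, G i x y := by
    intro I _ G
    rw [Finset.sum_comm]
    exact Finset.sum_congr rfl fun x _ => Finset.sum_comm
  rw [← Finset.mul_sum, hswap, hswap, Finset.mul_sum]
  refine Finset.sum_congr rfl fun x _ => ?_
  rw [Finset.mul_sum]
  refine Finset.sum_congr rfl fun y _ => ?_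
  rw [← Finset.mul_sum, sum_phaseChar]
  have : ∀ β, (if w x = β ∧ w y = β then f x * star (f y) else 0) =
      if w x = β then (if w x = w y then f x * star (f y) else 0) else 0 := by
    intro β
    by_cases hx : w x = β
    · subst hx; simp [eq_comm]
    · simp [hx]
  simp only [this, Finset.sum_ite_eq, Finset.mem_univ, if_true, sub_eq_zero]
  split_ifs <;> simp [mul_comm]

/-- The product of the two sums is a single sum of characters, whose coefficient at β is the sum
over t of g t times the coefficient of the first sum at β - e_t. At most `M` values of t contribute,
so Cauchy-Schwarz costs a factor `M`; Parseval is applied before and after. -/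
theorem sum_norm_sq_mul_phaseChar_le (w : X → T → ZMod N) (f : X → ℂ) (g : T → ℂ) (M : ℕ)
    (hM : ∀ β, {t | ∃ x, w x + Pi.single t 1 = β}.ncard ≤ M) :
    ∑ θ, ‖∑ x, f x * phaseChar (w x) θ‖ ^ 2 * ‖∑ t, g t * ZMod.stdAddChar (θ t)‖ ^ 2 ≤
      M * (∑ t, ‖g t‖ ^ 2) * ∑ θ, ‖∑ x, f x * phaseChar (w x) θ‖ ^ 2 := by
  classical
  set F : (T → ZMod N) → ℂ := fun γ => ∑ x, if w x = γ then f x else 0 with hF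
  have h₁ : ∀ θ, ‖∑ x, f x * phaseChar (w x) θ‖ ^ 2 * ‖∑ t, g t * ZMod.stdAddChar (θ t)‖ ^ 2 =
      ‖∑ p : X × T, (f p.1 * g p.2) * phaseChar (w p.1 + Pi.single p.2 1) θ‖ ^ 2 := by
    intro θ
    rw [← mul_pow, ← norm_mul, Finset.sum_mul_sum, Fintype.sum_prod_type]
    congr 2
    refine Finset.sum_congr rfl fun x _ => Finset.sum_congr rfl fun t _ => ?_
    rw [phaseChar_add, phaseChar_single]
    ring
  have h₂ : ∀ β : T → ZMod N, ∑ p : X × T, (if w p.1 + Pi.single p.2 (1 : ZMod N) = β then f p.1 * g p.2 else 0) =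
      ∑ t, g t * F (β - Pi.single t (1 : ZMod N)) := by
    intro β
    rw [Fintype.sum_prod_type, Finset.sum_comm]
    refine Finset.sum_congr rfl fun t _ => ?_
    rw [hF, Finset.mul_sum]
    refine Finset.sum_congr rfl fun x _ => ?_
    simp only [eq_sub_iff_add_eq, mul_ite, mul_zero, mul_comm]
  have h₃ : ∀ β : T → ZMod N, ‖∑ t, g t * F (β - Pi.single t (1 : ZMod N))‖ ^ 2 ≤
      M * ∑ t, ‖g t‖ ^ 2 * ‖F (β - Pi.single t 1)‖ ^ 2 := by
    intro β
    set S : Finset T := {t | ∃ x, w x + Pi.single t 1 = β} with hS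
    have hSM : S.card ≤ M := by
      have := hM β
      rwa [← Set.ncard_coe_finset, hS, Finset.coe_filter_univ]
    have h₀ : ∑ t, g t * F (β - Pi.single t (1 : ZMod N)) = ∑ t ∈ S, g t * F (β - Pi.single t 1) := by
      symm
      refine Finset.sum_subset (Finset.subset_univ _) fun t _ ht => ?_
      have : F (β - Pi.single t 1) = 0 := by
        refine Finset.sum_eq_zero fun x _ => if_neg fun hx => ht ?_
        rw [hS, Finset.mem_filter]
        exact ⟨Finset.mem_univ _, x, by rw [hx, sub_add_cancel]⟩
      rw [this, mul_zero]
    rw [h₀]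
    refine (pow_le_pow_left₀ (norm_nonneg _) (norm_sum_le _ _) 2).trans ?_
    refine (sq_sum_le_card_mul_sum_sq).trans ?_
    refine mul_le_mul (by exact_mod_cast hSM) ?_ (by positivity) (by positivity)
    simp only [norm_mul, mul_pow]
    exact Finset.sum_le_sum_of_subset_of_nonneg (Finset.subset_univ _) fun _ _ _ => by positivity
  simp only [h₁]
  have h₅ := sum_norm_sq_phaseChar (fun p : X × T => w p.1 + Pi.single p.2 (1 : ZMod N))
    (fun p => f p.1 * g p.2)
  simp only [h₂] at h₅
  rw [h₅, sum_norm_sq_phaseChar w]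
  have h₄ : ∑ β : T → ZMod N, ‖∑ t, g t * F (β - Pi.single t (1 : ZMod N))‖ ^ 2 ≤ M * (∑ t, ‖g t‖ ^ 2) * ∑ β, ‖F β‖ ^ 2 := by
    refine (Finset.sum_le_sum fun β _ => h₃ β).trans_eq ?_
    rw [← Finset.mul_sum, Finset.sum_comm, mul_assoc, Finset.sum_mul]
    congr 1
    refine Finset.sum_congr rfl fun t _ => ?_
    rw [← Finset.mul_sum]
    congr 1
    -- For fixed t, shifting the frequency by e_t only permutes the coefficients.
    exact Equiv.sum_comp (Equiv.subRight (Pi.single t 1)) fun β => ‖F β‖ ^ 2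
  calc _ ≤ (N : ℝ) ^ Fintype.card T * (M * (∑ t, ‖g t‖ ^ 2) * ∑ β, ‖F β‖ ^ 2) := by gcongr
    _ = _ := by ring

/-- The type of a tuple: how often each element occurs, modulo `N`. -/
def tupleType {m : ℕ} (x : Fin m → T) : T → ZMod N := ∑ c, Pi.single (x c) 1

theorem phaseChar_tupleType {m : ℕ} (x : Fin m → T) (θ : T → ZMod N) :
    phaseChar (tupleType x) θ = ∏ c, ZMod.stdAddChar (θ (x c)) := by
  have : ∀ s : Finset (Fin m), phaseChar (∑ c ∈ s, Pi.single (x c) 1) θ =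
      ∏ c ∈ s, ZMod.stdAddChar (θ (x c)) := by
    classical
    intro s
    induction s using Finset.induction_on with
    | empty => simp [phaseChar]
    | insert c s hc ih =>
      rw [Finset.sum_insert hc, Finset.prod_insert hc, phaseChar_add, phaseChar_single, ih]
  exact this _

theorem tupleType_apply {m : ℕ} (x : Fin m → T) (t : T) :
    (tupleType x : T → ZMod N) t = ((Finset.univ.filter fun c => x c = t).card : ℕ) := by
  simp [tupleType, Finset.sum_apply, Pi.single_apply, eq_comm]

/-- Fix one decomposition of β into the type of a tuple `x₀` and a further element `t₀`. Any other
admissible t occurs in β between 1 and m + 1 times, which is nonzero modulo N because N ≥ m + 2;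
hence t is `t₀` or an entry of `x₀`. -/
theorem ncard_tupleType_le {m : ℕ} (hN : m + 2 ≤ N) (β : T → ZMod N) :
    {t | ∃ x : Fin m → T, tupleType x + Pi.single t 1 = β}.ncard ≤ m + 1 := by
  rcases Set.eq_empty_or_nonempty {t | ∃ x : Fin m → T, tupleType x + Pi.single t 1 = β} with h | h
  · simp [h]
  obtain ⟨t₀, x₀, h₀⟩ := h
  have hsub : {t | ∃ x : Fin m → T, tupleType x + Pi.single t 1 = β} ⊆
      (insert t₀ (Finset.univ.image x₀) : Finset T) := by
    rintro t ⟨x, rfl⟩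
    by_contra ht
    simp only [Finset.coe_insert, Finset.coe_image, Finset.coe_univ, Set.image_univ,
      Set.mem_insert_iff, Set.mem_range, not_or, not_exists] at ht
    have h₁ := congrFun h₀ t
    simp only [Pi.add_apply, tupleType_apply, Pi.single_eq_same, Pi.single_eq_of_ne ht.1] at h₁
    rw [Finset.filter_false_of_mem (fun c _ => ht.2 c), Finset.card_empty, Nat.cast_zero, zero_add,
      ← Nat.cast_add_one, eq_comm, ZMod.natCast_eq_zero_iff] at h₁
    have h₂ := Nat.le_of_dvd (Nat.succ_pos _) h₁
    have h₃ := (Finset.card_filter_le (Finset.univ : Finset (Fin m)) fun c => x c = t)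
    rw [Finset.card_univ, Fintype.card_fin] at h₃
    omega
  refine (Set.ncard_le_ncard hsub (Finset.finite_toSet _)).trans ?_
  rw [Set.ncard_coe_finset]
  refine (Finset.card_insert_le _ _).trans (Nat.succ_le_succ ?_)
  exact Finset.card_image_le.trans (by simp)

end PhaseAverage

end

end QLearn

namespace QLearn

noncomputable section

/-! ### The mean overlap of the learner's output with its input -/

section MeanOverlap

variable {m n b : ℕ}

/-- The mean overlap of `ψ` with the state that is prepared by the circuit found by `C`. -/
def meanOverlap (C : QCircuit (Fin m × Fin n)) (b : ℕ) (ψ : Ket (Fin n)) : ℝ :=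
  ∑ a, (C.run (copies m (ketBra ψ)) a a).re *
    overlap ψ (gatesOnZero (describedGates (n + b) (C.outputs.map a)))

variable (C : QCircuit (Fin m × Fin n))

theorem probOf_distinguisher_eq (b : ℕ) (ψ : Ket (Fin n)) (hψ : ‖ψ‖ = 1) :
    (distinguisher C b).probOf (copies (m + 1) (ketBra ψ)) (fun s => s = [true]) =
      (1 - meanOverlap C b ψ) / 2 := by
  have h : (distinguisher C b).probOf (copies (m + 1) (ketBra ψ)) (fun s => s = [true]) =
      (∑ a, (C.run (copies m (ketBra ψ)) a a).re - meanOverlap C b ψ) / 2 := by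
    rw [probOf_distinguisher C b ψ hψ, meanOverlap, ← Finset.sum_sub_distrib, Finset.sum_div]
    exact Finset.sum_congr rfl fun a _ => by ring
  rw [h, sum_diag_run C ψ hψ]

theorem re_run_nonneg (ψ : Ket (Fin n)) (a : (Fin m × Fin n) ⊕ Fin C.anc → Bool) :
    0 ≤ (C.run (copies m (ketBra ψ)) a a).re := by
  obtain ⟨κ, _, K, hK⟩ := exists_diag_run C
  rw [hK]
  positivity

/-- If `C` often finds a circuit that prepares approximately `ψ`, then the mean overlap is large. -/
theorem mul_probOf_le_meanOverlap (ψ : Ket (Fin n)) (hψ : ‖ψ‖ = 1) (η : ℝ) :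
    η * (C.probOf (copies m (ketBra ψ)) fun s => traceDist (ketBra ψ) (preparedState n b s) ≤
      1 - η) ≤ meanOverlap C b ψ := by
  rw [QCircuit.probOf, Finset.mul_sum, meanOverlap]
  refine Finset.sum_le_sum fun a _ => ?_
  split_ifs with h
  · rw [mul_comm]
    refine mul_le_mul_of_nonneg_left ?_ (re_run_nonneg C ψ a)
    exact le_trans (by linarith) (one_sub_traceDist_le_overlap ψ hψ _)
  · rw [mul_zero]
    exact mul_nonneg (re_run_nonneg C ψ a) (overlap_nonneg _ _)

/-- A change of the phases of the amplitudes. -/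
def phaseKet {N : ℕ} [NeZero N] (θ : (Fin n → Bool) → ZMod N) (ψ : Ket (Fin n)) : Ket (Fin n) :=
  WithLp.toLp 2 fun t => ZMod.stdAddChar (θ t) * ψ t

theorem norm_phaseKet {N : ℕ} [NeZero N] (θ : (Fin n → Bool) → ZMod N) (ψ : Ket (Fin n)) :
    ‖phaseKet θ ψ‖ = ‖ψ‖ := by
  rw [EuclideanSpace.norm_eq, EuclideanSpace.norm_eq]
  congr 1
  refine Finset.sum_congr rfl fun t _ => ?_
  rw [phaseKet, norm_mul, AddChar.norm_apply, one_mul]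

theorem powVec_phaseKet {N : ℕ} [NeZero N] (θ : (Fin n → Bool) → ZMod N) (ψ : Ket (Fin n))
    (x : Fin m → Fin n → Bool) :
    powVec m (phaseKet θ ψ) x = powVec m ψ x * phaseChar (tupleType x) θ := by
  rw [phaseChar_tupleType, powVec, powVec, ← Finset.prod_mul_distrib]
  exact Finset.prod_congr rfl fun c _ => mul_comm _ _

/-- The left side is the sum of q_t |ψ_t|², where q is the distribution of the first n bits of χ.
The inequality of arithmetic and geometric means with weight `s`, together with q_t² ≤ q_t, gives a
bound independent of χ and affine in the fourth powers, so that it can be averaged over ψ for a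
fixed `s`. -/
theorem sum_norm_sq_mul_le (ψ : Ket (Fin n)) {χ : (Fin (n + b) → Bool) → ℂ}
    (hχ : ∑ x, ‖χ x‖ ^ 2 = 1) {s : ℝ} (hs : 0 < s) :
    ∑ z : Fin b → Bool, ∑ t, ‖star (χ (Fin.append t z)) * ψ t‖ ^ 2 ≤
      (s + (∑ t, ‖ψ t‖ ^ 4) / s) / 2 := by
  set q : (Fin n → Bool) → ℝ := fun t => ∑ z : Fin b → Bool, ‖χ (Fin.append t z)‖ ^ 2 with hq
  have hq0 : ∀ t, 0 ≤ q t := fun t => Finset.sum_nonneg fun _ _ => by positivity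
  have hq1 : ∑ t, q t = 1 := by
    rw [← hχ, ← Equiv.sum_comp (Fin.appendEquiv n b), Fintype.sum_prod_type]
    rfl
  have hle : ∀ t, q t ≤ 1 := fun t =>
    hq1 ▸ Finset.single_le_sum (fun t _ => hq0 t) (Finset.mem_univ t)
  have h₁ : ∑ z : Fin b → Bool, ∑ t, ‖star (χ (Fin.append t z)) * ψ t‖ ^ 2 =
      ∑ t, q t * ‖ψ t‖ ^ 2 := by
    rw [Finset.sum_comm]
    refine Finset.sum_congr rfl fun t _ => ?_
    rw [hq, Finset.sum_mul]
    refine Finset.sum_congr rfl fun z _ => ?_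
    rw [norm_mul, norm_star, mul_pow]
  have h₂ : ∀ t, q t * ‖ψ t‖ ^ 2 ≤ (s * q t + ‖ψ t‖ ^ 4 / s) / 2 := by
    intro t
    have h₃ : s * q t ^ 2 ≤ s * q t := by
      have := mul_le_mul_of_nonneg_left (hle t) (hq0 t)
      nlinarith
    have h₄ : 0 ≤ (s * q t - ‖ψ t‖ ^ 2) ^ 2 / s := by positivity
    have h₅ : (s * q t - ‖ψ t‖ ^ 2) ^ 2 / s = s * q t ^ 2 - 2 * (q t * ‖ψ t‖ ^ 2) +
        ‖ψ t‖ ^ 4 / s := by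
      field_simp
      ring
    linarith
  rw [h₁]
  refine (Finset.sum_le_sum fun t _ => h₂ t).trans_eq ?_
  rw [← Finset.sum_div, Finset.sum_add_distrib, ← Finset.mul_sum, hq1, mul_one, Finset.sum_div]

/-- Averaging over the phases bounds the mean overlap. -/
theorem sum_meanOverlap_phaseKet_le {N : ℕ} [NeZero N] (hN : m + 2 ≤ N) (b : ℕ) (ψ : Ket (Fin n))
    (hψ : ‖ψ‖ = 1) {s : ℝ} (hs : 0 < s) :
    ∑ θ : (Fin n → Bool) → ZMod N, meanOverlap C b (phaseKet θ ψ) ≤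
      Fintype.card ((Fin n → Bool) → ZMod N) * ((m + 1) * ((s + (∑ t, ‖ψ t‖ ^ 4) / s) / 2)) := by
  obtain ⟨κ, _, K, hK⟩ := exists_diag_run C
  set χ := fun a => gatesOnZero (describedGates (n + b) (C.outputs.map a)) with hχ
  have h₁ : ∀ (a : (Fin m × Fin n) ⊕ Fin C.anc → Bool) (k : κ) (z : Fin b → Bool),
      ∑ θ : (Fin n → Bool) → ZMod N, ‖∑ x, K k a x * powVec m (phaseKet θ ψ) x‖ ^ 2 *
        ‖∑ t, star (phaseKet θ ψ t) * χ a (Fin.append t z)‖ ^ 2 ≤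
      (m + 1) * (∑ t, ‖star (χ a (Fin.append t z)) * ψ t‖ ^ 2) *
        ∑ θ : (Fin n → Bool) → ZMod N, ‖∑ x, K k a x * powVec m (phaseKet θ ψ) x‖ ^ 2 := by
    intro a k z
    -- The copies seen by the learner give characters of tuple type; the copy used in the overlap
    -- gives the single additional character.
    have h := sum_norm_sq_mul_phaseChar_le (N := N) (fun x : Fin m → Fin n → Bool => tupleType x)
      (fun x => K k a x * powVec m ψ x) (fun t => star (χ a (Fin.append t z)) * ψ t) (m + 1)
      (fun β => ncard_tupleType_le hN β)
    have h₂ : ∀ θ : (Fin n → Bool) → ZMod N, ‖∑ t, star (phaseKet θ ψ t) * χ a (Fin.append t z)‖ =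
        ‖∑ t, star (χ a (Fin.append t z)) * ψ t * ZMod.stdAddChar (θ t)‖ := by
      intro θ
      rw [← norm_star, star_sum]
      congr 2
      funext t
      rw [star_mul', star_star, phaseKet]
      ring
    simp only [powVec_phaseKet, h₂, ← mul_assoc]
    push_cast at h
    exact h
  have h₂ : ∀ θ : (Fin n → Bool) → ZMod N, meanOverlap C b (phaseKet θ ψ) =
      ∑ a, ∑ k, ∑ z : Fin b → Bool, ‖∑ x, K k a x * powVec m (phaseKet θ ψ) x‖ ^ 2 *
        ‖∑ t, star (phaseKet θ ψ t) * χ a (Fin.append t z)‖ ^ 2 := by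
    intro θ
    rw [meanOverlap]
    refine Finset.sum_congr rfl fun a _ => ?_
    rw [hK, overlap, Finset.sum_mul_sum]
  simp only [h₂]
  have hswap : ∑ θ : (Fin n → Bool) → ZMod N, ∑ a, ∑ k, ∑ z : Fin b → Bool,
      ‖∑ x, K k a x * powVec m (phaseKet θ ψ) x‖ ^ 2 *
        ‖∑ t, star (phaseKet θ ψ t) * χ a (Fin.append t z)‖ ^ 2 =
      ∑ a, ∑ k, ∑ z : Fin b → Bool, ∑ θ : (Fin n → Bool) → ZMod N,
      ‖∑ x, K k a x * powVec m (phaseKet θ ψ) x‖ ^ 2 *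
        ‖∑ t, star (phaseKet θ ψ t) * χ a (Fin.append t z)‖ ^ 2 := by
    rw [Finset.sum_comm]
    refine Finset.sum_congr rfl fun a _ => ?_
    rw [Finset.sum_comm]
    refine Finset.sum_congr rfl fun k _ => ?_
    rw [Finset.sum_comm]
  rw [hswap]
  set B := (s + (∑ t, ‖ψ t‖ ^ 4) / s) / 2 with hB
  have h₃ : ∀ a (k : κ), ∑ z : Fin b → Bool, ∑ θ : (Fin n → Bool) → ZMod N,
      ‖∑ x, K k a x * powVec m (phaseKet θ ψ) x‖ ^ 2 *
        ‖∑ t, star (phaseKet θ ψ t) * χ a (Fin.append t z)‖ ^ 2 ≤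
      (m + 1) * B * ∑ θ : (Fin n → Bool) → ZMod N,
        ‖∑ x, K k a x * powVec m (phaseKet θ ψ) x‖ ^ 2 := by
    intro a k
    refine (Finset.sum_le_sum fun z _ => h₁ a k z).trans ?_
    rw [← Finset.sum_mul, ← Finset.mul_sum]
    gcongr
    exact sum_norm_sq_mul_le ψ (sum_gatesOnZero _) hs
  refine (Finset.sum_le_sum fun a _ => Finset.sum_le_sum fun k _ => h₃ a k).trans_eq ?_
  -- The remaining factors are the probabilities of all outputs for each choice of phases, and they
  -- add up to 1.
  have h₄ : ∑ a, ∑ k, ∑ θ : (Fin n → Bool) → ZMod N,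
      ‖∑ x, K k a x * powVec m (phaseKet θ ψ) x‖ ^ 2 =
      Fintype.card ((Fin n → Bool) → ZMod N) := by
    have : ∀ a, ∑ k, ∑ θ : (Fin n → Bool) → ZMod N,
        ‖∑ x, K k a x * powVec m (phaseKet θ ψ) x‖ ^ 2 =
        ∑ θ : (Fin n → Bool) → ZMod N, (C.run (copies m (ketBra (phaseKet θ ψ))) a a).re := by
      intro a
      rw [Finset.sum_comm]
      simp only [hK]
    simp only [this]
    rw [Finset.sum_comm, Finset.sum_congr rfl fun θ _ => sum_diag_run C (phaseKet θ ψ)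
      ((norm_phaseKet θ ψ).trans hψ)]
    simp
  rw [← h₄]
  simp only [← Finset.mul_sum]
  ring

theorem continuous_meanOverlap (b : ℕ) : Continuous (meanOverlap C b) := by
  obtain ⟨κ, _, K, hK⟩ := exists_diag_run C
  unfold meanOverlap
  simp only [hK, overlap, powVec]
  fun_prop

end MeanOverlap

end

end QLearn

namespace QLearn

noncomputable section

/-! ### Haar moments and the bound for Haar random states -/

section Haar

variable {n : ℕ}

open scoped Pointwise

/-- The surface measure of a set is defined by the volume of the cone over it, and an isometry maps
cones to cones and preserves volume. -/
theorem map_toSphere_of_isometry (U : Ket (Fin n) ≃ₗᵢ[ℝ] Ket (Fin n))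
    (S : Metric.sphere (0 : Ket (Fin n)) 1 → Metric.sphere (0 : Ket (Fin n)) 1)
    (hS : ∀ ψ, (S ψ : Ket (Fin n)) = U ψ) (hSm : Measurable S) :
    (volume : Measure (Ket (Fin n))).toSphere.map S =
      (volume : Measure (Ket (Fin n))).toSphere := by
  ext s hs
  rw [Measure.map_apply hSm hs, Measure.toSphere_apply' _ (hSm hs), Measure.toSphere_apply' _ hs]
  congr 1
  have h : Set.Ioo (0 : ℝ) 1 • (Subtype.val '' (S ⁻¹' s) : Set (Ket (Fin n))) =
      U ⁻¹' (Set.Ioo (0 : ℝ) 1 • (Subtype.val '' s : Set (Ket (Fin n)))) := by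
    ext ψ
    simp only [Set.mem_smul, Set.mem_preimage, Set.mem_image]
    constructor
    · rintro ⟨r, hr, _, ⟨φ, hφ, rfl⟩, rfl⟩
      exact ⟨r, hr, _, ⟨S φ, hφ, rfl⟩, by rw [hS, map_smul]⟩
    · rintro ⟨r, hr, _, ⟨φ, hφ, rfl⟩, h⟩
      have hnorm : ‖U.symm φ‖ = 1 := by
        rw [LinearIsometryEquiv.norm_map]
        exact mem_sphere_zero_iff_norm.1 φ.2
      refine ⟨r, hr, _, ⟨⟨U.symm φ, mem_sphere_zero_iff_norm.2 hnorm⟩, ?_, rfl⟩, ?_⟩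
      · have : S ⟨U.symm φ, mem_sphere_zero_iff_norm.2 hnorm⟩ = φ :=
          Subtype.ext (by rw [hS, LinearIsometryEquiv.apply_symm_apply])
        rw [this]
        exact hφ
      · apply U.injective
        rw [← h, map_smul, LinearIsometryEquiv.apply_symm_apply]
  rw [h]
  exact U.measurePreserving.measure_preimage_emb U.toHomeomorph.measurableEmbedding _

instance : Nontrivial (Ket (Fin n)) := by
  refine ⟨⟨EuclideanSpace.single (fun _ => false) 1, 0, fun h => ?_⟩⟩
  have := congrArg (fun ψ : Ket (Fin n) => ψ fun _ => false) h
  simp at this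

instance isProbabilityMeasure_haarState : IsProbabilityMeasure (haarState n) := by
  refine ⟨?_⟩
  rw [haarState, Measure.smul_apply, smul_eq_mul]
  refine ENNReal.inv_mul_cancel ?_ (measure_ne_top _ _)
  rw [Ne, Measure.measure_univ_eq_zero]
  exact Measure.toSphere_ne_zero _

/-- The Haar measure is invariant under isometries. -/
theorem integral_haarState_comp (f : Ket (Fin n) →ₗ[ℝ] Ket (Fin n)) (hf : ∀ ψ, ‖f ψ‖ = ‖ψ‖)
    (F : Ket (Fin n) → ℝ) :
    ∫ ψ, F (f (ψ : Ket (Fin n))) ∂(haarState n) = ∫ ψ, F (ψ : Ket (Fin n)) ∂(haarState n) := by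
  set U : Ket (Fin n) ≃ₗᵢ[ℝ] Ket (Fin n) :=
    LinearIsometry.toLinearIsometryEquiv ⟨f, hf⟩ rfl with hU
  have hUf : ∀ ψ, U ψ = f ψ := fun ψ => rfl
  set S : Metric.sphere (0 : Ket (Fin n)) 1 ≃ₜ Metric.sphere (0 : Ket (Fin n)) 1 :=
    U.toHomeomorph.subtype (fun ψ => by
      simp only [mem_sphere_zero_iff_norm]
      exact (by rw [← U.norm_map ψ]; rfl)) with hS
  have hSU : ∀ ψ, (S ψ : Ket (Fin n)) = U ψ := fun ψ => rfl
  have hmp : MeasurePreserving S (haarState n) (haarState n) := by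
    refine ⟨S.continuous.measurable, ?_⟩
    rw [haarState, Measure.map_smul, map_toSphere_of_isometry U S hSU S.continuous.measurable]
  have := hmp.integral_comp S.measurableEmbedding fun ψ => F (ψ : Ket (Fin n))
  simpa only [hSU, hUf] using this

theorem integrable_haarState {F : Ket (Fin n) → ℝ} (hF : Continuous F) :
    Integrable (fun ψ : Metric.sphere (0 : Ket (Fin n)) 1 => F (ψ : Ket (Fin n))) (haarState n) :=
  (hF.comp continuous_subtype_val).integrable_of_hasCompactSupport
    (HasCompactSupport.of_compactSpace _)

/-- A beam splitter on the amplitudes `j` and `k`. -/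
def beamSplitter (j k : Fin n → Bool) (ω : ℂ) : Ket (Fin n) →ₗ[ℝ] Ket (Fin n) where
  toFun ψ := WithLp.toLp 2 fun t => if t = j then (ψ j + ω * ψ k) / Real.sqrt 2 else
    if t = k then (ψ j - ω * ψ k) / Real.sqrt 2 else ψ t
  map_add' ψ φ := by
    ext t
    simp only [PiLp.add_apply]
    split_ifs <;> ring
  map_smul' r ψ := by
    ext t
    simp only [PiLp.smul_apply, Complex.real_smul, RingHom.id_apply]
    split_ifs <;> ring

theorem norm_beamSplitter {j k : Fin n → Bool} (h : j ≠ k) {ω : ℂ} (hω : ‖ω‖ = 1)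
    (ψ : Ket (Fin n)) : ‖beamSplitter j k ω ψ‖ = ‖ψ‖ := by
  have h2 : ‖(Real.sqrt 2 : ℂ)‖ ^ 2 = 2 := by
    rw [Complex.norm_real, Real.norm_of_nonneg (Real.sqrt_nonneg 2), Real.sq_sqrt (by norm_num)]
  have hpar : ‖(ψ j + ω * ψ k) / (Real.sqrt 2 : ℂ)‖ ^ 2 + ‖(ψ j - ω * ψ k) / (Real.sqrt 2 : ℂ)‖ ^ 2 =
      ‖ψ j‖ ^ 2 + ‖ψ k‖ ^ 2 := by
    have := parallelogram_law_with_norm ℝ (ψ j) (ω * ψ k)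
    rw [norm_mul, hω, one_mul] at this
    rw [norm_div, norm_div, div_pow, div_pow, h2]
    linarith
  have hsum : ∀ F : (Fin n → Bool) → ℝ,
      ∑ t, F t = F j + (F k + ∑ t ∈ (Finset.univ.erase j).erase k, F t) := by
    intro F
    rw [Finset.add_sum_erase _ _ (Finset.mem_erase.2 ⟨h.symm, Finset.mem_univ k⟩),
      Finset.add_sum_erase _ _ (Finset.mem_univ j)]
  have : ‖beamSplitter j k ω ψ‖ ^ 2 = ‖ψ‖ ^ 2 := by
    rw [EuclideanSpace.norm_sq_eq, EuclideanSpace.norm_sq_eq, hsum, hsum (fun t => ‖ψ t‖ ^ 2)]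
    have hj : beamSplitter j k ω ψ j = (ψ j + ω * ψ k) / Real.sqrt 2 := if_pos rfl
    have hk : beamSplitter j k ω ψ k = (ψ j - ω * ψ k) / Real.sqrt 2 :=
      (if_neg h.symm).trans (if_pos rfl)
    rw [hj, hk, ← add_assoc, hpar, add_assoc]
    congr 2
    refine Finset.sum_congr rfl fun t ht => ?_
    rw [Finset.mem_erase, Finset.mem_erase] at ht
    have ht' : beamSplitter j k ω ψ t = ψ t := (if_neg ht.2.1).trans (if_neg ht.1)
    rw [ht']
  exact (sq_eq_sq₀ (norm_nonneg _) (norm_nonneg _)).1 this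

theorem norm_pow_four (a : ℂ) : ‖a‖ ^ 4 = (a.re ^ 2 + a.im ^ 2) ^ 2 := by
  rw [show (4 : ℕ) = 2 * 2 from rfl, pow_mul, Complex.sq_norm, Complex.normSq_apply]
  ring

/-- By invariance the first amplitude may be replaced by (ψ_j + ωψ_k)/√2 for any ω of modulus 1.
Adding the four cases ω = ±1, ±i removes all terms that depend on the relative phase. -/
theorem four_mul_integral_norm_pow_four {j k : Fin n → Bool} (h : j ≠ k) :
    4 * ∫ ψ, ‖(ψ : Ket (Fin n)) j‖ ^ 4 ∂(haarState n) =
      (∫ ψ, ‖(ψ : Ket (Fin n)) j‖ ^ 4 ∂(haarState n)) +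
      (∫ ψ, ‖(ψ : Ket (Fin n)) k‖ ^ 4 ∂(haarState n)) +
      4 * ∫ ψ, ‖(ψ : Ket (Fin n)) j‖ ^ 2 * ‖(ψ : Ket (Fin n)) k‖ ^ 2 ∂(haarState n) := by
  have h₁ : ∀ ω : ℂ, ‖ω‖ = 1 → ∫ ψ, ‖(ψ : Ket (Fin n)) j‖ ^ 4 ∂(haarState n) =
      ∫ ψ, ‖((ψ : Ket (Fin n)) j + ω * (ψ : Ket (Fin n)) k)‖ ^ 4 / 4 ∂(haarState n) := by
    intro ω hω
    rw [← integral_haarState_comp (beamSplitter j k ω) (norm_beamSplitter h hω)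
      fun ψ => ‖ψ j‖ ^ 4]
    congr 1
    funext ψ
    have hj : beamSplitter j k ω (ψ : Ket (Fin n)) j =
      ((ψ : Ket (Fin n)) j + ω * (ψ : Ket (Fin n)) k) / Real.sqrt 2 := if_pos rfl
    have h2 : ‖(Real.sqrt 2 : ℂ)‖ ^ 4 = 4 := by
      rw [Complex.norm_real, Real.norm_of_nonneg (Real.sqrt_nonneg 2),
        show (4 : ℕ) = 2 * 2 from rfl, pow_mul, Real.sq_sqrt (by norm_num)]
      norm_num
    rw [hj, norm_div, div_pow, h2]
  have hI : ∀ ω : ℂ, Integrable (fun ψ : Metric.sphere (0 : Ket (Fin n)) 1 =>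
      ‖((ψ : Ket (Fin n)) j + ω * (ψ : Ket (Fin n)) k)‖ ^ 4 / 4) (haarState n) := fun ω =>
    integrable_haarState (F := fun ψ => ‖(ψ j + ω * ψ k)‖ ^ 4 / 4) (by fun_prop)
  have hj : Integrable (fun ψ : Metric.sphere (0 : Ket (Fin n)) 1 => ‖(ψ : Ket (Fin n)) j‖ ^ 4)
    (haarState n) := integrable_haarState (F := fun ψ => ‖ψ j‖ ^ 4) (by fun_prop)
  have hk : Integrable (fun ψ : Metric.sphere (0 : Ket (Fin n)) 1 => ‖(ψ : Ket (Fin n)) k‖ ^ 4)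
    (haarState n) := integrable_haarState (F := fun ψ => ‖ψ k‖ ^ 4) (by fun_prop)
  have hjk : Integrable (fun ψ : Metric.sphere (0 : Ket (Fin n)) 1 =>
      4 * (‖(ψ : Ket (Fin n)) j‖ ^ 2 * ‖(ψ : Ket (Fin n)) k‖ ^ 2)) (haarState n) :=
    integrable_haarState (F := fun ψ => 4 * (‖ψ j‖ ^ 2 * ‖ψ k‖ ^ 2)) (by fun_prop)
  have hjk' : Integrable (fun ψ : Metric.sphere (0 : Ket (Fin n)) 1 =>
      ‖(ψ : Ket (Fin n)) j‖ ^ 4 + ‖(ψ : Ket (Fin n)) k‖ ^ 4) (haarState n) := hj.add hk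
  have hI₂ : ∀ ω ω' : ℂ, Integrable (fun ψ : Metric.sphere (0 : Ket (Fin n)) 1 =>
      ‖((ψ : Ket (Fin n)) j + ω * (ψ : Ket (Fin n)) k)‖ ^ 4 / 4 +
        ‖((ψ : Ket (Fin n)) j + ω' * (ψ : Ket (Fin n)) k)‖ ^ 4 / 4) (haarState n) := fun ω ω' =>
    (hI ω).add (hI ω')
  rw [← integral_const_mul 4 fun ψ : Metric.sphere (0 : Ket (Fin n)) 1 =>
      ‖(ψ : Ket (Fin n)) j‖ ^ 2 * ‖(ψ : Ket (Fin n)) k‖ ^ 2, ← integral_add hj hk,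
    ← integral_add hjk' hjk]
  have h₂ : 4 * ∫ ψ, ‖(ψ : Ket (Fin n)) j‖ ^ 4 ∂(haarState n) =
      (∫ ψ, ‖((ψ : Ket (Fin n)) j + 1 * (ψ : Ket (Fin n)) k)‖ ^ 4 / 4 ∂(haarState n)) +
      (∫ ψ, ‖((ψ : Ket (Fin n)) j + (-1) * (ψ : Ket (Fin n)) k)‖ ^ 4 / 4 ∂(haarState n)) +
      (∫ ψ, ‖((ψ : Ket (Fin n)) j + Complex.I * (ψ : Ket (Fin n)) k)‖ ^ 4 / 4 ∂(haarState n)) +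
      ∫ ψ, ‖((ψ : Ket (Fin n)) j + (-Complex.I) * (ψ : Ket (Fin n)) k)‖ ^ 4 / 4
        ∂(haarState n) := by
    rw [← h₁ 1 (by simp), ← h₁ (-1) (by simp), ← h₁ Complex.I (by simp),
      ← h₁ (-Complex.I) (by simp)]
    ring
  rw [h₂, add_assoc, ← integral_add (hI _) (hI _), ← integral_add (hI _) (hI _),
    ← integral_add (hI₂ _ _) (hI₂ _ _)]
  congr 1
  funext ψ
  simp only [norm_pow_four, Complex.sq_norm, Complex.normSq_apply]
  simp
  ring

theorem sum_integral_norm_pow_four :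
    ∑ j, ∫ ψ, ‖(ψ : Ket (Fin n)) j‖ ^ 4 ∂(haarState n) = 2 / (2 ^ n + 1) := by
  have hI : ∀ j k, Integrable (fun ψ : Metric.sphere (0 : Ket (Fin n)) 1 =>
      ‖(ψ : Ket (Fin n)) j‖ ^ 2 * ‖(ψ : Ket (Fin n)) k‖ ^ 2) (haarState n) := fun j k =>
    integrable_haarState (F := fun ψ => ‖ψ j‖ ^ 2 * ‖ψ k‖ ^ 2) (by fun_prop)
  have h₁ : ∑ j, ∑ k, ∫ ψ, ‖(ψ : Ket (Fin n)) j‖ ^ 2 * ‖(ψ : Ket (Fin n)) k‖ ^ 2 ∂(haarState n) =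
      1 := by
    have : ∀ j, ∑ k, ∫ ψ, ‖(ψ : Ket (Fin n)) j‖ ^ 2 * ‖(ψ : Ket (Fin n)) k‖ ^ 2 ∂(haarState n) =
        ∫ ψ, ∑ k, ‖(ψ : Ket (Fin n)) j‖ ^ 2 * ‖(ψ : Ket (Fin n)) k‖ ^ 2 ∂(haarState n) := fun j =>
      (integral_finsetSum _ fun k _ => hI j k).symm
    simp only [this]
    rw [← integral_finsetSum _ fun j _ => integrable_finsetSum _ fun k _ => hI j k]
    have h : ∀ ψ : Metric.sphere (0 : Ket (Fin n)) 1,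
        ∑ j, ∑ k, ‖(ψ : Ket (Fin n)) j‖ ^ 2 * ‖(ψ : Ket (Fin n)) k‖ ^ 2 = 1 := by
      intro ψ
      rw [← Finset.sum_mul_sum, ← EuclideanSpace.norm_sq_eq, mem_sphere_zero_iff_norm.1 ψ.2]
      norm_num
    simp only [h]
    simp
  -- For j ≠ k, comparing the identity with the one for exchanged indices shows that all fourth
  -- moments agree and that the mixed moment is half of them. With the sum of all mixed moments
  -- equal to 1 this fixes the sum of the fourth moments.
  have h₂ : ∀ j k, ∫ ψ, ‖(ψ : Ket (Fin n)) j‖ ^ 2 * ‖(ψ : Ket (Fin n)) k‖ ^ 2 ∂(haarState n) =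
      (∫ ψ, ‖(ψ : Ket (Fin n)) j‖ ^ 4 ∂(haarState n)) / 2 +
        if k = j then (∫ ψ, ‖(ψ : Ket (Fin n)) j‖ ^ 4 ∂(haarState n)) / 2 else 0 := by
    intro j k
    split_ifs with h
    · subst h
      rw [add_halves]
      simp only [← pow_add]
    · have ha := four_mul_integral_norm_pow_four (Ne.symm h)
      have hb := four_mul_integral_norm_pow_four h
      simp only [mul_comm (‖(_ : Ket (Fin n)) k‖ ^ 2)] at hb
      linarith
  simp only [h₂, Finset.sum_add_distrib, Finset.sum_ite_eq', Finset.sum_const, Finset.mem_univ,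
    if_true] at h₁
  rw [← Finset.smul_sum, ← Finset.sum_div, Finset.card_univ, Fintype.card_fun, Fintype.card_fin,
    Fintype.card_bool, nsmul_eq_mul] at h₁
  push_cast at h₁
  rw [eq_div_iff (by positivity)]
  linarith

theorem integral_meanOverlap_phaseKet {m N : ℕ} [NeZero N] (C : QCircuit (Fin m × Fin n)) (b : ℕ)
    (θ : (Fin n → Bool) → ZMod N) :
    ∫ ψ, meanOverlap C b (phaseKet θ (ψ : Ket (Fin n))) ∂(haarState n) =
      ∫ ψ, meanOverlap C b (ψ : Ket (Fin n)) ∂(haarState n) := by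
  refine integral_haarState_comp
    { toFun := phaseKet θ
      map_add' := fun ψ φ => ?_
      map_smul' := fun r ψ => ?_ } (norm_phaseKet θ) (meanOverlap C b)
  · ext t
    simp only [phaseKet, PiLp.add_apply]
    ring
  · ext t
    simp only [phaseKet, PiLp.smul_apply, Complex.real_smul, RingHom.id_apply]
    ring

theorem continuous_phaseKet {N : ℕ} [NeZero N] (θ : (Fin n → Bool) → ZMod N) :
    Continuous (phaseKet θ) := by
  unfold phaseKet
  fun_prop

theorem integral_phase_bound (c s : ℝ) :
    ∫ ψ, c * ((s + (∑ t, ‖(ψ : Ket (Fin n)) t‖ ^ 4) / s) / 2) ∂(haarState n) =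
      c * ((s + (2 / (2 ^ n + 1)) / s) / 2) := by
  have h₄ : ∀ j, Integrable (fun ψ : Metric.sphere (0 : Ket (Fin n)) 1 =>
      ‖(ψ : Ket (Fin n)) j‖ ^ 4) (haarState n) := fun j =>
    integrable_haarState (F := fun ψ => ‖ψ j‖ ^ 4) (by fun_prop)
  rw [integral_const_mul, integral_div, integral_add (integrable_const _)
    ((integrable_finsetSum _ fun j _ => h₄ j).div_const _), integral_div,
    integral_finsetSum _ fun j _ => h₄ j, sum_integral_norm_pow_four]
  simp

/-- Each choice of phases leaves the Haar mean unchanged, so their number times the mean is the mean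
of the sum over phases, which is bounded pointwise in ψ. -/
theorem mul_integral_meanOverlap_le {m N : ℕ} [NeZero N] (hN : m + 2 ≤ N)
    (C : QCircuit (Fin m × Fin n)) (b : ℕ) {s : ℝ} (hs : 0 < s) :
    Fintype.card ((Fin n → Bool) → ZMod N) *
      ∫ ψ, meanOverlap C b (ψ : Ket (Fin n)) ∂(haarState n) ≤
    Fintype.card ((Fin n → Bool) → ZMod N) *
      ((m + 1) * ((s + (2 / (2 ^ n + 1)) / s) / 2)) := by
  have hG : ∀ θ : (Fin n → Bool) → ZMod N,
      Integrable (fun ψ : Metric.sphere (0 : Ket (Fin n)) 1 =>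
        meanOverlap C b (phaseKet θ (ψ : Ket (Fin n)))) (haarState n) := fun θ =>
    integrable_haarState (F := fun ψ => meanOverlap C b (phaseKet θ ψ))
      ((continuous_meanOverlap C b).comp (continuous_phaseKet θ))
  have h₁ : Fintype.card ((Fin n → Bool) → ZMod N) *
      ∫ ψ, meanOverlap C b (ψ : Ket (Fin n)) ∂(haarState n) =
      ∫ ψ, ∑ θ : (Fin n → Bool) → ZMod N, meanOverlap C b (phaseKet θ (ψ : Ket (Fin n)))
        ∂(haarState n) := by
    rw [integral_finsetSum _ fun θ _ => hG θ]
    simp only [integral_meanOverlap_phaseKet, Finset.sum_const, Finset.card_univ, nsmul_eq_mul]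
  rw [h₁, ← mul_assoc, ← integral_phase_bound]
  refine integral_mono (integrable_finsetSum _ fun θ _ => hG θ)
    (integrable_haarState (F := fun ψ => _ * ((s + (∑ t, ‖ψ t‖ ^ 4) / s) / 2))
      (by fun_prop)) fun ψ => ?_
  rw [mul_assoc]
  exact sum_meanOverlap_phaseKet_le C hN b _ (mem_sphere_zero_iff_norm.1 ψ.2) hs

/-- For Haar random states, no circuit that is found from `m` copies prepares a similar state. -/
theorem integral_meanOverlap_le {m : ℕ} (C : QCircuit (Fin m × Fin n)) (b : ℕ) :
    ∫ ψ, meanOverlap C b (ψ : Ket (Fin n)) ∂(haarState n) ≤ (m + 1) * Real.sqrt (2 / 2 ^ n) := by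
  set s := Real.sqrt (2 / 2 ^ n) with hs
  have hs0 : 0 < s := Real.sqrt_pos.2 (by positivity)
  have hs2 : s ^ 2 = 2 / 2 ^ n := Real.sq_sqrt (by positivity)
  -- Here N = m + 2 is the least admissible order of the phases, and s = √(2/2^n) balances the two
  -- terms up to replacing 2^n + 1 by 2^n.
  have h := le_of_mul_le_mul_left (mul_integral_meanOverlap_le le_rfl C b hs0)
    (Nat.cast_pos.2 Fintype.card_pos)
  have h₅ : 2 / (2 ^ n + 1) / s ≤ s := by
    rw [div_le_iff₀ hs0, ← pow_two, hs2]
    gcongr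
    linarith
  refine h.trans ?_
  gcongr
  linarith

end Haar

end

end QLearn

namespace QLearn

noncomputable section

/-! ### The advantage and its asymptotics -/

section Distinguishing

/-- The advantage of the distinguisher that is built from a learner. -/
theorem le_abs_probOf_distinguisher_sub {m n b : ℕ} (C : QCircuit (Fin m × Fin n))
    {ρ : Op (Fin n)} (hρ : IsPureState ρ) {η lam : ℝ} (hη : 0 < η) (hlam : 0 < lam)
    (h : 1 - (1 - lam) ≤ C.probOf (copies m ρ)
      fun s => traceDist ρ (preparedState n b s) ≤ 1 - η) :
    (1 - (m + 1) * Real.sqrt (2 / 2 ^ n) / (η * lam)) / 2 * η * lam ≤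
      |(distinguisher C b).probOf (copies (m + 1) ρ) (fun s => s = [true]) -
        ∫ ψ, (distinguisher C b).probOf (copies (m + 1) (ketBra (ψ : Ket (Fin n))))
          (fun s => s = [true]) ∂(haarState n)| := by
  obtain ⟨ψ, hψ, rfl⟩ := hρ
  have h₁ : η * lam ≤ meanOverlap C b ψ := by
    refine le_trans ?_ (mul_probOf_le_meanOverlap C ψ hψ η)
    exact mul_le_mul_of_nonneg_left (by linarith) hη.le
  have h₂ := integral_meanOverlap_le C b
  have h₃ : ∫ ψ, (distinguisher C b).probOf (copies (m + 1) (ketBra (ψ : Ket (Fin n))))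
      (fun s => s = [true]) ∂(haarState n) =
      (1 - ∫ ψ, meanOverlap C b (ψ : Ket (Fin n)) ∂(haarState n)) / 2 := by
    have h₄ : ∀ ψ : Metric.sphere (0 : Ket (Fin n)) 1,
        (distinguisher C b).probOf (copies (m + 1) (ketBra (ψ : Ket (Fin n))))
          (fun s => s = [true]) = (1 - meanOverlap C b (ψ : Ket (Fin n))) / 2 := fun ψ =>
      probOf_distinguisher_eq C b _ (mem_sphere_zero_iff_norm.1 ψ.2)
    simp only [h₄]
    rw [integral_div, integral_sub (integrable_const _)
      (integrable_haarState (continuous_meanOverlap C b))]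
    simp
  rw [h₃, probOf_distinguisher_eq C b ψ hψ]
  -- Output 1 means that the swap test fails, which is less likely on the class than for Haar random
  -- states; hence the negative sign.
  refine le_trans ?_ (neg_le_abs _)
  have h₅ : (1 - (m + 1) * Real.sqrt (2 / 2 ^ n) / (η * lam)) / 2 * η * lam =
      (η * lam - (m + 1) * Real.sqrt (2 / 2 ^ n)) / 2 := by
    field_simp
  rw [h₅]
  linarith

theorem eventually_le_of_isLittleO {f : ℕ → ℝ} (hf : f =o[atTop] fun n : ℕ => (n : ℝ)) :
    ∀ᶠ n : ℕ in atTop, (2 : ℝ) ^ f n ≤ ((2 : ℝ) ^ (1 / 16 : ℝ)) ^ n := by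
  filter_upwards [hf.bound (c := 1 / 16) (by norm_num)] with n hn
  rw [← Real.rpow_natCast, ← Real.rpow_mul (by norm_num)]
  refine Real.rpow_le_rpow_of_exponent_le (by norm_num) ?_
  rw [Real.norm_of_nonneg (Nat.cast_nonneg n)] at hn
  exact (le_abs_self _).trans hn

/-- With r = 2^{n/16}, eventually m ≤ r and η, λ ≥ 1/r, whereas √(2/2^n) ≤ 2/r⁸. The quotient is
thus at most a constant times r^{-5}, of which the bound 4/r is enough. -/
theorem tendsto_haar_error {m : ℕ → ℕ} {η lam : ℕ → ℝ}
    (hη : ∃ f : ℕ → ℝ, f =o[atTop] (fun n : ℕ => (n : ℝ)) ∧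
      ∀ᶠ n in atTop, (2 : ℝ) ^ (-f n) ≤ η n)
    (hlam : ∃ f : ℕ → ℝ, f =o[atTop] (fun n : ℕ => (n : ℝ)) ∧
      ∀ᶠ n in atTop, (2 : ℝ) ^ (-f n) ≤ lam n)
    (hm : ∃ f : ℕ → ℝ, f =o[atTop] (fun n : ℕ => (n : ℝ)) ∧
      ∀ᶠ n in atTop, (m n : ℝ) ≤ (2 : ℝ) ^ f n) :
    Tendsto (fun n => (m n + 1) * Real.sqrt (2 / 2 ^ n) / (η n * lam n)) atTop (𝓝 0) := by
  obtain ⟨f, hf, hη⟩ := hη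
  obtain ⟨f', hf', hlam⟩ := hlam
  obtain ⟨f'', hf'', hm⟩ := hm
  -- The exponent 1/16 is one convenient choice: it makes √(2^n) an integral power of r and leaves
  -- ample room for the factors m, 1/η and 1/λ.
  set q : ℝ := (2 : ℝ) ^ (1 / 16 : ℝ) with hq
  have hq1 : 1 < q := Real.one_lt_rpow (by norm_num) (by norm_num)
  have hq16 : q ^ 16 = 2 := by
    rw [hq, ← Real.rpow_natCast, ← Real.rpow_mul (by norm_num)]
    norm_num
  have hlim : Tendsto (fun n : ℕ => 4 * (q ^ n)⁻¹) atTop (𝓝 0) := by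
    have := (tendsto_inv_atTop_zero.comp (tendsto_pow_atTop_atTop_of_one_lt hq1)).const_mul 4
    rwa [mul_zero] at this
  have hinv : ∀ {g η : ℕ → ℝ}, g =o[atTop] (fun n : ℕ => (n : ℝ)) →
      (∀ᶠ n in atTop, (2 : ℝ) ^ (-g n) ≤ η n) → ∀ᶠ n in atTop, 0 < η n ∧ 1 ≤ η n * q ^ n := by
    intro g η hg h
    filter_upwards [eventually_le_of_isLittleO hg, h] with n h₁ h₂
    have h₃ : 0 < η n := (Real.rpow_pos_of_pos (by norm_num) _).trans_le h₂
    refine ⟨h₃, ?_⟩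
    calc (1 : ℝ) = (2 : ℝ) ^ (-g n) * (2 : ℝ) ^ g n := by
          rw [← Real.rpow_add (by norm_num)]; simp
      _ ≤ η n * q ^ n := by gcongr
  refine squeeze_zero' (g := fun n : ℕ => 4 * (q ^ n)⁻¹) ?_ ?_ hlim
  · filter_upwards [hinv hf hη, hinv hf' hlam] with n h₁ h₂
    have := h₁.1
    have := h₂.1
    positivity
  · filter_upwards [hinv hf hη, hinv hf' hlam, eventually_le_of_isLittleO hf'', hm]
      with n h₁ h₂ h₃ h₄
    set r := q ^ n with hr
    have hr1 : 1 ≤ r := one_le_pow₀ hq1.le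
    have hr0 : 0 < r := one_pos.trans_le hr1
    have h16 : (2 : ℝ) ^ n = r ^ 16 := by
      rw [hr, ← pow_mul, mul_comm, pow_mul, hq16]
    have hsqrt : Real.sqrt (2 / 2 ^ n) ≤ 2 / r ^ 8 := by
      refine Real.sqrt_le_iff.2 ⟨by positivity, ?_⟩
      have h8 : (r ^ 8) ^ 2 = r ^ 16 := by rw [← pow_mul]
      rw [h16, div_pow, h8]
      gcongr
      norm_num
    have hden : 1 ≤ η n * lam n * (r * r) := by
      calc (1 : ℝ) = 1 * 1 := (one_mul 1).symm
        _ ≤ (η n * r) * (lam n * r) :=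
          mul_le_mul h₁.2 h₂.2 zero_le_one (zero_le_one.trans h₁.2)
        _ = _ := by ring
    have hpos : 0 < η n * lam n := mul_pos h₁.1 h₂.1
    have hm' : (m n : ℝ) + 1 ≤ 2 * r := by linarith [h₄.trans h₃]
    rw [div_le_iff₀ hpos]
    calc ((m n : ℝ) + 1) * Real.sqrt (2 / 2 ^ n) ≤ 2 * r * (2 / r ^ 8) := by gcongr
      _ = 4 * r⁻¹ * (1 / (r ^ 2 * r ^ 4)) := by field_simp; norm_num
      _ ≤ 4 * r⁻¹ * (1 / (r ^ 2 * 1)) := by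
          gcongr
          exact one_le_pow₀ hr1
      _ ≤ 4 * r⁻¹ * (η n * lam n) := by
          gcongr
          rw [div_le_iff₀ (by positivity)]
          linarith

end Distinguishing

end

end QLearn

theorem mainTheorem9
    (𝒞 : ∀ n : ℕ, Set (Op (Fin n)))
    (h𝒞 : ∀ n, 1 ≤ n → ∀ ρ ∈ 𝒞 n, IsPureState ρ)
    (m : ℕ → ℕ) (t η lam : ℕ → ℝ)
    (ht_pos : ∀ n, 0 < t n)
    (ht : (fun n : ℕ => (n : ℝ)) =O[atTop] t)
    (hη : ∃ f : ℕ → ℝ, f =o[atTop] (fun n : ℕ => (n : ℝ)) ∧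
      ∀ᶠ n in atTop, (2 : ℝ) ^ (-f n) ≤ η n)
    (hlam : ∃ f : ℕ → ℝ, f =o[atTop] (fun n : ℕ => (n : ℝ)) ∧
      ∀ᶠ n in atTop, (2 : ℝ) ^ (-f n) ≤ lam n)
    (hm : ∃ f : ℕ → ℝ, f =o[atTop] (fun n : ℕ => (n : ℝ)) ∧
      ∀ᶠ n in atTop, (m n : ℝ) ≤ (2 : ℝ) ^ f n)
    (hlearn : Learnable 𝒞 m t (fun n => 1 - η n) (fun n => 1 - lam n)) :
    ∃ g : ℕ → ℝ, Tendsto g atTop (𝓝 0) ∧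
      Distinguishable 𝒞 (fun n => m n + 1) (fun n => t n * Real.logb 2 (t n))
        (fun n => (1 - g n) / 2 * η n * lam n) := by
  obtain ⟨C, a, hC, ha, hl⟩ := hlearn
  -- The error function g is the Haar bound (m + 1)√(2/2^n) divided by ηλ.
  refine ⟨_, tendsto_haar_error hη hlam hm, fun n => distinguisher (C n) (a n),
    timeUniform_distinguisher ht_pos ht hC ha, fun _ => rfl, ?_⟩
  obtain ⟨f, -, hη⟩ := hη
  obtain ⟨f', -, hlam⟩ := hlam
  -- For large n the lower bounds make η and λ positive, which is needed to divide by their product.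
  filter_upwards [eventually_ge_atTop 1, hη, hlam] with n hn h₁ h₂ ρ hρ
  exact le_abs_probOf_distinguisher_sub (C n) (h𝒞 n hn ρ hρ)
    ((Real.rpow_pos_of_pos (by norm_num) _).trans_le h₁)
    ((Real.rpow_pos_of_pos (by norm_num) _).trans_le h₂) (hl n hn ρ hρ)
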